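/- **Setting.** A graphon is a measurable symmetric function $f:[0,1]^2\to[0,1]$. For graphons $f,g$ let $d_\square(f,g)=\sup_{S,T\subseteq[0,1]}\left|\int_{S\times T}(f-g)\,dx\,dy\right|$ (over measurable $S,T$) and $\delta_\square(f,g)=\inf_{\phi}d_\square(f,g^{\phi})$, where $\phi$ runs over the measure-preserving bijections of $[0,1]$ and $g^\phi(x,y)=g(\phi(x),\phi(y))$. Graphons at $\delta_\square$-distance $0$ are identified. For a finite simple graph $H$ on the vertex set $V$ let $t(H,f)=\int_{[0,1]^V}\prod_{ij\in E(H)}f(x_i,x_j)\,dx$. For $p,u\in[0,1]$ let $h_p(u)=u\log\frac up+(1-u)\log\frac{1-u}{1-p}\in[0,\infty]$ (with $0\log 0=0\log\frac00=0$). For a graphon $W$ let $I_W(f)=\frac12\int_{[0,1]^2}h_{W(x,y)}(f(x,y))\,dx\,dy$. Let $\mathcal W_\Omega$ be the set of graphons $g$ with $g=W$ almost everywhere on $\{W\in\{0,1\}\}$. Put $$J_W(f)=\sup_{\eta>0}\ \inf\{I_W(h):\delta_\square(f,h)\le\eta\}$$ if $\delta_\square(f,g)=0$ for some $g\in\mathcal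 W_\Omega$, and $J_W(f)=\infty$ otherwise. For $0<\gamma<1$ and $a,b,c\in[0,1]$ let $f^\gamma_{a,b,c}$ be the graphon equal to $a$ on $[0,\gamma]^2$, to $c$ on $(\gamma,1]^2$ and to $b$ elsewhere. Let $\widetilde{\mathcal B}^{\gamma}$ be the set of graphons $g$ with $\delta_\square(g,f^\gamma_{a,b,c})=0$ for some $a,b,c\in[0,1]$. **Theorem 1.6.** Let $0<\gamma<1$, let $H$ be a finite $d$-regular simple graph with at least one vertex and with $d\ge2$, let $t\in\mathbb R$, and assume that one of the following holds: 1. $W_p=f^\gamma_{0,p,p}$ for all $p\in[0,1]$, and $0<t<t(H,f^\gamma_{0,0,1})$; 2. $W_p=f^\gamma_{1,p,p}$ for all $p\in[0,1]$, and $t(H,f^\gamma_{1,0,0})<t<1$; 3. $W_p=f^\gamma_{1,p,0}$ for all $p\in[0,1]$, and $t(H,f^\gamma_{1,0,0})<t<t(H,f^\gamma_{1,1,0})$. Then there is $p_0>0$ such that for every $p\in[0,1]$ with $0<p<p_0$ both minima below are attained and $$\min\{J_{W_p}(g):t(H,g)\ge t\}<\min\{J_{W_p}(g):g\in\widetilde{\mathcal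 B}^{\gamma},\ t(H,g)\ge t\}.$$ Moreover, for each such $p$, no minimizer $g$ of $J_{W_p}$ subject to $t(H,g)\ge t$ belongs to $\widetilde{\mathcal B}^{\gamma}$ (every optimizer is non-symmetric). -/

import Mathlib

open MeasureTheory
open scoped unitInterval ENNReal

noncomputable section

/-- A graphon: a measurable symmetric function `[0,1]² → [0,1]`. -/
structure Graphon where
  toFun : I → I → ℝ
  measurable_toFun : Measurable (Function.uncurry toFun)
  symm_toFun : ∀ x y, toFun x y = toFun y x
  mem_Icc_toFun : ∀ x y, toFun x y ∈ Set.Icc (0 : ℝ) 1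

namespace Graphon

instance : CoeFun Graphon (fun _ => I → I → ℝ) := ⟨Graphon.toFun⟩

/-- The set `𝓜` of bijective, Lebesgue measure preserving maps `[0,1] → [0,1]`. -/
def MeasurePreservingBij : Type :=
  {φ : I → I // Function.Bijective φ ∧ MeasurePreserving φ volume volume}

/-- The relabelled graphon `g^φ(x,y) = g(φ x, φ y)`. -/
def relabel (g : Graphon) (φ : MeasurePreservingBij) : Graphon where
  toFun x y := g (φ.1 x) (φ.1 y)
  measurable_toFun := by
    have hφ : Measurable φ.1 := φ.2.2.measurable
    exact g.measurable_toFun.comp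
      ((hφ.comp measurable_fst).prodMk (hφ.comp measurable_snd))
  symm_toFun x y := g.symm_toFun _ _
  mem_Icc_toFun x y := g.mem_Icc_toFun _ _

/-- The cut distance `d_□(f,g) = sup_{S,T} |∫_{S×T} (f - g)|`, over measurable `S, T ⊆ [0,1]`.
The supremum is over a nonempty set of reals bounded by `1`. -/
def cutDist (f g : Graphon) : ℝ :=
  sSup {r : ℝ | ∃ S T : Set I, MeasurableSet S ∧ MeasurableSet T ∧
    r = |∫ z in S ×ˢ T, (f z.1 z.2 - g z.1 z.2)|}

/-- The cut metric `δ_□(f,g) = inf_{φ ∈ 𝓜} d_□(f, g^φ)`. It is a pseudometric on graphons; the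
points of the quotient space are the classes of graphons at `δ_□`-distance `0`. -/
def cutMetric (f g : Graphon) : ℝ :=
  ⨅ φ : MeasurePreservingBij, cutDist f (g.relabel φ)

/-- The homomorphism density
`t(H,f) = ∫_{[0,1]^V} ∏_{ij ∈ E(H)} f(x_i, x_j) dx`; each (unordered) edge contributes one
factor. -/
def homDensity {V : Type*} [Fintype V] (H : SimpleGraph V) [Fintype H.edgeSet]
    (f : Graphon) : ℝ :=
  ∫ x : V → I, ∏ e ∈ H.edgeFinset,
    Sym2.lift ⟨fun i j => f (x i) (x j), fun _ _ => f.symm_toFun _ _⟩ e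

/-- The relative entropy `h_p(u) = u log (u/p) + (1-u) log ((1-u)/(1-p))` for `p, u ∈ [0,1]`, with
values in `[0,∞]`. It is `∞` exactly when `p = 0 ≠ u` or `p = 1 ≠ u`. Otherwise the real expression
(with `0 log 0 = 0 log (0/0) = 0`) is nonnegative by Gibbs' inequality, see
`relEntropy_formula_nonneg`. -/
def relEntropy (p u : ℝ) : ℝ≥0∞ :=
  open Classical in
  if (p = 0 ∧ u ≠ 0) ∨ (p = 1 ∧ u ≠ 1) then ⊤
  else ENNReal.ofReal (u * Real.log (u / p) + (1 - u) * Real.log ((1 - u) / (1 - p)))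

/-- `ENNReal.ofReal` truncates nothing in `relEntropy`. -/
theorem relEntropy_formula_nonneg {p u : ℝ} (hp : p ∈ Set.Icc (0 : ℝ) 1)
    (hu : u ∈ Set.Icc (0 : ℝ) 1) (h : ¬((p = 0 ∧ u ≠ 0) ∨ (p = 1 ∧ u ≠ 1))) :
    0 ≤ u * Real.log (u / p) + (1 - u) * Real.log ((1 - u) / (1 - p)) := by
  have key : ∀ a b : ℝ, 0 ≤ a → 0 ≤ b → (b = 0 → a = 0) → a - b ≤ a * Real.log (a / b) := by
    intro a b ha hb hab
    rcases ha.eq_or_lt with rfl | ha'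
    · simpa using hb
    have hb' : 0 < b := lt_of_le_of_ne hb (fun h0 => ha'.ne' (hab h0.symm))
    have h1 := Real.one_sub_inv_le_log_of_pos (div_pos ha' hb')
    have h2 := mul_le_mul_of_nonneg_left h1 ha
    have h3 : a * (1 - (a / b)⁻¹) = a - b := by field_simp
    linarith
  push Not at h
  have h1 := key u p hu.1 hp.1 h.1
  have h2 := key (1 - u) (1 - p) (by linarith [hu.2]) (by linarith [hp.2])
    (fun h0 => by linarith [h.2 (by linarith)])
  linarith

/-- `I_W(f) = ½ ∫_{[0,1]²} h_{W(x,y)}(f(x,y)) dx dy`, with values in `[0,∞]`. -/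
def entropy (W f : Graphon) : ℝ≥0∞ :=
  (1 / 2) * ∫⁻ z : I × I, relEntropy (W z.1 z.2) (f z.1 z.2)

/-- `f ∈ 𝓦_Ω`, where `Ω = {W ∈ (0,1)}`: `f` agrees with `W` almost everywhere off `Ω`. -/
def AgreesOffOmega (W f : Graphon) : Prop :=
  volume {z : I × I | W z.1 z.2 ∉ Set.Ioo (0 : ℝ) 1 ∧ f z.1 z.2 ≠ W z.1 z.2} = 0

/-- The rate function `J_W` at the class of `f`:
`sup_{η > 0} inf {I_W(h) : δ_□(f,h) ≤ η}` if some `g ∈ 𝓦_Ω` has `δ_□(f,g) = 0`, else `∞`. -/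
def rate (W f : Graphon) : ℝ≥0∞ :=
  open Classical in
  if ∃ g : Graphon, AgreesOffOmega W g ∧ cutMetric f g = 0 then
    ⨆ (η : ℝ) (_ : 0 < η), ⨅ (h : Graphon) (_ : cutMetric f h ≤ η), entropy W h
  else ⊤

/-- The two-block graphon `f^γ_{a,b,c}`: `a` on `[0,γ]²`, `c` on `(γ,1]²`, and `b` elsewhere. -/
def twoBlock (γ : ℝ) (a b c : I) : Graphon where
  toFun x y :=
    if (x : ℝ) ≤ γ ∧ (y : ℝ) ≤ γ then (a : ℝ)
    else if γ < (x : ℝ) ∧ γ < (y : ℝ) then (c : ℝ) else (b : ℝ)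
  measurable_toFun := by
    have hx : Measurable (fun z : I × I => (z.1 : ℝ)) := measurable_subtype_coe.comp measurable_fst
    have hy : Measurable (fun z : I × I => (z.2 : ℝ)) := measurable_subtype_coe.comp measurable_snd
    exact Measurable.ite
      ((measurableSet_le hx measurable_const).inter (measurableSet_le hy measurable_const))
      measurable_const
      (Measurable.ite
        ((measurableSet_lt measurable_const hx).inter (measurableSet_lt measurable_const hy))
        measurable_const measurable_const)
  symm_toFun x y := by
    simp only [and_comm]
  mem_Icc_toFun x y := by
    split_ifs
    exacts [a.2, c.2, b.2]

/-- The class of `f` lies in `𝓑̃^{(γ,1-γ)}`: `f` is at `δ_□`-distance `0` from a block graphon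
with the two blocks `[0,γ]` and `(γ,1]`. -/
def IsSymmetric (γ : ℝ) (f : Graphon) : Prop :=
  ∃ a b c : I, cutMetric f (twoBlock γ a b c) = 0

/-- (The class of) `g` minimizes `J_W` subject to `t(H,·) ≥ t`. -/
def IsOptimizer {V : Type*} [Fintype V] (H : SimpleGraph V) [Fintype H.edgeSet]
    (W : Graphon) (t : ℝ) (g : Graphon) : Prop :=
  t ≤ homDensity H g ∧ ∀ f : Graphon, t ≤ homDensity H f → rate W g ≤ rate W f

end Graphon

end

/-! For small `p` the relative entropy merely counts mass. Binary entropy is at most log 2, so for a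
reference `W` with values in {0, 1, p} the entropy of `g` is at least half of log(1/p) (∫ g - |{W =
1}|) - log 2, and for p ≤ 1/2 a 0-1 valued graphon that agrees with `W` on {W ∈ {0,1}} satisfies the
reverse bound with + log 2 (`le_entropy`, `entropy_le`). If a competitor beats all symmetric
candidates in mass by a gap independent of `p`, it therefore beats them in entropy once log(1/p) is
large.

Symmetric graphons waste mass. In the first two cases write t = s^|V|. The indicator of a square of
side s has density t and mass s². Hölder's inequality on a d-regular graph gives t(H,f)² ≤ (∫
f^d)^|V| (`sq_homDensity_le`), so density at least t forces mass at least s². For two-block graphons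
the mass is strictly larger, apart from the indicators of the two block squares and the constant 1
(`sq_lt_blockMass`): equality would force all values into {0,1}, and the other patterns of zeros and
ones are excluded by counting colourings of H or by a perturbation. In the third case only the value
b of the off-diagonal blocks is free. The density depends on (1-γ)b^d and the mass on (1-γ)b;
joining the first block fully to an interval of length r ≤ (1-γ)b^d instead is cheaper because d ≥ 2
(`exists_initialHub`). Compactness of the parameter cube makes these strict inequalities uniform
(`exists_mass_gap`).

Symmetry is meant up to relabelling, so the square [0,γ]² on which the reference forces a value w ∈
{0,1} may correspond to the second block of the equivalent two-block graphon. This needs γ ≤ 1/2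
(`exists_overlap`). If γ < 1/2, mass comparison may fail in the first two cases, but then `g` equals
w on a nonnegligible part of {W = p} (`sq_le_volume_eq`). For w = 0, raising `g` to the reference
lowers the entropy; for w = 1, a cut by ε saves an amount of order ε log(1/ε), whereas restoring the
density costs O(ε) (`exists_entropy_lt_of_volume_one`).

To pass from the entropy to the rate function, one uses that the reference is invariant under
relabellings that preserve the blocks. With these relabellings alone the graphons still form a
compact space (weak regularity and weak limits), on which the entropy is lower semicontinuous. Hence
the rate of `f` is the minimum of the entropy over the class of `f` (`exists_entropy_eq_rate`), all
minima are attained, and it suffices to lower the entropy of each admissible symmetric graphon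
(`rate_optimizers_not_symmetric`). -/

open Filter Topology

namespace Graphon

/-! ### The group of relabellings -/

namespace MeasurePreservingBij

theorem measurableEmbedding (φ : MeasurePreservingBij) : MeasurableEmbedding φ.1 :=
  φ.2.2.measurable.measurableEmbedding φ.2.1.injective

/-- A measure preserving bijection as a measurable equivalence. -/
noncomputable def toMeasurableEquiv (φ : MeasurePreservingBij) : I ≃ᵐ I where
  toEquiv := Equiv.ofBijective φ.1 φ.2.1
  measurable_toFun := φ.2.2.measurable
  measurable_invFun := by
    intro s hs
    have : (Equiv.ofBijective φ.1 φ.2.1).symm ⁻¹' s = φ.1 '' s := by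
      rw [← Equiv.image_eq_preimage_symm]; rfl
    change MeasurableSet ((Equiv.ofBijective φ.1 φ.2.1).symm ⁻¹' s)
    rw [this]
    exact φ.measurableEmbedding.measurableSet_image' hs

noncomputable instance : Group MeasurePreservingBij where
  mul φ ψ := ⟨φ.1 ∘ ψ.1, φ.2.1.comp ψ.2.1, φ.2.2.comp ψ.2.2⟩
  one := ⟨id, Function.bijective_id, MeasurePreserving.id _⟩
  inv φ := ⟨φ.toMeasurableEquiv.symm, φ.toMeasurableEquiv.symm.bijective,
    MeasurePreserving.symm φ.toMeasurableEquiv φ.2.2⟩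
  mul_assoc _ _ _ := rfl
  one_mul _ := rfl
  mul_one _ := rfl
  inv_mul_cancel φ := Subtype.ext (funext fun x => φ.toMeasurableEquiv.symm_apply_apply x)

theorem mul_val (φ ψ : MeasurePreservingBij) : (φ * ψ).1 = φ.1 ∘ ψ.1 := rfl

theorem one_val : (1 : MeasurePreservingBij).1 = id := rfl

theorem apply_inv_apply (φ : MeasurePreservingBij) (x : I) : φ.1 ((φ⁻¹).1 x) = x :=
  congrFun (congrArg Subtype.val (mul_inv_cancel φ)) x

theorem inv_apply_apply (φ : MeasurePreservingBij) (x : I) : (φ⁻¹).1 (φ.1 x) = x :=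
  congrFun (congrArg Subtype.val (inv_mul_cancel φ)) x

theorem measurePreserving_prodMap (φ : MeasurePreservingBij) :
    MeasurePreserving (Prod.map φ.1 φ.1) (volume : Measure (I × I)) volume :=
  φ.2.2.prod φ.2.2

theorem measurableEmbedding_prodMap (φ : MeasurePreservingBij) :
    MeasurableEmbedding (Prod.map φ.1 φ.1) :=
  φ.measurePreserving_prodMap.measurable.measurableEmbedding
    (φ.2.1.injective.prodMap φ.2.1.injective)

end MeasurePreservingBij

theorem ext' {f g : Graphon} (h : ∀ x y, f x y = g x y) : f = g := by
  cases f; cases g; congr; funext x y; exact h x y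

theorem relabel_mul (g : Graphon) (φ ψ : MeasurePreservingBij) :
    g.relabel (φ * ψ) = (g.relabel φ).relabel ψ := rfl

theorem relabel_one (g : Graphon) : g.relabel 1 = g := rfl

theorem measurable_uncurry (f : Graphon) : Measurable fun z : I × I => f z.1 z.2 :=
  f.measurable_toFun

theorem nonneg (f : Graphon) (x y : I) : 0 ≤ f x y := (f.mem_Icc_toFun x y).1

theorem le_one (f : Graphon) (x y : I) : f x y ≤ 1 := (f.mem_Icc_toFun x y).2

theorem integrable_uncurry (f : Graphon) : Integrable fun z : I × I => f z.1 z.2 :=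
  Integrable.of_bound f.measurable_uncurry.aestronglyMeasurable 1
    (.of_forall fun z => by
      rw [Real.norm_eq_abs, abs_of_nonneg (f.nonneg _ _)]; exact f.le_one _ _)

theorem integrable_sub (f g : Graphon) :
    Integrable fun z : I × I => f z.1 z.2 - g z.1 z.2 :=
  f.integrable_uncurry.sub g.integrable_uncurry

theorem abs_sub_le_one (f g : Graphon) (x y : I) : |f x y - g x y| ≤ 1 := by
  rw [abs_le]
  constructor <;> linarith [f.nonneg x y, f.le_one x y, g.nonneg x y, g.le_one x y]

/-! ### Rectangle integrals and the cut distance -/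

/-- All rectangle integrals of the kernel `k` are at most `r` in absolute value. -/
def CutLE (k : I × I → ℝ) (r : ℝ) : Prop :=
  ∀ S T : Set I, MeasurableSet S → MeasurableSet T → |∫ z in S ×ˢ T, k z| ≤ r

theorem CutLE.add {k l : I × I → ℝ} {r s : ℝ} (hk : CutLE k r) (hl : CutLE l s)
    (hki : Integrable k) (hli : Integrable l) : CutLE (fun z => k z + l z) (r + s) := by
  intro S T hS hT
  rw [integral_add hki.integrableOn hli.integrableOn]
  exact (abs_add_le _ _).trans (add_le_add (hk S T hS hT) (hl S T hS hT))

theorem CutLE.neg {k : I × I → ℝ} {r : ℝ} (hk : CutLE k r) : CutLE (fun z => -k z) r := by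
  intro S T hS hT
  rw [integral_neg, abs_neg]
  exact hk S T hS hT

theorem CutLE.mono {k : I × I → ℝ} {r s : ℝ} (hk : CutLE k r) (h : r ≤ s) : CutLE k s :=
  fun S T hS hT => (hk S T hS hT).trans h

theorem cutLE_of_integral_abs_le {k : I × I → ℝ} {r : ℝ} (hki : Integrable k)
    (h : ∫ z, |k z| ≤ r) : CutLE k r := by
  intro S T _ _
  calc |∫ z in S ×ˢ T, k z| ≤ ∫ z in S ×ˢ T, |k z| := abs_integral_le_integral_abs
    _ ≤ ∫ z, |k z| := setIntegral_le_integral hki.abs (.of_forall fun z => abs_nonneg _)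
    _ ≤ r := h

/-- Bijectivity makes every rectangle the preimage of a rectangle, so relabelling only permutes the
rectangle integrals. -/
theorem CutLE.comp {k : I × I → ℝ} {r : ℝ} (hk : CutLE k r) (φ : MeasurePreservingBij) :
    CutLE (fun z => k (φ.1 z.1, φ.1 z.2)) r := by
  intro S T hS hT
  have h1 : S = φ.1 ⁻¹' ((φ⁻¹).1 ⁻¹' S) := by
    ext x; simp [φ.inv_apply_apply]
  have h2 : T = φ.1 ⁻¹' ((φ⁻¹).1 ⁻¹' T) := by
    ext x; simp [φ.inv_apply_apply]
  have h3 : S ×ˢ T = Prod.map φ.1 φ.1 ⁻¹' (((φ⁻¹).1 ⁻¹' S) ×ˢ ((φ⁻¹).1 ⁻¹' T)) := by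
    conv_lhs => rw [h1, h2]
    rfl
  rw [h3]
  have := φ.measurePreserving_prodMap.setIntegral_preimage_emb φ.measurableEmbedding_prodMap k
    (((φ⁻¹).1 ⁻¹' S) ×ˢ ((φ⁻¹).1 ⁻¹' T))
  change |∫ z in _, k (Prod.map φ.1 φ.1 z)| ≤ r
  rw [this]
  exact hk _ _ ((φ⁻¹).2.2.measurable hS) ((φ⁻¹).2.2.measurable hT)

theorem cutLE_one (f g : Graphon) : CutLE (fun z => f z.1 z.2 - g z.1 z.2) 1 := by
  refine cutLE_of_integral_abs_le (f.integrable_sub g) ?_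
  calc ∫ z : I × I, |f z.1 z.2 - g z.1 z.2| ≤ ∫ _z : I × I, (1 : ℝ) :=
        integral_mono (f.integrable_sub g).abs (integrable_const 1)
          fun z => abs_sub_le_one f g _ _
    _ = 1 := by simp

theorem cutLE_cutDist (f g : Graphon) : CutLE (fun z => f z.1 z.2 - g z.1 z.2) (cutDist f g) := by
  intro S T hS hT
  refine le_csSup ⟨1, ?_⟩ ⟨S, T, hS, hT, rfl⟩
  rintro r ⟨S, T, hS, hT, rfl⟩
  exact cutLE_one f g S T hS hT

theorem cutDist_le {f g : Graphon} {r : ℝ} (h : CutLE (fun z => f z.1 z.2 - g z.1 z.2) r) :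
    cutDist f g ≤ r := by
  refine csSup_le ⟨_, ∅, ∅, .empty, .empty, rfl⟩ ?_
  rintro r ⟨S, T, hS, hT, rfl⟩
  exact h S T hS hT

theorem cutDist_nonneg (f g : Graphon) : 0 ≤ cutDist f g :=
  (abs_nonneg _).trans (cutLE_cutDist f g ∅ ∅ .empty .empty)

theorem cutDist_self (f : Graphon) : cutDist f f = 0 :=
  le_antisymm (cutDist_le fun S T _ _ => by simp) (cutDist_nonneg f f)

theorem cutDist_comm (f g : Graphon) : cutDist f g = cutDist g f := by
  have key : ∀ f g : Graphon, cutDist f g ≤ cutDist g f := fun f g =>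
    cutDist_le (by simpa using (cutLE_cutDist g f).neg)
  exact le_antisymm (key f g) (key g f)

theorem cutDist_triangle (f g h : Graphon) : cutDist f h ≤ cutDist f g + cutDist g h :=
  cutDist_le (by
    simpa using (cutLE_cutDist f g).add (cutLE_cutDist g h) (f.integrable_sub g)
      (g.integrable_sub h))

theorem cutDist_relabel_le (f g : Graphon) (φ : MeasurePreservingBij) :
    cutDist (f.relabel φ) (g.relabel φ) ≤ cutDist f g :=
  cutDist_le ((cutLE_cutDist f g).comp φ)

theorem cutDist_relabel (f g : Graphon) (φ : MeasurePreservingBij) :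
    cutDist (f.relabel φ) (g.relabel φ) = cutDist f g := by
  refine le_antisymm (cutDist_relabel_le f g φ) ?_
  have := cutDist_relabel_le (f.relabel φ) (g.relabel φ) φ⁻¹
  rwa [← relabel_mul, ← relabel_mul, mul_inv_cancel, relabel_one, relabel_one] at this

/-! ### The cut metric of a group of relabellings -/

/-- The cut metric with relabellings restricted to a subgroup. -/
noncomputable def cutMetricOn (G : Subgroup MeasurePreservingBij) (f g : Graphon) : ℝ :=
  ⨅ φ : G, cutDist f (g.relabel φ)

theorem cutMetricOn_le (G : Subgroup MeasurePreservingBij) (f g : Graphon) {φ : MeasurePreservingBij}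
    (hφ : φ ∈ G) : cutMetricOn G f g ≤ cutDist f (g.relabel φ) :=
  ciInf_le ⟨0, by rintro _ ⟨ψ, rfl⟩; exact cutDist_nonneg _ _⟩ (⟨φ, hφ⟩ : G)

theorem exists_lt_of_cutMetricOn_lt {G : Subgroup MeasurePreservingBij} {f g : Graphon} {r : ℝ}
    (h : cutMetricOn G f g < r) : ∃ φ ∈ G, cutDist f (g.relabel φ) < r := by
  obtain ⟨φ, hφ⟩ := exists_lt_of_ciInf_lt h
  exact ⟨φ.1, φ.2, hφ⟩

theorem cutMetricOn_nonneg (G : Subgroup MeasurePreservingBij) (f g : Graphon) :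
    0 ≤ cutMetricOn G f g :=
  le_ciInf fun _ => cutDist_nonneg _ _

theorem cutMetricOn_le_cutDist (G : Subgroup MeasurePreservingBij) (f g : Graphon) :
    cutMetricOn G f g ≤ cutDist f g :=
  cutMetricOn_le G f g G.one_mem

theorem cutMetricOn_self (G : Subgroup MeasurePreservingBij) (f : Graphon) :
    cutMetricOn G f f = 0 :=
  le_antisymm ((cutMetricOn_le_cutDist G f f).trans (cutDist_self f).le) (cutMetricOn_nonneg G f f)

theorem cutMetricOn_comm (G : Subgroup MeasurePreservingBij) (f g : Graphon) :
    cutMetricOn G f g = cutMetricOn G g f := by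
  have key : ∀ f g : Graphon, cutMetricOn G f g ≤ cutMetricOn G g f := by
    intro f g
    refine le_ciInf fun φ => (cutMetricOn_le G f g (G.inv_mem φ.2)).trans ?_
    have := cutDist_relabel f (g.relabel (φ : MeasurePreservingBij)⁻¹) φ
    rw [← relabel_mul, inv_mul_cancel, relabel_one] at this
    rw [← this, cutDist_comm]
  exact le_antisymm (key f g) (key g f)

theorem cutMetricOn_triangle (G : Subgroup MeasurePreservingBij) (f g h : Graphon) :
    cutMetricOn G f h ≤ cutMetricOn G f g + cutMetricOn G g h := by
  refine le_of_forall_pos_lt_add fun ε hε => ?_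
  obtain ⟨φ, hφ, h1⟩ := exists_lt_of_cutMetricOn_lt
    (show cutMetricOn G f g < cutMetricOn G f g + ε / 2 by linarith)
  obtain ⟨ψ, hψ, h2⟩ := exists_lt_of_cutMetricOn_lt
    (show cutMetricOn G g h < cutMetricOn G g h + ε / 2 by linarith)
  have h3 := cutMetricOn_le G f h (G.mul_mem hψ hφ)
  have h4 := cutDist_triangle f (g.relabel φ) (h.relabel (ψ * φ))
  rw [relabel_mul, cutDist_relabel] at h4
  rw [relabel_mul] at h3
  linarith

/-- Transfers the pseudometric properties, proved once for an arbitrary subgroup, to the cut metric.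
-/
theorem cutMetric_eq (f g : Graphon) : cutMetric f g = cutMetricOn ⊤ f g :=
  (Equiv.iInf_congr (Equiv.subtypeUnivEquiv (p := fun φ : MeasurePreservingBij => φ ∈ (⊤ : Subgroup _))
    fun _ => trivial) fun _ => rfl).symm

theorem cutMetric_le_cutMetricOn (G : Subgroup MeasurePreservingBij) (f g : Graphon) :
    cutMetric f g ≤ cutMetricOn G f g := by
  rw [cutMetric_eq]
  exact le_ciInf fun φ => cutMetricOn_le ⊤ f g trivial

theorem cutMetric_le_cutDist (f g : Graphon) : cutMetric f g ≤ cutDist f g :=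
  cutMetric_eq f g ▸ cutMetricOn_le_cutDist ⊤ f g

theorem cutMetric_nonneg (f g : Graphon) : 0 ≤ cutMetric f g :=
  cutMetric_eq f g ▸ cutMetricOn_nonneg ⊤ f g

theorem cutMetric_self (f : Graphon) : cutMetric f f = 0 :=
  cutMetric_eq f f ▸ cutMetricOn_self ⊤ f

theorem cutMetric_comm (f g : Graphon) : cutMetric f g = cutMetric g f := by
  rw [cutMetric_eq, cutMetric_eq, cutMetricOn_comm]

theorem cutMetric_triangle (f g h : Graphon) :
    cutMetric f h ≤ cutMetric f g + cutMetric g h := by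
  simp only [cutMetric_eq]
  exact cutMetricOn_triangle ⊤ f g h

theorem exists_cutDist_lt_of_cutMetric_lt {f g : Graphon} {r : ℝ} (h : cutMetric f g < r) :
    ∃ φ : MeasurePreservingBij, cutDist f (g.relabel φ) < r := by
  rw [cutMetric_eq] at h
  obtain ⟨φ, -, hφ⟩ := exists_lt_of_cutMetricOn_lt h
  exact ⟨φ, hφ⟩

/-- The measure preserving bijections that map `[0,γ]` to itself. -/
def blockStabilizer (γ : ℝ) : Subgroup MeasurePreservingBij where
  carrier := {φ | ∀ x, (φ.1 x : ℝ) ≤ γ ↔ (x : ℝ) ≤ γ}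
  mul_mem' := fun {φ ψ} hφ hψ x => (hφ (ψ.1 x)).trans (hψ x)
  one_mem' := fun x => Iff.rfl
  inv_mem' := fun {φ} hφ x => by
    have := hφ ((φ⁻¹).1 x)
    rw [φ.apply_inv_apply] at this
    exact this.symm

/-- This is why relabellings are restricted to the stabilizer: they fix the reference graphon and
hence preserve the entropy, which arbitrary relabellings need not do. -/
theorem twoBlock_relabel {γ : ℝ} {a b c : I} {φ : MeasurePreservingBij}
    (hφ : φ ∈ blockStabilizer γ) : (twoBlock γ a b c).relabel φ = twoBlock γ a b c := by
  have h1 : ∀ x, (φ.1 x : ℝ) ≤ γ ↔ (x : ℝ) ≤ γ := hφ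
  have h2 : ∀ x, γ < (φ.1 x : ℝ) ↔ γ < (x : ℝ) := fun x => by
    rw [← not_le, ← not_le, h1]
  refine ext' fun x y => ?_
  change (if (φ.1 x : ℝ) ≤ γ ∧ (φ.1 y : ℝ) ≤ γ then (a : ℝ)
    else if γ < (φ.1 x : ℝ) ∧ γ < (φ.1 y : ℝ) then (c : ℝ) else (b : ℝ)) = _
  simp only [h1, h2]
  rfl


/-! ### Exchanging two intervals -/

/-- The map exchanging the intervals `(a, a+l]` and `(b, b+l]` by translation. -/
noncomputable def exchange (a b l x : ℝ) : ℝ :=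
  if a < x ∧ x ≤ a + l then x + (b - a) else if b < x ∧ x ≤ b + l then x - (b - a) else x

section exchange

variable {a b l : ℝ}

theorem exchange_involutive (hab : a + l ≤ b) : Function.Involutive (exchange a b l) := by
  intro x
  unfold exchange
  split_ifs <;> grind

theorem measurable_exchange : Measurable (exchange a b l) :=
  Measurable.ite measurableSet_Ioc (measurable_id.add_const _)
    (Measurable.ite measurableSet_Ioc (measurable_id.sub_const _) measurable_id)

/-- The map is a translation of each interval onto the other and the identity elsewhere, so the
preimage splits into three pieces of known measure. -/
theorem volume_preimage_exchange (hab : a + l ≤ b) {s : Set ℝ} (hs : MeasurableSet s) :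
    volume (exchange a b l ⁻¹' s) = volume s := by
  have hm : MeasurableSet (exchange a b l ⁻¹' s) := measurable_exchange hs
  rw [← measure_inter_add_sdiff (exchange a b l ⁻¹' s) (measurableSet_Ioc (a := a) (b := a + l)),
    ← measure_inter_add_sdiff (exchange a b l ⁻¹' s \ _) (measurableSet_Ioc (a := b) (b := b + l)),
    ← measure_inter_add_sdiff s (measurableSet_Ioc (a := b) (b := b + l)),
    ← measure_inter_add_sdiff (s \ _) (measurableSet_Ioc (a := a) (b := a + l))]
  have h1 : exchange a b l ⁻¹' s ∩ Set.Ioc a (a + l) =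
      (fun x => x + (b - a)) ⁻¹' (s ∩ Set.Ioc b (b + l)) := by
    ext x
    simp only [Set.mem_inter_iff, Set.mem_preimage, Set.mem_Ioc, exchange]
    split_ifs <;> grind
  have h2 : (exchange a b l ⁻¹' s \ Set.Ioc a (a + l)) ∩ Set.Ioc b (b + l) =
      (fun x => x + (-(b - a))) ⁻¹' ((s \ Set.Ioc b (b + l)) ∩ Set.Ioc a (a + l)) := by
    ext x
    simp only [Set.mem_inter_iff, Set.mem_preimage, Set.mem_Ioc, Set.mem_sdiff, exchange]
    split_ifs <;> grind
  have h3 : (exchange a b l ⁻¹' s \ Set.Ioc a (a + l)) \ Set.Ioc b (b + l) =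
      (s \ Set.Ioc b (b + l)) \ Set.Ioc a (a + l) := by
    ext x
    simp only [Set.mem_preimage, Set.mem_Ioc, Set.mem_sdiff, exchange]
    split_ifs <;> grind
  rw [h1, h2, h3, measure_preimage_add_right, measure_preimage_add_right]

theorem exchange_mem (ha : 0 ≤ a) (hab : a + l ≤ b) (hb : b + l ≤ 1) {x : ℝ}
    (hx : x ∈ Set.Icc (0 : ℝ) 1) : exchange a b l x ∈ Set.Icc (0 : ℝ) 1 := by
  unfold exchange
  simp only [Set.mem_Icc] at *
  split_ifs <;> grind

/-- Exchanging two intervals is a measure preserving bijection of `[0,1]`. -/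
noncomputable def exchangeBij (ha : 0 ≤ a) (hab : a + l ≤ b) (hb : b + l ≤ 1) :
    MeasurePreservingBij := by
  refine ⟨fun x => ⟨exchange a b l x, exchange_mem ha hab hb x.2⟩, ?_, ?_⟩
  · exact Function.Involutive.bijective fun x => Subtype.ext (exchange_involutive hab x)
  · have hmeas : Measurable fun x : I => (⟨exchange a b l x, exchange_mem ha hab hb x.2⟩ : I) :=
      (measurable_exchange.comp measurable_subtype_coe).subtype_mk
    refine ⟨hmeas, Measure.ext fun s hs => ?_⟩
    rw [Measure.map_apply hmeas hs]
    have hI : MeasurableSet (Set.Icc (0 : ℝ) 1) := measurableSet_Icc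
    change (Measure.comap Subtype.val volume) _ = (Measure.comap Subtype.val volume) _
    rw [comap_subtype_coe_apply hI, comap_subtype_coe_apply hI,
      ← volume_preimage_exchange hab (hI.subtype_image hs)]
    congr 1
    ext x
    simp only [Set.mem_image, Set.mem_preimage]
    constructor
    · rintro ⟨y, hy, rfl⟩
      exact ⟨_, hy, rfl⟩
    · rintro ⟨y, hy, hyx⟩
      have hx : x ∈ Set.Icc (0 : ℝ) 1 := by
        rw [← exchange_involutive hab x, ← hyx]
        exact exchange_mem ha hab hb y.2
      refine ⟨⟨x, hx⟩, ?_, rfl⟩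
      convert hy
      exact hyx.symm

theorem exchangeBij_apply (ha : 0 ≤ a) (hab : a + l ≤ b) (hb : b + l ≤ 1) (x : I) :
    (((exchangeBij ha hab hb).1 x : I) : ℝ) = exchange a b l x := rfl

end exchange

/-! ### The grid -/

/-- Left end point of the blocks `(0,γ]` and `(γ,1]`. -/
noncomputable def blockStart (γ : ℝ) (β : Bool) : ℝ := if β then 0 else γ

/-- Length of the blocks `(0,γ]` and `(γ,1]`. -/
noncomputable def blockLength (γ : ℝ) (β : Bool) : ℝ := if β then γ else 1 - γ

/-- The block of a point. -/
noncomputable def block (γ : ℝ) (x : I) : Bool := decide ((x : ℝ) ≤ γ)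

/-- Each block is cut into `n + 1` intervals of the same length; this is the index of the
interval that contains `x`. -/
noncomputable def cellIdx (γ : ℝ) (n : ℕ) (x : I) : Bool × Fin (n + 1) :=
  (block γ x, Fin.ofNat (n + 1)
    (⌈((x : ℝ) - blockStart γ (block γ x)) / blockLength γ (block γ x) * (n + 1)⌉₊ - 1))

/-- Length of the cells. -/
noncomputable def cellLength (γ : ℝ) (n : ℕ) (β : Bool) : ℝ := blockLength γ β / (n + 1)

/-- Left end point of the cells. -/
noncomputable def cellStart (γ : ℝ) {n : ℕ} (k : Bool × Fin (n + 1)) : ℝ :=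
  blockStart γ k.1 + cellLength γ n k.1 * k.2

section grid

variable {γ : ℝ} {n : ℕ}

theorem measurable_block : Measurable (block γ) :=
  measurable_to_bool (by
    convert measurableSet_le (measurable_subtype_coe (p := (· ∈ I))) (measurable_const (a := γ))
    ext x; simp [block])

theorem blockLength_pos (h0 : 0 < γ) (h1 : γ < 1) (β : Bool) : 0 < blockLength γ β := by
  cases β <;> simp [blockLength, h0, h1]

theorem blockLength_le_one (h0 : 0 < γ) (h1 : γ < 1) (β : Bool) : blockLength γ β ≤ 1 := by
  cases β <;> simp [blockLength, h0.le, h1.le]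

theorem cellLength_pos (h0 : 0 < γ) (h1 : γ < 1) (β : Bool) : 0 < cellLength γ n β := by
  have := blockLength_pos h0 h1 β
  unfold cellLength
  positivity

theorem cellLength_le (h0 : 0 < γ) (h1 : γ < 1) (β : Bool) :
    cellLength γ n β ≤ 1 / (n + 1) := by
  unfold cellLength
  have := blockLength_le_one h0 h1 β
  gcongr

theorem block_eq_iff {x : I} (hx : x ≠ 0) (β : Bool) :
    block γ x = β ↔ blockStart γ β < x ∧ (x : ℝ) ≤ blockStart γ β + blockLength γ β := by
  have hx0 : (0 : ℝ) < x := lt_of_le_of_ne x.2.1 (fun h => hx (Subtype.ext h.symm))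
  have hx1 : (x : ℝ) ≤ 1 := x.2.2
  have hx0' : 0 < x := hx0
  cases β <;> simp [block, blockStart, blockLength] <;> grind

theorem cellStart_bounds (h0 : 0 < γ) (h1 : γ < 1) (k : Bool × Fin (n + 1)) :
    blockStart γ k.1 ≤ cellStart γ k ∧
      cellStart γ k + cellLength γ n k.1 ≤ blockStart γ k.1 + blockLength γ k.1 := by
  have hl := cellLength_pos (n := n) h0 h1 k.1
  have hk : (k.2 : ℝ) + 1 ≤ n + 1 := by exact_mod_cast k.2.2
  have he : cellLength γ n k.1 * (n + 1) = blockLength γ k.1 := by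
    unfold cellLength; field_simp
  unfold cellStart
  constructor
  · have : (0 : ℝ) ≤ k.2 := Nat.cast_nonneg _
    nlinarith
  · nlinarith

/-- Cells are open on the left, whence the ceiling minus one. The point 0 lies in no cell interval,
although truncated subtraction still assigns it the first index; it is a null set. -/
theorem cellIdx_eq_iff (h0 : 0 < γ) (h1 : γ < 1) {x : I} (hx : x ≠ 0)
    (k : Bool × Fin (n + 1)) :
    cellIdx γ n x = k ↔
      cellStart γ k < x ∧ (x : ℝ) ≤ cellStart γ k + cellLength γ n k.1 := by
  have hkb := cellStart_bounds h0 h1 k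
  have key : block γ x = k.1 → (cellIdx γ n x = k ↔
      cellStart γ k < x ∧ (x : ℝ) ≤ cellStart γ k + cellLength γ n k.1) := by
    intro hb
    obtain ⟨hb1, hb2⟩ := (block_eq_iff hx k.1).1 hb
    have hL := blockLength_pos h0 h1 k.1
    set L := blockLength γ k.1
    set s := blockStart γ k.1
    set y := ((x : ℝ) - s) / L * (n + 1) with hy
    have hn : (0 : ℝ) < n + 1 := by positivity
    have hy0 : 0 < y := by
      have : 0 < (x : ℝ) - s := by linarith
      positivity
    have hy1 : y ≤ n + 1 := by
      have : ((x : ℝ) - s) / L ≤ 1 := by rw [div_le_one hL]; linarith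
      nlinarith
    have hc1 : 1 ≤ ⌈y⌉₊ := Nat.one_le_iff_ne_zero.2 (Nat.ceil_pos.2 hy0).ne'
    have hc2 : ⌈y⌉₊ ≤ n + 1 := Nat.ceil_le.2 (by exact_mod_cast hy1)
    have hxy : (x : ℝ) = s + L / (n + 1) * y := by rw [hy]; field_simp; ring
    have h2 : cellIdx γ n x = k ↔ ⌈y⌉₊ = k.2 + 1 := by
      rw [Prod.ext_iff, Fin.ext_iff]
      have : ((cellIdx γ n x).2 : ℕ) = (⌈y⌉₊ - 1) % (n + 1) := by
        simp only [cellIdx, hb]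
        rfl
      rw [this, Nat.mod_eq_of_lt (by omega)]
      constructor
      · rintro ⟨-, h⟩; omega
      · intro h; exact ⟨hb, by omega⟩
    rw [h2, Nat.ceil_eq_iff (by omega), Nat.add_sub_cancel]
    have hl : 0 < L / (n + 1) := by positivity
    simp only [cellStart, cellLength]
    change _ ↔ s + L / (n + 1) * k.2 < x ∧ (x : ℝ) ≤ s + L / (n + 1) * k.2 + L / (n + 1)
    rw [hxy]
    push_cast
    constructor
    · rintro ⟨h3, h4⟩
      constructor <;> nlinarith
    · rintro ⟨h3, h4⟩
      constructor
      · by_contra hcon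
        push Not at hcon
        nlinarith
      · by_contra hcon
        push Not at hcon
        nlinarith
  by_cases hb : block γ x = k.1
  · exact key hb
  · constructor
    · intro h; exact absurd (congrArg Prod.fst h) hb
    · rintro ⟨h3, h4⟩
      exact absurd ((block_eq_iff hx k.1).2 ⟨by linarith, by linarith⟩) hb

theorem measurable_cellIdx : Measurable (cellIdx γ n) := by
  refine measurable_block.prodMk ?_
  have h : Measurable fun m : ℕ => Fin.ofNat (n + 1) (m - 1) := measurable_of_countable _
  refine h.comp (Nat.measurable_ceil.comp ?_)
  have h1 : Measurable fun x : I => blockStart γ (block γ x) :=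
    (measurable_of_countable (blockStart γ)).comp measurable_block
  have h2 : Measurable fun x : I => blockLength γ (block γ x) :=
    (measurable_of_countable (blockLength γ)).comp measurable_block
  exact ((measurable_subtype_coe.sub h1).div h2).mul_const _

theorem ae_ne_zero : ∀ᵐ x : I, x ≠ 0 := by
  rw [ae_iff]
  simp

theorem volume_val_preimage_Ioc {u v : ℝ} (hu : 0 ≤ u) (huv : u ≤ v) (hv : v ≤ 1) :
    volume.real (Subtype.val ⁻¹' Set.Ioc u v : Set I) = v - u := by
  have hI : MeasurableSet (Set.Icc (0 : ℝ) 1) := measurableSet_Icc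
  have : (volume : Measure I) (Subtype.val ⁻¹' Set.Ioc u v) = volume (Set.Ioc u v) := by
    change (Measure.comap Subtype.val volume) _ = _
    rw [comap_subtype_coe_apply hI, Subtype.image_preimage_coe]
    congr 1
    ext x
    simp only [Set.mem_inter_iff, Set.mem_Icc, Set.mem_Ioc]
    grind
  rw [measureReal_def, this, Real.volume_Ioc, ENNReal.toReal_ofReal (by linarith)]

theorem volume_cellIdx_preimage_singleton (h0 : 0 < γ) (h1 : γ < 1) (k : Bool × Fin (n + 1)) :
    volume.real (cellIdx γ n ⁻¹' {k}) = cellLength γ n k.1 := by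
  have hb := cellStart_bounds h0 h1 k
  have hs : 0 ≤ blockStart γ k.1 ∧ blockStart γ k.1 + blockLength γ k.1 ≤ 1 := by
    obtain ⟨β, j⟩ := k
    cases β <;> simp [blockStart, blockLength, h0.le, h1.le]
  have hl := cellLength_pos (n := n) h0 h1 k.1
  rw [measureReal_congr (t := Subtype.val ⁻¹' Set.Ioc (cellStart γ k)
    (cellStart γ k + cellLength γ n k.1)), volume_val_preimage_Ioc] <;> try linarith
  filter_upwards [ae_ne_zero] with x hx
  exact propext (cellIdx_eq_iff h0 h1 hx k)

theorem volume_cellIdx_preimage (h0 : 0 < γ) (h1 : γ < 1) (A : Finset (Bool × Fin (n + 1))) :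
    volume.real (cellIdx γ n ⁻¹' (A : Set (Bool × Fin (n + 1)))) =
      ∑ k ∈ A, cellLength γ n k.1 := by
  have : cellIdx γ n ⁻¹' (A : Set (Bool × Fin (n + 1))) = ⋃ k ∈ A, cellIdx γ n ⁻¹' {k} := by
    ext x; simp
  rw [this, measureReal_biUnion_finset]
  · exact Finset.sum_congr rfl fun k _ => volume_cellIdx_preimage_singleton h0 h1 k
  · intro i _ j _ hij
    exact Disjoint.preimage _ (by simpa using hij)
  · exact fun k _ => measurable_cellIdx (measurableSet_singleton k)

/-- Two cells of the same block are exchanged by a measure preserving bijection. -/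
theorem exists_swap_cells (h0 : 0 < γ) (h1 : γ < 1) {k k' : Bool × Fin (n + 1)}
    (hk : k.1 = k'.1) : ∃ φ ∈ blockStabilizer γ, φ.1 0 = 0 ∧
      ∀ x, x ≠ 0 → cellIdx γ n (φ.1 x) = Equiv.swap k k' (cellIdx γ n x) := by
  wlog hlt : k.2 < k'.2 generalizing k k'
  · rcases (not_lt.1 hlt).lt_or_eq with h | h
    · obtain ⟨φ, h2, h3, h4⟩ := this hk.symm h
      exact ⟨φ, h2, h3, fun x hx => by rw [h4 x hx, Equiv.swap_comm]⟩
    · have : k = k' := Prod.ext hk h.symm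
      subst this
      exact ⟨1, one_mem _, rfl, fun x _ => by simp [MeasurePreservingBij.one_val]⟩
  have hl := cellLength_pos (n := n) h0 h1 k.1
  have hb := cellStart_bounds h0 h1 k
  have hb' := cellStart_bounds h0 h1 k'
  rw [← hk] at hb'
  have hs : 0 ≤ blockStart γ k.1 ∧ blockStart γ k.1 + blockLength γ k.1 ≤ 1 := by
    obtain ⟨β, j⟩ := k
    cases β <;> simp [blockStart, blockLength, h0.le, h1.le]
  have hle : cellStart γ k + cellLength γ n k.1 ≤ cellStart γ k' := by
    have : ((k.2 : ℕ) : ℝ) + 1 ≤ (k'.2 : ℕ) := by exact_mod_cast hlt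
    unfold cellStart
    rw [← hk]
    nlinarith
  have ha : 0 ≤ cellStart γ k := by linarith
  have hb1 : cellStart γ k' + cellLength γ n k.1 ≤ 1 := by linarith
  set φ := exchangeBij ha hle hb1 with hφ
  -- Fixing the exceptional point 0 keeps the index formula for nonzero points stable under
  -- composition.
  have hz : φ.1 0 = 0 := by
    refine Subtype.ext ?_
    rw [hφ, exchangeBij_apply]
    unfold exchange
    simp only [Set.Icc.coe_zero]
    split_ifs <;> grind
  have hnz : ∀ x, x ≠ 0 → φ.1 x ≠ 0 := fun x hx h => hx (φ.2.1.injective (h.trans hz.symm))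
  have hidx : ∀ x, x ≠ 0 → cellIdx γ n (φ.1 x) = Equiv.swap k k' (cellIdx γ n x) := by
    intro x hx
    have hi := fun m => cellIdx_eq_iff (n := n) h0 h1 hx m
    have hi' := fun m => cellIdx_eq_iff (n := n) h0 h1 (hnz x hx) m
    have hval : ((φ.1 x : I) : ℝ) = exchange (cellStart γ k) (cellStart γ k')
      (cellLength γ n k.1) x := rfl
    by_cases hxk : cellIdx γ n x = k
    · rw [hxk, Equiv.swap_apply_left, hi', hval]
      have := (hi k).1 hxk
      rw [exchange, if_pos this, ← hk]
      constructor <;> linarith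
    by_cases hxk' : cellIdx γ n x = k'
    · rw [hxk', Equiv.swap_apply_right, hi', hval]
      have h2 := (hi k').1 hxk'
      have h3 := mt (hi k).2 hxk
      rw [← hk] at h2
      rw [exchange, if_neg h3, if_pos h2]
      constructor <;> linarith
    · rw [Equiv.swap_apply_of_ne_of_ne hxk hxk']
      have h2 := mt (hi k').2 hxk'
      have h3 := mt (hi k).2 hxk
      rw [← hk] at h2
      congr 1
      refine Subtype.ext ?_
      rw [hval, exchange, if_neg h3, if_neg h2]
  refine ⟨φ, ?_, hz, hidx⟩
  intro x
  by_cases hx : x = 0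
  · rw [hx, hz]
  · have := congrArg Prod.fst (hidx x hx)
    have h2 : (Equiv.swap k k' (cellIdx γ n x)).1 = (cellIdx γ n x).1 := by
      rw [Equiv.swap_apply_def]
      split_ifs with h h
      · rw [h, hk]
      · rw [h, hk]
      · rfl
    rw [h2] at this
    simpa [cellIdx, block] using this

end grid

/-! ### Approximation by cell unions -/

/-- Induction over the π-system of initial segments. Asking for all large `n` instead of one `n`
lets finitely many sets be approximated on a common grid, which the step for disjoint unions needs.
-/
theorem exists_cells_approx {γ : ℝ} (h0 : 0 < γ) (h1 : γ < 1) {S : Set I} (hS : MeasurableSet S) :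
    ∀ δ : ℝ, 0 < δ → ∀ᶠ n : ℕ in Filter.atTop, ∃ A : Set (Bool × Fin (n + 1)),
      volume.real (symmDiff S (cellIdx γ n ⁻¹' A)) ≤ δ := by
  induction S, hS using MeasurableSpace.induction_on_inter
    (BorelSpace.measurable_eq.trans (borel_eq_generateFrom_Iic I)) isPiSystem_Iic with
  | empty =>
    intro δ hδ
    refine .of_forall fun n => ⟨∅, ?_⟩
    simpa using hδ.le
  | basic t ht =>
    obtain ⟨y, rfl⟩ := ht
    intro δ hδ
    filter_upwards [tendsto_one_div_add_atTop_nhds_zero_nat.eventually (ge_mem_nhds hδ)] with n hn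
    -- The cells that end no later than `y`: the error lies within one cell length to the left of
    -- `y`.
    refine ⟨{k | cellStart γ k + cellLength γ n k.1 ≤ y}, ?_⟩
    refine le_trans ?_ hn
    have hy1 : (y : ℝ) ≤ 1 := y.2.2
    have hy0 : 0 ≤ (y : ℝ) := y.2.1
    have hn0 : 0 < 1 / ((n : ℝ) + 1) := by positivity
    calc volume.real (symmDiff (Set.Iic y) (cellIdx γ n ⁻¹'
          {k | cellStart γ k + cellLength γ n k.1 ≤ y}))
        ≤ volume.real (Subtype.val ⁻¹' Set.Ioc (max 0 ((y : ℝ) - 1 / (n + 1))) y : Set I) := by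
          refine ENNReal.toReal_mono (measure_ne_top _ _) (measure_mono_ae ?_)
          filter_upwards [ae_ne_zero] with x hx hxs
          have hx0 : (0 : ℝ) < x := lt_of_le_of_ne x.2.1 (fun h => hx (Subtype.ext h.symm))
          have h2 := (cellIdx_eq_iff h0 h1 hx (cellIdx γ n x)).1 rfl
          have h3 := cellLength_le (n := n) h0 h1 (cellIdx γ n x).1
          rcases hxs with ⟨h4, h5⟩ | ⟨h4, h5⟩
          · have h4 : (x : ℝ) ≤ y := h4
            have h5 : ¬ (cellStart γ (cellIdx γ n x) + cellLength γ n (cellIdx γ n x).1 ≤ y) := h5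
            exact ⟨max_lt hx0 (by linarith), h4⟩
          · have h5 : ¬ (x : ℝ) ≤ y := h5
            have h4 : (cellStart γ (cellIdx γ n x) + cellLength γ n (cellIdx γ n x).1 ≤ y) := h4
            exact absurd (h2.2.trans h4) h5
      _ = y - max 0 ((y : ℝ) - 1 / (n + 1)) := by
          rw [volume_val_preimage_Ioc (le_max_left _ _) (max_le hy0 (by linarith)) hy1]
      _ ≤ 1 / (n + 1) := by
          have := le_max_right 0 ((y : ℝ) - 1 / (n + 1))
          linarith
  | compl t _ ih =>
    intro δ hδ
    filter_upwards [ih δ hδ] with n hn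
    obtain ⟨A, hA⟩ := hn
    refine ⟨Aᶜ, ?_⟩
    rwa [Set.preimage_compl, compl_symmDiff_compl]
  | iUnion f hd hf ih =>
    intro δ hδ
    -- A countable disjoint union is cut off where its tail has measure below δ/2; the finitely many
    -- remaining sets share the other half of δ.
    have htail := tendsto_measure_biUnion_Ici_zero_of_pairwise_disjoint
      (μ := (volume : Measure I)) (fun i => (hf i).nullMeasurableSet) hd
    have h2 : ∀ᶠ m : ℕ in Filter.atTop, volume (⋃ i ≥ m, f i) < ENNReal.ofReal (δ / 2) :=
      htail.eventually (gt_mem_nhds (by simpa using hδ))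
    obtain ⟨m, hm⟩ := h2.exists
    have h3 : ∀ i ∈ Finset.range m, ∀ᶠ n : ℕ in Filter.atTop, ∃ A : Set (Bool × Fin (n + 1)),
        volume.real (symmDiff (f i) (cellIdx γ n ⁻¹' A)) ≤ δ / 2 / (m + 1) :=
      fun i _ => ih i _ (by positivity)
    filter_upwards [(Finset.eventually_all _).2 h3] with n hn
    choose! A hA using hn
    refine ⟨⋃ i ∈ Finset.range m, A i, ?_⟩
    have hsub : symmDiff (⋃ i, f i) (cellIdx γ n ⁻¹' ⋃ i ∈ Finset.range m, A i) ⊆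
        (⋃ i ∈ Finset.range m, symmDiff (f i) (cellIdx γ n ⁻¹' A i)) ∪ ⋃ i ≥ m, f i := by
      intro x hx
      simp only [Set.mem_symmDiff, Set.mem_iUnion, Set.mem_preimage, Finset.mem_range,
        Set.mem_union] at hx ⊢
      rcases hx with ⟨⟨i, hi⟩, h4⟩ | ⟨⟨i, hi, hiA⟩, h4⟩
      · by_cases him : i < m
        · exact Or.inl ⟨i, him, Or.inl ⟨hi, fun h => h4 ⟨i, him, h⟩⟩⟩
        · exact Or.inr ⟨i, not_lt.1 him, hi⟩
      · exact Or.inl ⟨i, hi, Or.inr ⟨hiA, fun h => h4 ⟨i, h⟩⟩⟩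
    calc _ ≤ volume.real ((⋃ i ∈ Finset.range m, symmDiff (f i) (cellIdx γ n ⁻¹' A i)) ∪
          ⋃ i ≥ m, f i) := measureReal_mono hsub
      _ ≤ volume.real (⋃ i ∈ Finset.range m, symmDiff (f i) (cellIdx γ n ⁻¹' A i)) +
          volume.real (⋃ i ≥ m, f i) := measureReal_union_le _ _
      _ ≤ ∑ i ∈ Finset.range m, δ / 2 / (m + 1) + δ / 2 := by
          refine add_le_add ((measureReal_biUnion_finset_le _ _).trans (Finset.sum_le_sum hA)) ?_
          exact ENNReal.toReal_le_of_le_ofReal (by positivity) hm.le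
      _ ≤ δ := by
          rw [Finset.sum_const, Finset.card_range, nsmul_eq_mul]
          have : (m : ℝ) * (δ / 2 / (m + 1)) ≤ δ / 2 := by
            rw [mul_div_assoc', div_le_iff₀ (by positivity)]
            nlinarith
          linarith


/-! ### Matching tags by permutations -/

/-- A family of permutations that contains the identity and is closed under exchanging two values
with the same first tag contains one that matches two taggings as well as the numbers of points
with each tag allow. -/
theorem exists_perm_matching {κ β : Type*} [Fintype κ] [DecidableEq κ] [DecidableEq β]
    (u u' : κ → β) (R : Set (Equiv.Perm κ)) (h1 : 1 ∈ R)
    (hR : ∀ π ∈ R, ∀ i j, u (π j) = u' i → Equiv.swap (π i) (π j) * π ∈ R) :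
    ∃ π ∈ R, ∀ τ, ((Finset.univ.filter fun j => u' j = τ ∧ u (π j) ≠ τ).card : ℝ) ≤
      |((Finset.univ.filter fun j => u' j = τ).card : ℝ) -
        (Finset.univ.filter fun j => u j = τ).card| := by
  classical
  -- Take a permutation in `R` with the largest number of matched points.
  obtain ⟨π, hπ, hmax⟩ := Set.exists_max_image R
    (fun π => (Finset.univ.filter fun j => u (π j) = u' j).card) (Set.toFinite R) ⟨1, h1⟩
  refine ⟨π, hπ, fun τ => ?_⟩
  -- By maximality a tag cannot be missing at `i` and wasted at `j` at once: exchanging the two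
  -- values would gain the match at `i` and lose none.
  have key : (Finset.univ.filter fun j => u' j = τ ∧ u (π j) ≠ τ) = ∅ ∨
      (Finset.univ.filter fun j => u (π j) = τ ∧ u' j ≠ τ) = ∅ := by
    by_contra hcon
    push Not at hcon
    obtain ⟨⟨i, hi⟩, ⟨j, hj⟩⟩ := hcon
    simp only [Finset.mem_filter, Finset.mem_univ, true_and] at hi hj
    have hij : i ≠ j := by
      rintro rfl; exact hj.2 hi.1
    have hlt := hmax _ (hR π hπ i j (hj.1.trans hi.1.symm))
    refine absurd hlt (not_le.2 (Finset.card_lt_card ?_))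
    rw [Finset.ssubset_iff_of_subset]
    · refine ⟨i, ?_, ?_⟩
      · rw [Finset.mem_filter, Equiv.Perm.mul_apply, Equiv.swap_apply_left]
        exact ⟨Finset.mem_univ _, hj.1.trans hi.1.symm⟩
      · simp only [Finset.mem_filter, Finset.mem_univ, true_and, hi.1]
        exact hi.2
    · intro k hk
      rw [Finset.mem_filter] at hk ⊢
      refine ⟨Finset.mem_univ _, ?_⟩
      replace hk := hk.2
      have hki : k ≠ i := by rintro rfl; exact hi.2 (hk.trans hi.1)
      have hkj : k ≠ j := by rintro rfl; exact hj.2 (hk.symm.trans hj.1)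
      rw [Equiv.Perm.mul_apply, Equiv.swap_apply_of_ne_of_ne (π.injective.ne hki) (π.injective.ne hkj)]
      exact hk
  rcases key with h | h
  · rw [h]; simp
  · have e1 : (Finset.univ.filter fun j => u j = τ).card =
        (Finset.univ.filter fun j => u (π j) = τ).card := by
      symm
      refine Finset.card_bij (fun j _ => π j) (by simp) (fun _ _ _ _ h => π.injective h) ?_
      intro b hb
      exact ⟨π.symm b, by simpa using hb, by simp⟩
    have e2 : (Finset.univ.filter fun j => u (π j) = τ) =
        Finset.univ.filter fun j => u' j = τ ∧ u (π j) = τ := by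
      refine Finset.filter_congr fun j _ => ⟨fun hj => ⟨?_, hj⟩, fun hj => hj.2⟩
      by_contra hne
      have : j ∈ (Finset.univ.filter fun j => u (π j) = τ ∧ u' j ≠ τ) := by simp [hj, hne]
      rw [h] at this
      simp at this
    have e3 : (Finset.univ.filter fun j => u' j = τ).card =
        (Finset.univ.filter fun j => u' j = τ ∧ u (π j) = τ).card +
        (Finset.univ.filter fun j => u' j = τ ∧ u (π j) ≠ τ).card := by
      rw [← Finset.filter_filter, ← Finset.filter_filter, Finset.card_filter_add_card_filter_not]
    rw [e1, e2, e3]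
    push_cast
    rw [add_sub_cancel_left]
    exact le_abs_self _

/-- A finite valued measurable function is approximated by functions of the cell. -/
theorem exists_tag_approx {γ : ℝ} (h0 : 0 < γ) (h1 : γ < 1) {T : Type*} [Fintype T] [Nonempty T]
    [MeasurableSpace T] [MeasurableSingletonClass T] {t : I → T} (ht : Measurable t) {δ : ℝ}
    (hδ : 0 < δ) : ∀ᶠ n : ℕ in Filter.atTop, ∃ u : Bool × Fin (n + 1) → T,
      volume.real {x | t x ≠ u (cellIdx γ n x)} ≤ δ := by
  classical
  have hc : (0 : ℝ) < Fintype.card T := by exact_mod_cast Fintype.card_pos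
  have h : ∀ τ ∈ (Finset.univ : Finset T), ∀ᶠ n : ℕ in Filter.atTop,
      ∃ A : Set (Bool × Fin (n + 1)),
        volume.real (symmDiff (t ⁻¹' {τ}) (cellIdx γ n ⁻¹' A)) ≤ δ / Fintype.card T :=
    fun τ _ => exists_cells_approx h0 h1 (ht (measurableSet_singleton τ)) _ (by positivity)
  filter_upwards [(Finset.eventually_all _).2 h] with n hn
  choose A hA using fun τ => hn τ (Finset.mem_univ τ)
  -- Outside all symmetric differences the tag of `x` is the only τ whose set `A τ` contains the
  -- cell of `x`, so the arbitrary choice is harmless.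
  refine ⟨fun k => if hk : ∃ τ, k ∈ A τ then hk.choose else Classical.arbitrary T, ?_⟩
  calc _ ≤ volume.real (⋃ τ ∈ (Finset.univ : Finset T),
        symmDiff (t ⁻¹' {τ}) (cellIdx γ n ⁻¹' A τ)) := by
        refine measureReal_mono (fun x hx => ?_) (measure_ne_top _ _)
        by_contra hcon
        simp only [Finset.mem_univ, Set.iUnion_true, Set.mem_iUnion, not_exists,
          Set.mem_symmDiff, Set.mem_preimage, Set.mem_singleton_iff, not_or, not_and,
          not_not] at hcon
        have hk : ∃ τ, cellIdx γ n x ∈ A τ := ⟨t x, (hcon (t x)).1 rfl⟩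
        refine hx ?_
        change t x = if hk : ∃ τ, cellIdx γ n x ∈ A τ then hk.choose else Classical.arbitrary T
        rw [dif_pos hk]
        exact (hcon hk.choose).2 hk.choose_spec
    _ ≤ ∑ τ : T, δ / Fintype.card T :=
        (measureReal_biUnion_finset_le _ _).trans (Finset.sum_le_sum fun τ _ => hA τ)
    _ = δ := by
        rw [Finset.sum_const, nsmul_eq_mul, Finset.card_univ]; field_simp

/-- Measure of the points of a block that carry a given tag. -/
noncomputable def tagVolume (γ : ℝ) {T : Type*} (t : I → T) (τ : Bool × T) : ℝ :=
  volume.real {x | (block γ x, t x) = τ}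

theorem abs_tagVolume_sub_le {γ : ℝ} {T : Type*} (t t' : I → T) (τ : Bool × T) :
    |tagVolume γ t τ - tagVolume γ t' τ| ≤ volume.real {x | t x ≠ t' x} := by
  have key : ∀ t t' : I → T, tagVolume γ t τ ≤ tagVolume γ t' τ + volume.real {x | t x ≠ t' x} := by
    intro t t'
    refine (measureReal_mono ?_).trans (measureReal_union_le _ _)
    intro x hx
    by_cases h : t x = t' x
    · left
      simpa [h] using hx
    · exact Or.inr h
  have h1 := key t t'
  have h2 := key t' t
  have h3 : {x | t' x ≠ t x} = {x | t x ≠ t' x} := by ext; simp [eq_comm]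
  rw [h3] at h2
  rw [abs_le]
  constructor <;> linarith

/-- Two finite valued functions with almost the same distribution on both blocks almost agree after
a measure preserving bijection that respects the blocks. -/
theorem exists_tag_matching {γ : ℝ} (h0 : 0 < γ) (h1 : γ < 1) {T : Type*} [Fintype T] [Nonempty T]
    [MeasurableSpace T] [MeasurableSingletonClass T] {t t' : I → T} (ht : Measurable t)
    (ht' : Measurable t') {δ : ℝ} (hδ : 0 < δ) :
    ∃ φ ∈ blockStabilizer γ, volume.real {x | t (φ.1 x) ≠ t' x} ≤
      ∑ τ : Bool × T, |tagVolume γ t τ - tagVolume γ t' τ| + δ := by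
  classical
  have hc : (0 : ℝ) < Fintype.card (Bool × T) := by exact_mod_cast Fintype.card_pos
  -- Each tag volume moves by at most 2δ₁ on passing to the grid, and the two approximations
  -- themselves cost another 2δ₁.
  set δ₁ : ℝ := δ / (2 * Fintype.card (Bool × T) + 2) with hδ₁
  have hδ₁0 : 0 < δ₁ := by positivity
  obtain ⟨n, ⟨u, hu⟩, ⟨u', hu'⟩⟩ :=
    ((exists_tag_approx h0 h1 ht hδ₁0).and (exists_tag_approx h0 h1 ht' hδ₁0)).exists
  have hmu : ∀ v : Bool × Fin (n + 1) → T, Measurable fun x => v (cellIdx γ n x) :=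
    fun v => (measurable_of_countable v).comp measurable_cellIdx
  -- The cell permutations that are realized by a block preserving bijection fixing 0. Only closure
  -- under exchanging two cells of one block has to be known, not a realization of each permutation.
  set R : Set (Equiv.Perm (Bool × Fin (n + 1))) := {π | (∀ k, (π k).1 = k.1) ∧
    ∃ φ ∈ blockStabilizer γ, φ.1 0 = 0 ∧ ∀ x, x ≠ 0 → cellIdx γ n (φ.1 x) = π (cellIdx γ n x)}
    with hRdef
  obtain ⟨π, ⟨hπ1, φ, hφ, hφ0, hφπ⟩, hπ⟩ := exists_perm_matching
    (fun k => (k.1, u k)) (fun k => (k.1, u' k)) R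
    ⟨fun _ => rfl, 1, one_mem _, rfl, fun _ _ => rfl⟩ (by
      rintro π ⟨hπ1, φ, hφ, hφ0, hφπ⟩ i j hij
      have hblk : (π i).1 = (π j).1 := by
        rw [hπ1 i]; exact (congrArg Prod.fst hij).symm
      obtain ⟨ψ, hψ, hψ0, hψs⟩ := exists_swap_cells h0 h1 hblk
      refine ⟨fun k => ?_, ψ * φ, mul_mem hψ hφ, ?_, fun x hx => ?_⟩
      · rw [← hπ1 k, Equiv.Perm.mul_apply, Equiv.swap_apply_def]
        split_ifs with h h
        · rw [h, hblk]
        · rw [h, hblk]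
        · rfl
      · rw [MeasurePreservingBij.mul_val, Function.comp_apply, hφ0, hψ0]
      · rw [MeasurePreservingBij.mul_val, Function.comp_apply, hψs, hφπ x hx]
        · rfl
        · exact fun h => hx (φ.2.1.injective (h.trans hφ0.symm)))
  refine ⟨φ, hφ, ?_⟩
  have hvol : ∀ (v : Bool × Fin (n + 1) → T) (τ : Bool × T),
      tagVolume γ (fun x => v (cellIdx γ n x)) τ =
        (Finset.univ.filter fun k : Bool × Fin (n + 1) => (k.1, v k) = τ).card *
          cellLength γ n τ.1 := by
    intro v τ
    have : {x | (block γ x, v (cellIdx γ n x)) = τ} = cellIdx γ n ⁻¹'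
        ((Finset.univ.filter fun k : Bool × Fin (n + 1) => (k.1, v k) = τ :
          Finset (Bool × Fin (n + 1))) : Set (Bool × Fin (n + 1))) := by
      ext x
      simp only [Set.mem_ofPred_eq, Set.mem_preimage, Finset.coe_filter, Finset.mem_univ, true_and]
      rfl
    rw [tagVolume, this, volume_cellIdx_preimage h0 h1, ← nsmul_eq_mul]
    refine Finset.sum_eq_card_nsmul fun k hk => ?_
    rw [Finset.mem_filter] at hk
    rw [← hk.2]
  have hmis : volume.real {x | u (cellIdx γ n (φ.1 x)) ≠ u' (cellIdx γ n x)} ≤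
      ∑ τ : Bool × T, |tagVolume γ (fun x => u (cellIdx γ n x)) τ -
        tagVolume γ (fun x => u' (cellIdx γ n x)) τ| := by
    calc _ ≤ volume.real (⋃ τ ∈ (Finset.univ : Finset (Bool × T)), cellIdx γ n ⁻¹'
          ((Finset.univ.filter fun k : Bool × Fin (n + 1) => (k.1, u' k) = τ ∧
            ((π k).1, u (π k)) ≠ τ : Finset (Bool × Fin (n + 1))) :
              Set (Bool × Fin (n + 1)))) := by
          refine ENNReal.toReal_mono (measure_ne_top _ _) (measure_mono_ae ?_)
          filter_upwards [ae_ne_zero] with x hx hxs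
          have hxs : u (cellIdx γ n (φ.1 x)) ≠ u' (cellIdx γ n x) := hxs
          rw [hφπ x hx] at hxs
          refine Set.mem_biUnion (Finset.mem_univ ((cellIdx γ n x).1, u' (cellIdx γ n x))) ?_
          simp only [Set.mem_preimage, Finset.coe_filter, Finset.mem_univ, true_and,
            Set.mem_ofPred_eq, ne_eq, Prod.mk.injEq, not_and]
          exact fun _ => hxs
      _ ≤ ∑ τ : Bool × T, ((Finset.univ.filter fun k : Bool × Fin (n + 1) => (k.1, u' k) = τ ∧
            ((π k).1, u (π k)) ≠ τ).card : ℝ) * cellLength γ n τ.1 := by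
          refine (measureReal_biUnion_finset_le _ _).trans (Finset.sum_le_sum fun τ _ => ?_)
          rw [volume_cellIdx_preimage h0 h1, ← nsmul_eq_mul]
          refine (Finset.sum_eq_card_nsmul fun k hk => ?_).le
          rw [Finset.mem_filter] at hk
          rw [← hk.2.1]
      _ ≤ _ := by
          refine Finset.sum_le_sum fun τ _ => ?_
          rw [hvol, hvol, ← sub_mul, abs_mul, abs_of_pos (cellLength_pos h0 h1 τ.1), abs_sub_comm]
          exact mul_le_mul_of_nonneg_right (hπ τ) (cellLength_pos h0 h1 τ.1).le
  have hpre : volume.real {x | t (φ.1 x) ≠ u (cellIdx γ n (φ.1 x))} ≤ δ₁ := by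
    refine le_of_eq_of_le ?_ hu
    have hms : MeasurableSet {x | t x ≠ u (cellIdx γ n x)} :=
      (measurableSet_eq_fun ht (hmu u)).compl
    exact φ.2.2.measureReal_preimage hms.nullMeasurableSet
  have hsplit : volume.real {x | t (φ.1 x) ≠ t' x} ≤
      volume.real {x | t (φ.1 x) ≠ u (cellIdx γ n (φ.1 x))} +
      volume.real {x | u (cellIdx γ n (φ.1 x)) ≠ u' (cellIdx γ n x)} +
      volume.real {x | t' x ≠ u' (cellIdx γ n x)} := by
    refine (measureReal_mono ?_).trans ((measureReal_union_le _ _).trans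
      (add_le_add_left (measureReal_union_le _ _) _))
    intro x hx
    by_contra hcon
    simp only [Set.mem_union, Set.mem_ofPred_eq, not_or, not_not] at hcon
    exact hx (hcon.1.1.trans (hcon.1.2.trans hcon.2.symm))
  have hsum : ∑ τ : Bool × T, |tagVolume γ (fun x => u (cellIdx γ n x)) τ -
        tagVolume γ (fun x => u' (cellIdx γ n x)) τ| ≤
      ∑ τ : Bool × T, (|tagVolume γ t τ - tagVolume γ t' τ| + 2 * δ₁) := by
    refine Finset.sum_le_sum fun τ _ => ?_
    have h2 := (abs_tagVolume_sub_le (γ := γ) t (fun x => u (cellIdx γ n x)) τ).trans hu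
    have h3 := (abs_tagVolume_sub_le (γ := γ) t' (fun x => u' (cellIdx γ n x)) τ).trans hu'
    rw [abs_le] at h2 h3
    have h4 := neg_abs_le (tagVolume γ t τ - tagVolume γ t' τ)
    have h5 := le_abs_self (tagVolume γ t τ - tagVolume γ t' τ)
    rw [abs_le]
    constructor <;> linarith
  rw [Finset.sum_add_distrib, Finset.sum_const, nsmul_eq_mul, Finset.card_univ] at hsum
  have hδe : (2 * Fintype.card (Bool × T) + 2) * δ₁ = δ := by rw [hδ₁]; field_simp
  nlinarith


/-! ### Weak regularity -/

/-- The rectangle kernel with value `ε` or `-ε` on `S × T`. -/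
noncomputable def rectKernel (ε : ℝ) (s : Bool) (S T : Set I) : I × I → ℝ :=
  (S ×ˢ T).indicator fun _ => if s then ε else -ε

theorem measurable_rectKernel {ε : ℝ} {s : Bool} {S T : Set I} (hS : MeasurableSet S)
    (hT : MeasurableSet T) : Measurable (rectKernel ε s S T) :=
  measurable_const.indicator (hS.prod hT)

theorem abs_rectKernel_le {ε : ℝ} (hε : 0 ≤ ε) (s : Bool) (S T : Set I) (z : I × I) :
    |rectKernel ε s S T z| ≤ ε := by
  classical
  unfold rectKernel
  rw [Set.indicator_apply]
  split_ifs <;> simp [abs_of_nonneg hε, hε]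

/-- The error of the approximation by the first `n` rectangles. -/
noncomputable def rectError (f : Graphon) (ε : ℝ) (s : ℕ → Bool) (S T : ℕ → Set I) (n : ℕ) :
    I × I → ℝ :=
  fun z => f z.1 z.2 - ∑ i ∈ Finset.range n, rectKernel ε (s i) (S i) (T i) z

theorem measurable_rectError (f : Graphon) (ε : ℝ) (s : ℕ → Bool) {S T : ℕ → Set I}
    (hS : ∀ i, MeasurableSet (S i)) (hT : ∀ i, MeasurableSet (T i)) (n : ℕ) :
    Measurable (rectError f ε s S T n) :=
  f.measurable_uncurry.sub
    (Finset.measurable_sum _ fun i _ => measurable_rectKernel (hS i) (hT i))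

theorem abs_rectError_le (f : Graphon) {ε : ℝ} (hε : 0 ≤ ε) (s : ℕ → Bool) (S T : ℕ → Set I)
    (n : ℕ) (z : I × I) : |rectError f ε s S T n z| ≤ 1 + n * ε := by
  refine (abs_sub _ _).trans (add_le_add ?_ ?_)
  · rw [abs_of_nonneg (f.nonneg _ _)]; exact f.le_one _ _
  · refine (Finset.abs_sum_le_sum_abs _ _).trans ?_
    refine (Finset.sum_le_sum fun i _ => abs_rectKernel_le hε _ _ _ _).trans ?_
    simp

/-- Energy decrement: while some rectangle integral of the error exceeds ε in absolute value,
subtracting ±ε on that rectangle lowers the squared L² norm by at least ε². -/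
theorem exists_rectError_energy (f : Graphon) {ε : ℝ} (hε : 0 < ε) (n : ℕ) :
    ∃ (s : ℕ → Bool) (S T : ℕ → Set I), (∀ i, MeasurableSet (S i)) ∧ (∀ i, MeasurableSet (T i)) ∧
      (CutLE (rectError f ε s S T n) ε ∨ ∫ z, rectError f ε s S T n z ^ 2 ≤ 1 - n * ε ^ 2) := by
  induction n with
  | zero =>
    refine ⟨fun _ => true, fun _ => ∅, fun _ => ∅, fun _ => .empty, fun _ => .empty, Or.inr ?_⟩
    have : ∀ z : I × I, rectError f ε (fun _ => true) (fun _ => ∅) (fun _ => ∅) 0 z ^ 2 ≤ 1 := by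
      intro z
      simp only [rectError, Finset.range_zero, Finset.sum_empty, sub_zero]
      exact pow_le_one₀ (f.nonneg _ _) (f.le_one _ _)
    calc _ ≤ ∫ _z : I × I, (1 : ℝ) :=
          integral_mono_of_nonneg (.of_forall fun z => sq_nonneg _) (integrable_const 1)
            (.of_forall this)
      _ = _ := by simp
  | succ n ih =>
    obtain ⟨s, S, T, hS, hT, h⟩ := ih
    have hcongr : ∀ (b : Bool) (A B : Set I) (z : I × I),
        rectError f ε (Function.update s n b) (Function.update S n A) (Function.update T n B)
          (n + 1) z = rectError f ε s S T n z - rectKernel ε b A B z := by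
      intro b A B z
      simp only [rectError, Finset.sum_range_succ, Function.update_self]
      rw [← sub_sub]
      congr 2
      refine Finset.sum_congr rfl fun i hi => ?_
      have : i ≠ n := (Finset.mem_range.1 hi).ne
      simp [Function.update_of_ne this]
    have hmeas : ∀ (S : ℕ → Set I) (A : Set I), (∀ i, MeasurableSet (S i)) → MeasurableSet A →
        ∀ i, MeasurableSet (Function.update S n A i) := by
      intro S A hS hA i
      by_cases hi : i = n
      · subst hi; simpa using hA
      · simpa [Function.update_of_ne hi] using hS i
    by_cases hcut : CutLE (rectError f ε s S T n) ε
    -- Once the error is small, empty rectangles pad the list to the prescribed length.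
    · refine ⟨Function.update s n true, Function.update S n ∅, Function.update T n ∅,
        hmeas S ∅ hS .empty, hmeas T ∅ hT .empty, Or.inl ?_⟩
      have : rectError f ε (Function.update s n true) (Function.update S n ∅)
          (Function.update T n ∅) (n + 1) = rectError f ε s S T n := by
        funext z
        rw [hcongr]
        simp [rectKernel]
      rwa [this]
    · have hE := h.resolve_left hcut
      unfold CutLE at hcut
      push Not at hcut
      obtain ⟨A, B, hA, hB, hlt⟩ := hcut
      set R := rectError f ε s S T n with hR
      have hRm : Measurable R := measurable_rectError f ε s hS hT n
      have hRb : ∀ z, |R z| ≤ 1 + n * ε := abs_rectError_le f hε.le s S T n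
      have hRi : Integrable R :=
        Integrable.of_bound hRm.aestronglyMeasurable _ (.of_forall hRb)
      have hR2 : Integrable fun z => R z ^ 2 :=
        Integrable.of_bound (hRm.pow_const 2).aestronglyMeasurable ((1 + n * ε) ^ 2)
          (.of_forall fun z => by
            rw [Real.norm_eq_abs, abs_pow]
            exact pow_le_pow_left₀ (abs_nonneg _) (hRb z) 2)
      set b : Bool := decide (0 ≤ ∫ z in A ×ˢ B, R z) with hb
      set c : ℝ := if b then ε else -ε with hc
      have hcR : ε < |∫ z in A ×ˢ B, R z| := hlt
      have hcmul : ε ^ 2 ≤ c * ∫ z in A ×ˢ B, R z := by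
        by_cases h0 : 0 ≤ ∫ z in A ×ˢ B, R z
        · have : c = ε := by simp [hc, hb, h0]
          rw [abs_of_nonneg h0] at hcR
          rw [this]; nlinarith
        · have : c = -ε := by simp [hc, hb, h0]
          rw [abs_of_neg (not_le.1 h0)] at hcR
          rw [this]; nlinarith
      have hc2 : c ^ 2 = ε ^ 2 := by
        rw [hc]; split_ifs <;> ring
      refine ⟨Function.update s n b, Function.update S n A, Function.update T n B,
        hmeas S A hS hA, hmeas T B hT hB, Or.inr ?_⟩
      have hAB : MeasurableSet (A ×ˢ B) := hA.prod hB
      have hexp : ∀ z, rectError f ε (Function.update s n b) (Function.update S n A)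
          (Function.update T n B) (n + 1) z ^ 2 =
          R z ^ 2 - (A ×ˢ B).indicator (fun z => 2 * c * R z - ε ^ 2) z := by
        classical
        intro z
        rw [hcongr]
        change (R z - (A ×ˢ B).indicator (fun _ => c) z) ^ 2 = _
        rw [Set.indicator_apply, Set.indicator_apply, ← hc2]
        by_cases hz : z ∈ A ×ˢ B
        · rw [if_pos hz, if_pos hz]; ring
        · rw [if_neg hz, if_neg hz]; ring
      simp_rw [hexp]
      have hint : Integrable fun z => 2 * c * R z - ε ^ 2 :=
        (hRi.const_mul _).sub (integrable_const _)
      rw [integral_sub hR2 (hint.indicator hAB), integral_indicator hAB,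
        integral_sub (hRi.const_mul _).integrableOn (integrable_const _), integral_const_mul,
        setIntegral_const, smul_eq_mul]
      -- The decrement is 2c ∫ R over A × B minus ε² |A × B|, which is at least 2ε² - ε².
      have hv : volume.real (A ×ˢ B) ≤ 1 := measureReal_le_one
      push_cast
      nlinarith [sq_nonneg ε]

/-! ### Tagged approximation -/

/-- The tag of a point records its membership in the sets `S i` and `T i`. -/
noncomputable def rectTag (S T : ℕ → Set I) (m : ℕ) (x : I) : Fin m → Bool × Bool :=
  open Classical in fun i => (decide (x ∈ S i), decide (x ∈ T i))

/-- The step kernel on tags. -/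
noncomputable def tagKernel {m : ℕ} (ε : ℝ) (s : Fin m → Bool) (u v : Fin m → Bool × Bool) : ℝ :=
  ∑ i, if (u i).1 ∧ (v i).2 then (if s i then ε else -ε) else 0

theorem abs_tagKernel_le {m : ℕ} {ε : ℝ} (hε : 0 ≤ ε) (s : Fin m → Bool)
    (u v : Fin m → Bool × Bool) : |tagKernel ε s u v| ≤ m * ε := by
  refine (Finset.abs_sum_le_sum_abs _ _).trans ?_
  refine (Finset.sum_le_sum (g := fun _ => ε) fun i _ => ?_).trans (by simp)
  split_ifs <;> simp [abs_of_nonneg hε, hε]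

theorem measurable_rectTag {S T : ℕ → Set I} (hS : ∀ i, MeasurableSet (S i))
    (hT : ∀ i, MeasurableSet (T i)) (m : ℕ) : Measurable (rectTag S T m) := by
  refine measurable_pi_lambda _ fun i => Measurable.prodMk ?_ ?_
  · refine measurable_to_bool ?_
    convert hS i
    ext x; simp
  · refine measurable_to_bool ?_
    convert hT i
    ext x; simp

theorem sum_rectKernel_eq (ε : ℝ) (s : ℕ → Bool) (S T : ℕ → Set I) (m : ℕ) (z : I × I) :
    ∑ i ∈ Finset.range m, rectKernel ε (s i) (S i) (T i) z =
      tagKernel ε (fun i : Fin m => s i) (rectTag S T m z.1) (rectTag S T m z.2) := by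
  classical
  rw [Finset.sum_range]
  refine Finset.sum_congr rfl fun i _ => ?_
  simp [rectKernel, rectTag, Set.indicator_apply, Set.mem_prod]

/-- Number of rectangles that suffices for precision `ε`. -/
noncomputable def regularitySize (ε : ℝ) : ℕ := ⌈1 / ε ^ 2⌉₊ + 1

/-- Weak regularity lemma: a graphon is approximated in the cut norm by a step kernel whose
complexity depends on the precision only. -/
theorem exists_tagKernel_approx (f : Graphon) {ε : ℝ} (hε : 0 < ε) :
    ∃ (s : Fin (regularitySize ε) → Bool) (t : I → Fin (regularitySize ε) → Bool × Bool),
      Measurable t ∧ CutLE (fun z => f z.1 z.2 - tagKernel ε s (t z.1) (t z.2)) ε := by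
  obtain ⟨s, S, T, hS, hT, h⟩ := exists_rectError_energy f hε (regularitySize ε)
  refine ⟨fun i => s i, rectTag S T _, measurable_rectTag hS hT _, ?_⟩
  simp_rw [← sum_rectKernel_eq]
  -- After more than 1/ε² decrements the energy would be negative.
  refine h.resolve_right fun h2 => ?_
  have h3 : 0 ≤ ∫ z, rectError f ε s S T (regularitySize ε) z ^ 2 :=
    integral_nonneg fun z => sq_nonneg _
  have h4 : 1 / ε ^ 2 ≤ ⌈1 / ε ^ 2⌉₊ := Nat.le_ceil _
  rw [div_le_iff₀ (by positivity)] at h4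
  unfold regularitySize at h2 h3
  push_cast at h2
  nlinarith [sq_pos_of_pos hε]

/-! ### Total boundedness -/

/-- Graphons with the cut metric for relabellings that respect the blocks `[0,γ]` and `(γ,1]`. -/
def BlockGraphon (_γ : ℝ) : Type := Graphon

noncomputable instance (γ : ℝ) : PseudoMetricSpace (BlockGraphon γ) where
  dist f g := cutMetricOn (blockStabilizer γ) f g
  dist_self f := cutMetricOn_self _ f
  dist_comm f g := cutMetricOn_comm _ f g
  dist_triangle f g h := cutMetricOn_triangle _ f g h

theorem dist_blockGraphon {γ : ℝ} (f g : BlockGraphon γ) :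
    dist f g = cutMetricOn (blockStabilizer γ) f g := rfl

theorem measurable_tagKernel {m : ℕ} (ε : ℝ) (s : Fin m → Bool) {t : I → Fin m → Bool × Bool}
    (ht : Measurable t) : Measurable fun z : I × I => tagKernel ε s (t z.1) (t z.2) := by
  have h : Measurable fun w : (Fin m → Bool × Bool) × (Fin m → Bool × Bool) =>
    tagKernel ε s w.1 w.2 := measurable_of_countable _
  exact h.comp ((ht.comp measurable_fst).prodMk (ht.comp measurable_snd))

theorem integrable_tagKernel {m : ℕ} {ε : ℝ} (hε : 0 ≤ ε) (s : Fin m → Bool)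
    {t : I → Fin m → Bool × Bool} (ht : Measurable t) :
    Integrable fun z : I × I => tagKernel ε s (t z.1) (t z.2) :=
  Integrable.of_bound (measurable_tagKernel ε s ht).aestronglyMeasurable _
    (.of_forall fun _ => abs_tagKernel_le hε _ _ _)

/-- Step kernels on tags that agree outside a small set are close. -/
theorem cutLE_tagKernel_sub {m : ℕ} {ε ν : ℝ} (hε : 0 ≤ ε) (s : Fin m → Bool)
    {t t' : I → Fin m → Bool × Bool} (ht : Measurable t) (ht' : Measurable t')
    (h : volume.real {x | t x ≠ t' x} ≤ ν) :
    CutLE (fun z => tagKernel ε s (t z.1) (t z.2) - tagKernel ε s (t' z.1) (t' z.2))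
      (4 * m * ε * ν) := by
  have hi := (integrable_tagKernel hε s ht).sub (integrable_tagKernel hε s ht')
  refine cutLE_of_integral_abs_le hi ?_
  set M := {x | t x ≠ t' x} with hM
  have hMm : MeasurableSet M := (measurableSet_eq_fun ht ht').compl
  have hmε : 0 ≤ (m : ℝ) * ε := by positivity
  have hi1 : Integrable fun z : I × I => (M ×ˢ Set.univ).indicator (fun _ => 2 * (m * ε)) z :=
    (integrable_const _).indicator (hMm.prod .univ)
  have hi2 : Integrable fun z : I × I => (Set.univ ×ˢ M).indicator (fun _ => 2 * (m * ε)) z :=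
    (integrable_const _).indicator (MeasurableSet.univ.prod hMm)
  calc _ ≤ ∫ z : I × I, ((M ×ˢ Set.univ).indicator (fun _ => 2 * (m * ε)) z +
        (Set.univ ×ˢ M).indicator (fun _ => 2 * (m * ε)) z) := by
        refine integral_mono hi.abs (hi1.add hi2) fun z => ?_
        have hn1 : 0 ≤ (M ×ˢ Set.univ).indicator (fun _ : I × I => 2 * (m * ε)) z :=
          Set.indicator_nonneg (fun _ _ => by positivity) z
        have hn2 : 0 ≤ (Set.univ ×ˢ M).indicator (fun _ : I × I => 2 * (m * ε)) z :=
          Set.indicator_nonneg (fun _ _ => by positivity) z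
        have hb : |tagKernel ε s (t z.1) (t z.2) - tagKernel ε s (t' z.1) (t' z.2)| ≤
            2 * (m * ε) :=
          (abs_sub _ _).trans (by
            linarith [abs_tagKernel_le hε s (t z.1) (t z.2),
              abs_tagKernel_le hε s (t' z.1) (t' z.2)])
        change |tagKernel ε s (t z.1) (t z.2) - tagKernel ε s (t' z.1) (t' z.2)| ≤ _
        by_cases h1 : z.1 ∈ M
        · rw [Set.indicator_of_mem (show z ∈ M ×ˢ Set.univ from ⟨h1, trivial⟩)]
          linarith
        · by_cases h2 : z.2 ∈ M
          · rw [Set.indicator_of_mem (show z ∈ Set.univ ×ˢ M from ⟨trivial, h2⟩)]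
            linarith
          · rw [hM, Set.mem_ofPred_eq, not_not] at h1 h2
            rw [h1, h2, sub_self, abs_zero]
            exact add_nonneg hn1 hn2
    _ ≤ _ := by
        rw [integral_add hi1 hi2, integral_indicator (hMm.prod .univ),
          integral_indicator (MeasurableSet.univ.prod hMm), setIntegral_const, setIntegral_const,
          Measure.volume_eq_prod, measureReal_prod_prod, measureReal_prod_prod]
        simp only [probReal_univ, smul_eq_mul, mul_one, one_mul]
        nlinarith

/-- A graphon is encoded by the signs of a step approximation and the rounded measures of its tag
classes in each block. There are finitely many codes, and graphons with equal codes are aligned by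
`exists_tag_matching`. -/
theorem totallyBounded_blockGraphon {γ : ℝ} (h0 : 0 < γ) (h1 : γ < 1) :
    TotallyBounded (Set.univ : Set (BlockGraphon γ)) := by
  classical
  refine Metric.totallyBounded_of_finite_discretization fun ε hε => ?_
  set ε' := ε / 4 with hε'
  have hε'0 : 0 < ε' := by positivity
  set m := regularitySize ε' with hm
  have hm0 : (0 : ℝ) < m := by
    rw [hm]; unfold regularitySize; push_cast; positivity
  set c := Fintype.card (Bool × (Fin m → Bool × Bool)) with hcdef
  have hc0 : (0 : ℝ) < c := by exact_mod_cast Fintype.card_pos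
  -- Rounding to multiples of 1/Q costs c/Q = 1/(8m) in total, the matching another 1/(8m). A
  -- mismatch of 1/(4m) changes the step kernel by at most ε', so with both approximation errors the
  -- distance is at most 3ε' < ε.
  set Q : ℕ := 8 * m * c with hQ
  have hQ0 : (0 : ℝ) < Q := by rw [hQ]; push_cast; positivity
  choose s t ht hcut using fun f : Graphon => exists_tagKernel_approx f hε'0
  have hfl : ∀ (f : Graphon) τ, ⌊Q * tagVolume γ (t f) τ⌋₊ < Q + 1 := by
    intro f τ
    refine Nat.lt_succ_of_le (Nat.floor_le_of_le ?_)
    have : tagVolume γ (t f) τ ≤ 1 := measureReal_le_one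
    nlinarith
  refine ⟨(Fin m → Bool) × (Bool × (Fin m → Bool × Bool) → Fin (Q + 1)), inferInstance,
    fun f => (s f.1, fun τ => ⟨_, hfl f.1 τ⟩), ?_⟩
  intro f' g' hfg
  obtain ⟨f, _⟩ := f'
  obtain ⟨g, _⟩ := g'
  have hs : s f = s g := congrArg Prod.fst hfg
  have hv : (fun τ => (⟨_, hfl f τ⟩ : Fin (Q + 1))) = fun τ => ⟨_, hfl g τ⟩ :=
    congrArg Prod.snd hfg
  change dist f g < ε
  have hvol : ∀ τ, |tagVolume γ (t g) τ - tagVolume γ (t f) τ| ≤ 1 / Q := by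
    intro τ
    have h2 : ⌊Q * tagVolume γ (t f) τ⌋₊ = ⌊Q * tagVolume γ (t g) τ⌋₊ :=
      congrArg Fin.val (congrFun hv τ)
    have hn : ∀ h : Graphon, 0 ≤ Q * tagVolume γ (t h) τ := fun h =>
      mul_nonneg hQ0.le measureReal_nonneg
    have h3 := Nat.floor_le (hn f)
    have h4 := Nat.lt_floor_add_one (Q * tagVolume γ (t f) τ)
    have h5 := Nat.floor_le (hn g)
    have h6 := Nat.lt_floor_add_one (Q * tagVolume γ (t g) τ)
    rw [h2] at h3 h4
    rw [le_div_iff₀ hQ0, ← abs_of_pos hQ0, ← abs_mul, abs_le]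
    constructor <;> nlinarith
  obtain ⟨φ, hφ, hmis⟩ := exists_tag_matching h0 h1 (ht g) (ht f)
    (show (0 : ℝ) < 1 / (8 * m) by positivity)
  have hmis' : volume.real {x | t g (φ.1 x) ≠ t f x} ≤ 1 / (4 * m) := by
    refine hmis.trans ?_
    have : ∑ τ, |tagVolume γ (t g) τ - tagVolume γ (t f) τ| ≤ 1 / (8 * m) := by
      refine (Finset.sum_le_sum fun τ _ => hvol τ).trans ?_
      rw [Finset.sum_const, nsmul_eq_mul, Finset.card_univ, ← hcdef, hQ]
      push_cast
      refine le_of_eq ?_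
      field_simp
    refine (add_le_add_left this _).trans (le_of_eq ?_)
    field_simp
    norm_num
  rw [dist_blockGraphon]
  refine (cutMetricOn_le _ f g hφ).trans_lt ?_
  have htg : Measurable fun x => t g (φ.1 x) := (ht g).comp φ.2.2.measurable
  have e1 := hcut f
  have e2 := ((hcut g).comp φ).neg
  have e3 := (cutLE_tagKernel_sub hε'0.le (s f) htg (ht f) hmis').neg
  have i1 := f.integrable_uncurry.sub (integrable_tagKernel hε'0.le (s f) (ht f))
  have i2 := ((g.relabel φ).integrable_uncurry.sub
    (integrable_tagKernel hε'0.le (s f) htg)).neg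
  have i3 := ((integrable_tagKernel hε'0.le (s f) htg).sub
    (integrable_tagKernel hε'0.le (s f) (ht f))).neg
  have hs' : s g = s f := hs.symm
  rw [hs'] at e2
  have e4 := (e1.add e2 i1 i2).add e3 (i1.add i2) i3
  refine (cutDist_le (r := 3 * ε') ?_).trans_lt (by rw [hε']; linarith)
  refine CutLE.mono (r := ε' + ε' + 4 * m * ε' * (1 / (4 * m))) ?_ ?_
  · convert e4 using 1
    funext z
    change Graphon.toFun f z.1 z.2 - Graphon.toFun g (φ.1 z.1) (φ.1 z.2) = _
    ring
  · refine le_of_eq ?_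
    field_simp
    norm_num


/-! ### Weak convergence from rectangles -/

/-- Rectangles form a generating π-system; the uniform bound on the kernels dominates the series in
the step for countable unions. -/
theorem tendsto_setIntegral_of_rectangles {ι : Type*} {l : Filter ι} {k : ι → I × I → ℝ} {C : ℝ}
    (hkm : ∀ i, Measurable (k i)) (hkb : ∀ i z, |k i z| ≤ C)
    (h : ∀ S T : Set I, MeasurableSet S → MeasurableSet T →
      Tendsto (fun i => ∫ z in S ×ˢ T, k i z) l (𝓝 0))
    {E : Set (I × I)} (hE : MeasurableSet E) :
    Tendsto (fun i => ∫ z in E, k i z) l (𝓝 0) := by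
  have hki : ∀ i, Integrable (k i) := fun i =>
    Integrable.of_bound (hkm i).aestronglyMeasurable C (.of_forall (hkb i))
  induction E, hE using MeasurableSpace.induction_on_inter generateFrom_prod.symm
    isPiSystem_prod with
  | empty => simpa using tendsto_const_nhds
  | basic t ht =>
    obtain ⟨S, hS, T, hT, rfl⟩ := ht
    exact h S T hS hT
  | compl t ht ih =>
    have hu := h Set.univ Set.univ .univ .univ
    have := hu.sub ih
    rw [sub_zero] at this
    refine this.congr fun i => ?_
    rw [setIntegral_compl ht (hki i), Set.univ_prod_univ, setIntegral_univ]
  | iUnion f hd hf ih =>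
    have hC : Summable fun j => C * volume.real (f j) := by
      refine Summable.mul_left _ (ENNReal.summable_toReal ?_)
      rw [← measure_iUnion hd hf]
      exact measure_ne_top _ _
    have := tendsto_tsum_of_dominated_convergence (𝓕 := l)
      (f := fun i j => ∫ z in f j, k i z) (g := fun _ => 0) hC ih
      (.of_forall fun i j => by
        rw [Real.norm_eq_abs]
        exact norm_setIntegral_le_of_norm_le_const (f := k i) (measure_lt_top _ _)
          fun z _ => (Real.norm_eq_abs _).trans_le (hkb i z))
    rw [tsum_zero] at this
    refine this.congr fun i => ?_
    rw [integral_iUnion hf hd (hki i).integrableOn]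

/-- Simple functions are dense in L¹, and the uniformly bounded kernels act equicontinuously on L¹.
-/
theorem tendsto_integral_mul_of_rectangles {ι : Type*} {l : Filter ι} {k : ι → I × I → ℝ} {C : ℝ}
    (hkm : ∀ i, Measurable (k i)) (hkb : ∀ i z, |k i z| ≤ C)
    (h : ∀ S T : Set I, MeasurableSet S → MeasurableSet T →
      Tendsto (fun i => ∫ z in S ×ˢ T, k i z) l (𝓝 0))
    {β : I × I → ℝ} (hβ : Integrable β) :
    Tendsto (fun i => ∫ z, β z * k i z) l (𝓝 0) := by
  have hmul : ∀ {f : I × I → ℝ}, Integrable f → ∀ i, Integrable fun z => f z * k i z :=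
    fun hf i => hf.mul_bdd (c := C) (hkm i).aestronglyMeasurable (.of_forall (hkb i))
  refine Integrable.induction
    (fun β : I × I → ℝ => Tendsto (fun i => ∫ z, β z * k i z) l (𝓝 0)) ?_ ?_ ?_ ?_ hβ
  · intro c s hs _
    have h1 := (tendsto_setIntegral_of_rectangles hkm hkb h hs).const_mul c
    rw [mul_zero] at h1
    refine h1.congr fun i => ?_
    rw [← integral_const_mul, ← integral_indicator hs]
    congr 1
    funext z
    by_cases hz : z ∈ s <;> simp [hz]
  · intro f g _ hf hg ihf ihg
    have := ihf.add ihg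
    rw [add_zero] at this
    refine this.congr fun i => ?_
    rw [← integral_add (hmul hf i) (hmul hg i)]
    congr 1
    funext z
    simp [add_mul]
  · have hnorm : ∀ (f g : Lp ℝ 1 (volume : Measure (I × I))) i,
        |(∫ z, f z * k i z) - ∫ z, g z * k i z| ≤ |C| * dist f g := by
      intro f g i
      have hf := L1.integrable_coeFn f
      have hg := L1.integrable_coeFn g
      rw [dist_eq_norm, L1.norm_eq_integral_norm, ← integral_const_mul,
        ← integral_sub (hmul hf i) (hmul hg i), ← Real.norm_eq_abs]
      refine norm_integral_le_of_norm_le ((L1.integrable_coeFn (f - g)).norm.const_mul _) ?_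
      filter_upwards [Lp.coeFn_sub f g] with z hz
      rw [hz, Pi.sub_apply, ← sub_mul, norm_mul, mul_comm, Real.norm_eq_abs (k i z)]
      exact mul_le_mul_of_nonneg_right ((hkb i z).trans (le_abs_self C)) (norm_nonneg _)
    refine isClosed_of_closure_subset fun f hf => ?_
    rw [Set.mem_ofPred_eq, Metric.tendsto_nhds]
    intro ε hε
    obtain ⟨g, hg, hfg⟩ := Metric.mem_closure_iff.1 hf (ε / (2 * (|C| + 1))) (by positivity)
    have hg := Metric.tendsto_nhds.1 hg (ε / 2) (by positivity)
    filter_upwards [hg] with i hi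
    rw [Real.dist_eq, sub_zero] at hi ⊢
    have h2 := hnorm f g i
    have h3 : |C| * dist f g ≤ ε / 2 := by
      rw [lt_div_iff₀ (by positivity)] at hfg
      nlinarith [abs_nonneg C, dist_nonneg (x := f) (y := g)]
    calc |∫ z, f z * k i z| = |((∫ z, f z * k i z) - ∫ z, g z * k i z) + ∫ z, g z * k i z| := by
          rw [sub_add_cancel]
      _ ≤ _ := abs_add_le _ _
      _ < ε := by linarith
  · intro f g hfg _ ih
    refine ih.congr fun i => integral_congr_ae ?_
    filter_upwards [hfg] with z hz
    rw [hz]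

/-! ### Weak limits of graphons -/

/-- Banach–Alaoglu in L² along a nonprincipal ultrafilter. The bounds and the symmetry pass to the
limit through integrals over sets and hold only almost everywhere there. -/
theorem exists_weak_limit (g : ℕ → Graphon) :
    ∃ (F : Graphon) (l : Filter ℕ), l.NeBot ∧ l ≤ atTop ∧
      ∀ S T : Set I, MeasurableSet S → MeasurableSet T →
        Tendsto (fun n => ∫ z in S ×ˢ T, g n z.1 z.2) l (𝓝 (∫ z in S ×ˢ T, F z.1 z.2)) := by
  have hmem : ∀ n, MemLp (fun z : I × I => g n z.1 z.2) 2 := fun n =>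
    MemLp.of_bound (g n).measurable_uncurry.aestronglyMeasurable 1 (.of_forall fun z => by
      rw [Real.norm_eq_abs, abs_of_nonneg ((g n).nonneg _ _)]; exact (g n).le_one _ _)
  set G : ℕ → Lp ℝ 2 (volume : Measure (I × I)) := fun n => (hmem n).toLp with hG
  have hGn : ∀ n, ‖G n‖ ≤ 1 := by
    intro n
    refine (Lp.norm_le_of_ae_bound (C := 1) zero_le_one ?_).trans
      (by simp [measureUnivNNReal])
    filter_upwards [(hmem n).coeFn_toLp] with z hz
    rw [hG]
    simp only [hz]
    rw [Real.norm_eq_abs, abs_of_nonneg ((g n).nonneg _ _)]; exact (g n).le_one _ _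
  set ℓ : ℕ → WeakDual ℝ (Lp ℝ 2 (volume : Measure (I × I))) := fun n =>
    StrongDual.toWeakDual (InnerProductSpace.toDual ℝ _ (G n)) with hℓ
  have hball : ∀ n, ℓ n ∈ WeakDual.toStrongDual ⁻¹' Metric.closedBall 0 1 := by
    intro n
    simp only [Set.mem_preimage, mem_closedBall_zero_iff]
    change ‖InnerProductSpace.toDual ℝ _ (G n)‖ ≤ 1
    rw [LinearIsometryEquiv.norm_map]
    exact hGn n
  set u : Ultrafilter ℕ := hyperfilter ℕ
  obtain ⟨L, -, hL⟩ := (WeakDual.isCompact_closedBall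
    (0 : StrongDual ℝ (Lp ℝ 2 (volume : Measure (I × I)))) 1).ultrafilter_le_nhds (u.map ℓ)
      (by
        rw [le_principal_iff]
        exact Filter.mem_map.2 (Filter.univ_mem' hball))
  set F₀ : Lp ℝ 2 (volume : Measure (I × I)) :=
    (InnerProductSpace.toDual ℝ _).symm (WeakDual.toStrongDual L) with hF₀
  have hFi : Integrable F₀ := (Lp.memLp F₀).integrable one_le_two
  have hlim : ∀ E : Set (I × I), MeasurableSet E →
      Tendsto (fun n => ∫ z in E, g n z.1 z.2) u (𝓝 (∫ z in E, F₀ z)) := by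
    intro E hE
    set v := indicatorConstLp 2 hE (measure_ne_top volume E) (1 : ℝ) with hv
    have h1 : Tendsto (fun n => ℓ n v) u (𝓝 (L v)) :=
      ((WeakDual.eval_continuous v).tendsto L).comp hL
    have h2 : ∀ n, ℓ n v = ∫ z in E, g n z.1 z.2 := by
      intro n
      change inner ℝ (G n) v = _
      rw [real_inner_comm, hv, L2.inner_indicatorConstLp_one]
      exact setIntegral_congr_ae hE ((hmem n).coeFn_toLp.mono fun z hz _ => hz)
    have h3 : L v = ∫ z in E, F₀ z := by
      have : L v = inner ℝ F₀ v := by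
        rw [hF₀, InnerProductSpace.toDual_symm_apply]
        rfl
      rw [this, real_inner_comm, hv, L2.inner_indicatorConstLp_one]
    rw [← h3]
    exact h1.congr h2
  have h0 : 0 ≤ᵐ[volume] F₀ := by
    refine ae_nonneg_of_forall_setIntegral_nonneg hFi fun E hE _ => ?_
    exact ge_of_tendsto (hlim E hE) (.of_forall fun n => integral_nonneg fun z => (g n).nonneg _ _)
  have h1 : F₀ ≤ᵐ[volume] fun _ => 1 := by
    refine ae_le_of_forall_setIntegral_le hFi (integrable_const 1) fun E hE _ => ?_
    exact le_of_tendsto (hlim E hE) (.of_forall fun n =>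
      setIntegral_mono (g n).integrable_uncurry.integrableOn (integrable_const _).integrableOn
        fun z => (g n).le_one _ _)
  have hsw : MeasurePreserving (Prod.swap : I × I → I × I) volume volume :=
    Measure.measurePreserving_swap
  have hswap : (fun z => F₀ z.swap) =ᵐ[volume] F₀ := by
    refine Integrable.ae_eq_of_forall_setIntegral_eq _ _ (hsw.integrable_comp_of_integrable hFi)
      hFi fun E hE _ => ?_
    have hemb : MeasurableEmbedding (Prod.swap : I × I → I × I) :=
      MeasurableEquiv.prodComm.measurableEmbedding
    have e1 : ∀ f : I × I → ℝ, ∫ z in E, f z.swap = ∫ z in Prod.swap ⁻¹' E, f z := by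
      intro f
      have := hsw.setIntegral_preimage_emb hemb f (Prod.swap ⁻¹' E)
      rw [← this, ← Set.preimage_comp, Prod.swap_swap_eq, Set.preimage_id]
    rw [e1]
    refine tendsto_nhds_unique (hlim _ (measurable_swap hE)) ?_
    refine (hlim E hE).congr fun n => ?_
    rw [← e1]
    exact setIntegral_congr_fun hE fun z _ => (g n).symm_toFun _ _
  obtain ⟨F₁, hF₁m, hF₁⟩ := (Lp.aestronglyMeasurable F₀)
  have hF₁m := hF₁m.measurable
  -- Symmetrizing and truncating a measurable representative makes the constraints of a graphon hold
  -- everywhere without changing its class.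
  set F : Graphon :=
    { toFun := fun x y => max 0 (min 1 ((F₁ (x, y) + F₁ (y, x)) / 2))
      measurable_toFun := by
        have : Measurable fun z : I × I => max 0 (min 1 ((F₁ z + F₁ z.swap) / 2)) :=
          measurable_const.max (measurable_const.min
            ((hF₁m.add (hF₁m.comp measurable_swap)).div_const 2))
        exact this
      symm_toFun := fun x y => by rw [add_comm]
      mem_Icc_toFun := fun x y => ⟨le_max_left _ _, max_le zero_le_one (min_le_left _ _)⟩ }
    with hF
  have hFF : (fun z : I × I => F z.1 z.2) =ᵐ[volume] F₀ := by
    have h2 := hsw.quasiMeasurePreserving.ae_eq_comp hF₁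
    filter_upwards [h0, h1, hswap, hF₁, h2] with z hz0 hz1 hzs hz hz2
    change max 0 (min 1 ((F₁ z + F₁ z.swap) / 2)) = F₀ z
    have hz2 : F₀ z.swap = F₁ z.swap := hz2
    rw [← hz, ← hz2, hzs, add_self_div_two, min_eq_right hz1]
    exact max_eq_right hz0
  refine ⟨F, u, inferInstance, Nat.hyperfilter_le_atTop, fun S T hS hT => ?_⟩
  rw [setIntegral_congr_ae (hS.prod hT) (hFF.mono fun z hz _ => hz)]
  exact hlim _ (hS.prod hT)

/-! ### Compactness -/

/-- Accumulated relabellings turn a rapidly Cauchy sequence into one that is Cauchy for the cut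
distance. The bound on each rectangle integral survives a weak limit, so that limit is the limit in
cut distance. -/
theorem completeSpace_blockGraphon (γ : ℝ) : CompleteSpace (BlockGraphon γ) := by
  refine Metric.complete_of_convergent_controlled_sequences (fun n => (1 / 2) ^ n)
    (fun n => by positivity) fun u hu => ?_
  set v : ℕ → Graphon := u with hv
  have hstep : ∀ n, ∃ φ ∈ blockStabilizer γ,
      cutDist (v n) ((v (n + 1)).relabel φ) < (1 / 2) ^ n := fun n =>
    exists_lt_of_cutMetricOn_lt (hu n n (n + 1) le_rfl n.le_succ)
  choose φ hφ hd using hstep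
  set ψ : ℕ → MeasurePreservingBij := fun n => Nat.rec 1 (fun n ψ => φ n * ψ) n with hψ
  have hψs : ∀ n, ψ (n + 1) = φ n * ψ n := fun n => rfl
  have hψm : ∀ n, ψ n ∈ blockStabilizer γ := by
    intro n
    induction n with
    | zero => exact one_mem _
    | succ n ih => rw [hψs]; exact mul_mem (hφ n) ih
  set g : ℕ → Graphon := fun n => (v n).relabel (ψ n) with hg
  have hgd : ∀ n, cutDist (g n) (g (n + 1)) < (1 / 2) ^ n := by
    intro n
    rw [hg]
    simp only [hψs, relabel_mul, cutDist_relabel]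
    exact hd n
  have hgd2 : ∀ n m, cutDist (g n) (g (n + m)) ≤ 2 * (1 / 2) ^ n - 2 * (1 / 2) ^ (n + m) := by
    intro n m
    induction m with
    | zero => rw [add_zero, cutDist_self]; simp
    | succ m ih =>
      have h1 := cutDist_triangle (g n) (g (n + m)) (g (n + (m + 1)))
      have h2 := hgd (n + m)
      have h3 : ((1 : ℝ) / 2) ^ (n + (m + 1)) = (1 / 2) ^ (n + m) / 2 := by
        rw [← add_assoc, pow_succ]; ring
      rw [← add_assoc] at h1 ⊢
      rw [← add_assoc] at h3
      linarith
  obtain ⟨F, l, hl, hla, hlim⟩ := exists_weak_limit g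
  have hF : ∀ n, cutDist (g n) F ≤ 2 * (1 / 2) ^ n := by
    intro n
    refine cutDist_le fun S T hS hT => ?_
    have h1 : Tendsto (fun m => |∫ z in S ×ˢ T, (g n z.1 z.2 - g m z.1 z.2)|) l
        (𝓝 |∫ z in S ×ˢ T, (g n z.1 z.2 - F z.1 z.2)|) := by
      have := ((tendsto_const_nhds (x := ∫ z in S ×ˢ T, g n z.1 z.2)).sub (hlim S T hS hT)).abs
      rw [← integral_sub (g n).integrable_uncurry.integrableOn
        F.integrable_uncurry.integrableOn] at this
      refine this.congr fun m => ?_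
      rw [integral_sub (g n).integrable_uncurry.integrableOn
        (g m).integrable_uncurry.integrableOn]
    refine le_of_tendsto h1 (hla ((eventually_ge_atTop n).mono fun m hm => ?_))
    obtain ⟨k, rfl⟩ := Nat.exists_eq_add_of_le hm
    refine (cutLE_cutDist _ _ S T hS hT).trans ((hgd2 n k).trans ?_)
    have : (0 : ℝ) < (1 / 2) ^ (n + k) := by positivity
    linarith
  refine ⟨F, (tendsto_iff_dist_tendsto_zero (α := BlockGraphon γ)).2 ?_⟩
  refine squeeze_zero (fun _ => dist_nonneg) (fun n => ?_)
    (show Tendsto (fun n : ℕ => 2 * (1 / 2 : ℝ) ^ n) atTop (𝓝 0) by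
      simpa using (tendsto_pow_atTop_nhds_zero_of_lt_one (r := (1 / 2 : ℝ)) (by norm_num)
        (by norm_num)).const_mul 2)
  refine (cutMetricOn_comm _ (v n) F).le.trans
    ((cutMetricOn_le _ F (v n) (hψm n)).trans ?_)
  rw [cutDist_comm]
  exact hF n

theorem compactSpace_blockGraphon {γ : ℝ} (h0 : 0 < γ) (h1 : γ < 1) :
    CompactSpace (BlockGraphon γ) := by
  have := completeSpace_blockGraphon γ
  exact ⟨isCompact_iff_totallyBounded_isComplete.2
    ⟨totallyBounded_blockGraphon h0 h1, isComplete_univ⟩⟩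


/-! ### Cut norm bounds against product weights -/

/-- The integral is linear in the weight, so it is largest for the indicator of the set where the
partial integral of `k` is positive. -/
theorem exists_set_integral_ge {k : I × I → ℝ} (hk : Measurable k) {C : ℝ} (hC : ∀ z, |k z| ≤ C)
    {a : I → ℝ} (ha : Measurable a) (ha01 : ∀ x, a x ∈ Set.Icc (0 : ℝ) 1) :
    ∃ S, MeasurableSet S ∧ ∫ z, a z.1 * k z ≤ ∫ z in S ×ˢ Set.univ, k z := by
  have hki : Integrable k := Integrable.of_bound hk.aestronglyMeasurable C (.of_forall hC)
  have haki : Integrable fun z : I × I => a z.1 * k z :=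
    hki.bdd_mul (c := 1) (ha.comp measurable_fst).aestronglyMeasurable (.of_forall fun z => by
      rw [Real.norm_eq_abs, abs_of_nonneg (ha01 _).1]; exact (ha01 _).2)
  set F : I → ℝ := fun x => ∫ y, k (x, y) with hF
  have hFm : Measurable F := (hk.stronglyMeasurable.integral_prod_right' (ν := volume)).measurable
  have hFi : Integrable F := hki.integral_prod_left
  have hS : MeasurableSet {x | 0 < F x} := measurableSet_lt measurable_const hFm
  refine ⟨{x | 0 < F x}, hS, ?_⟩
  rw [Measure.volume_eq_prod, integral_prod _ haki, setIntegral_prod _ hki.integrableOn,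
    ← integral_indicator hS]
  refine integral_mono haki.integral_prod_left ?_ fun x => ?_
  · refine Integrable.indicator ?_ hS
    simpa using hFi
  · simp only [integral_const_mul, Measure.restrict_univ]
    by_cases hx : 0 < F x
    · rw [Set.indicator_of_mem (show x ∈ {x | 0 < F x} from hx)]
      change a x * F x ≤ F x
      nlinarith [(ha01 x).2]
    · rw [Set.indicator_of_notMem (show x ∉ {x | 0 < F x} from hx)]
      change a x * F x ≤ 0
      nlinarith [(ha01 x).1]

/-- The two weights are replaced by indicators one after the other, the second after exchanging the
coordinates. -/
theorem CutLE.integral_mul_le {k : I × I → ℝ} {r : ℝ} (h : CutLE k r) (hk : Measurable k) {C : ℝ}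
    (hC : ∀ z, |k z| ≤ C) {a b : I → ℝ} (ha : Measurable a) (ha01 : ∀ x, a x ∈ Set.Icc (0 : ℝ) 1)
    (hb : Measurable b) (hb01 : ∀ x, b x ∈ Set.Icc (0 : ℝ) 1) :
    ∫ z, a z.1 * (b z.2 * k z) ≤ r := by
  have hC0 : 0 ≤ C := (abs_nonneg _).trans (hC (0, 0))
  obtain ⟨S, hS, h1⟩ := exists_set_integral_ge (k := fun z => b z.2 * k z) (C := C)
    ((hb.comp measurable_snd).mul hk) (fun z => by
      rw [abs_mul, abs_of_nonneg (hb01 _).1]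
      nlinarith [hC z, (hb01 z.2).2, abs_nonneg (k z), (hb01 z.2).1]) ha ha01
  refine h1.trans ?_
  have hsw : MeasurePreserving (Prod.swap : I × I → I × I) volume volume :=
    Measure.measurePreserving_swap
  have hemb : MeasurableEmbedding (Prod.swap : I × I → I × I) :=
    MeasurableEquiv.prodComm.measurableEmbedding
  set k' : I × I → ℝ := fun w => (Set.univ ×ˢ S).indicator (fun w => k w.swap) w with hk'
  have hUS : MeasurableSet ((Set.univ : Set I) ×ˢ S) := MeasurableSet.univ.prod hS
  obtain ⟨T, hT, h2⟩ := exists_set_integral_ge (k := k') (C := C)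
    ((hk.comp measurable_swap).indicator hUS) (fun z => by
      change |(Set.univ ×ˢ S).indicator (fun w => k w.swap) z| ≤ C
      by_cases hz : z ∈ (Set.univ : Set I) ×ˢ S
      · rw [Set.indicator_of_mem hz]; exact hC _
      · rw [Set.indicator_of_notMem hz]; simpa using hC0) hb hb01
  have e1 : ∫ z in S ×ˢ Set.univ, b z.2 * k z = ∫ w, b w.1 * k' w := by
    rw [← integral_indicator (hS.prod .univ), ← hsw.integral_comp hemb]
    congr 1
    funext w
    change _ = b w.1 * (Set.univ ×ˢ S).indicator (fun w => k w.swap) w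
    by_cases hw : w ∈ (Set.univ : Set I) ×ˢ S
    · rw [Set.indicator_of_mem hw, Set.indicator_of_mem (show w.swap ∈ S ×ˢ Set.univ from ⟨hw.2, trivial⟩)]
      rfl
    · rw [Set.indicator_of_notMem hw, Set.indicator_of_notMem, mul_zero]
      exact fun h => hw ⟨trivial, h.1⟩
  have e2 : ∫ w in T ×ˢ Set.univ, k' w = ∫ z in S ×ˢ T, k z := by
    rw [hk', setIntegral_indicator hUS, ← hsw.setIntegral_preimage_emb hemb]
    congr 2
    ext w
    simp [and_comm]
  rw [e1]
  refine h2.trans ?_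
  rw [e2]
  exact (le_abs_self _).trans (h S T hS hT)

/-! ### Resampling coordinates -/

section resample

variable {V : Type*} [Fintype V] [DecidableEq V]

theorem measurePreserving_update {X : Type*} [MeasurableSpace X] (μ : Measure X)
    [IsProbabilityMeasure μ] (i : V) :
    MeasurePreserving (fun w : (V → X) × X => Function.update w.1 i w.2)
      ((Measure.pi fun _ => μ).prod μ) (Measure.pi fun _ => μ) := by
  have hm : Measurable fun w : (V → X) × X => Function.update w.1 i w.2 := by
    refine measurable_pi_iff.2 fun j => ?_
    by_cases hj : j = i
    · subst hj; simpa using measurable_snd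
    · simp only [Function.update_of_ne hj]
      exact (measurable_pi_apply j).comp measurable_fst
  refine ⟨hm, (Measure.pi_eq fun s hs => ?_).symm⟩
  rw [Measure.map_apply hm (MeasurableSet.univ_pi hs)]
  have : (fun w : (V → X) × X => Function.update w.1 i w.2) ⁻¹' Set.univ.pi s =
      (Set.univ.pi (Function.update s i Set.univ)) ×ˢ s i := by
    ext w
    simp only [Set.mem_preimage, Set.mem_pi, Set.mem_univ, true_imp_iff, Set.mem_prod]
    constructor
    · intro h
      refine ⟨fun j => ?_, by simpa using h i⟩
      by_cases hj : j = i
      · subst hj; simp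
      · simpa [Function.update_of_ne hj] using h j
    · rintro ⟨h1, h2⟩ j
      by_cases hj : j = i
      · subst hj; simpa using h2
      · simpa [Function.update_of_ne hj] using h1 j
  rw [this, Measure.prod_prod, Measure.pi_pi, ← Finset.prod_erase_mul _ _ (Finset.mem_univ i),
    ← Finset.prod_erase_mul _ (fun i => μ (s i)) (Finset.mem_univ i)]
  simp only [Function.update_self, measure_univ, mul_one]
  congr 1
  refine Finset.prod_congr rfl fun j hj => ?_
  rw [Function.update_of_ne (Finset.ne_of_mem_erase hj)]

theorem integral_eq_integral_update {F : (V → I) → ℝ} (hF : Integrable F) (i : V) :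
    ∫ x, F x = ∫ x : V → I, ∫ s : I, F (Function.update x i s) := by
  have h := measurePreserving_update (volume : Measure I) i
  have hF' : Integrable F (Measure.pi fun _ => volume) := hF
  have hi := h.integrable_comp_of_integrable hF'
  calc ∫ x, F x = ∫ x, F x ∂(Measure.pi fun _ => volume) := rfl
    _ = ∫ w, F (Function.update w.1 i w.2) ∂((Measure.pi fun _ => volume).prod volume) := by
        have h2 := integral_map (f := F) h.measurable.aemeasurable
          (h.map_eq.symm ▸ hF'.aestronglyMeasurable)
        rw [h.map_eq] at h2
        exact h2
    _ = _ := integral_prod _ hi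

/-- A kernel of small cut norm at two coordinates, against a product of a weight that does not
depend on the first and one that does not depend on the second coordinate. -/
theorem CutLE.integral_pi_le {k : I × I → ℝ} {r : ℝ} (h : CutLE k r) (hk : Measurable k) {C : ℝ}
    (hC : ∀ z, |k z| ≤ C) {i j : V} (hij : i ≠ j) {A B : (V → I) → ℝ} (hA : Measurable A)
    (hB : Measurable B) (hA01 : ∀ x, A x ∈ Set.Icc (0 : ℝ) 1)
    (hB01 : ∀ x, B x ∈ Set.Icc (0 : ℝ) 1) (hAi : ∀ x s, A (Function.update x i s) = A x)
    (hBj : ∀ x s, B (Function.update x j s) = B x) :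
    ∫ x : V → I, k (x i, x j) * (A x * B x) ≤ r := by
  have hC0 : 0 ≤ C := (abs_nonneg _).trans (hC (0, 0))
  have hbd : ∀ x : V → I, ‖k (x i, x j) * (A x * B x)‖ ≤ C := fun x => by
    rw [Real.norm_eq_abs, abs_mul, abs_mul, abs_of_nonneg (hA01 x).1, abs_of_nonneg (hB01 x).1]
    have h1 := hC (x i, x j)
    have h2 : A x * B x ≤ 1 := mul_le_one₀ (hA01 x).2 (hB01 x).1 (hB01 x).2
    have h3 : 0 ≤ A x * B x := mul_nonneg (hA01 x).1 (hB01 x).1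
    nlinarith [abs_nonneg (k (x i, x j))]
  have hFm : Measurable fun x : V → I => k (x i, x j) * (A x * B x) :=
    (hk.comp ((measurable_pi_apply i).prodMk (measurable_pi_apply j))).mul (hA.mul hB)
  have hFi : Integrable fun x : V → I => k (x i, x j) * (A x * B x) :=
    Integrable.of_bound hFm.aestronglyMeasurable C (.of_forall hbd)
  have hup : ∀ l : V, Measurable fun w : (V → I) × I => Function.update w.1 l w.2 :=
    fun l => (measurePreserving_update (volume : Measure I) l).measurable
  have hGi : Integrable fun x : V → I => ∫ s : I,
      (fun x : V → I => k (x i, x j) * (A x * B x)) (Function.update x j s) := by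
    have h1 := measurePreserving_update (volume : Measure I) j
    exact (h1.integrable_comp_of_integrable (g := fun x : V → I => k (x i, x j) * (A x * B x))
      hFi).integral_prod_left
  rw [integral_eq_integral_update hFi j, integral_eq_integral_update hGi i]
  have hin : ∀ x : V → I, ∫ s : I, ∫ t : I, (fun x : V → I => k (x i, x j) * (A x * B x))
      (Function.update (Function.update x i s) j t) ≤ r := by
    intro x
    have hfe : ∀ s t, (fun x : V → I => k (x i, x j) * (A x * B x))
        (Function.update (Function.update x i s) j t) =
        B (Function.update x i s) * (A (Function.update x j t) * k (s, t)) := by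
      intro s t
      have h1 : A (Function.update (Function.update x i s) j t) = A (Function.update x j t) := by
        rw [Function.update_comm hij, hAi]
      simp only [h1, hBj, Function.update_self, Function.update_of_ne hij]
      ring
    simp_rw [hfe]
    have hb : Measurable fun s => B (Function.update x i s) := hB.comp (measurable_update x)
    have ha : Measurable fun t => A (Function.update x j t) := hA.comp (measurable_update x)
    have hle := h.integral_mul_le hk hC hb (fun s => hB01 _) ha (fun t => hA01 _)
    rw [Measure.volume_eq_prod, integral_prod] at hle
    · exact hle
    · refine Integrable.of_bound (C := C) ((hb.comp measurable_fst).mul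
        ((ha.comp measurable_snd).mul hk)).aestronglyMeasurable (.of_forall fun z => ?_)
      rw [Real.norm_eq_abs, abs_mul, abs_mul, abs_of_nonneg (hA01 _).1, abs_of_nonneg (hB01 _).1,
        ← mul_assoc]
      have h1 := hC z
      have h2 : B (Function.update x i z.1) * A (Function.update x j z.2) ≤ 1 :=
        mul_le_one₀ (hB01 _).2 (hA01 _).1 (hA01 _).2
      have h3 := mul_nonneg (hB01 (Function.update x i z.1)).1 (hA01 (Function.update x j z.2)).1
      nlinarith [abs_nonneg (k z)]
  have hr0 : 0 ≤ r := (abs_nonneg _).trans (h ∅ ∅ .empty .empty)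
  -- Integrability need not be proved: otherwise the integral is 0 by convention, and `r` is
  -- nonnegative.
  by_cases hint : Integrable fun x : V → I => ∫ s : I, ∫ t : I,
      (fun x : V → I => k (x i, x j) * (A x * B x)) (Function.update (Function.update x i s) j t)
  · calc _ ≤ ∫ _x : V → I, r := integral_mono hint (integrable_const r) hin
      _ = r := by simp
  · exact (integral_undef hint).trans_le hr0

end resample

/-! ### The counting lemma -/

section counting

variable {V : Type*}

/-- The factor of an edge in the homomorphism density. -/
noncomputable def edgeWeight (f : Graphon) (x : V → I) (e : Sym2 V) : ℝ :=
  Sym2.lift ⟨fun i j => f (x i) (x j), fun _ _ => f.symm_toFun _ _⟩ e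

theorem edgeWeight_mk (f : Graphon) (x : V → I) (i j : V) :
    edgeWeight f x s(i, j) = f (x i) (x j) := rfl

theorem edgeWeight_mem (f : Graphon) (x : V → I) (e : Sym2 V) :
    edgeWeight f x e ∈ Set.Icc (0 : ℝ) 1 := by
  induction e with | _ i j => exact f.mem_Icc_toFun _ _

theorem measurable_edgeWeight (f : Graphon) (e : Sym2 V) :
    Measurable fun x : V → I => edgeWeight f x e := by
  induction e with
  | _ i j =>
    have h : Measurable fun x : V → I => (x i, x j) :=
      (measurable_pi_apply i).prodMk (measurable_pi_apply j)
    exact f.measurable_uncurry.comp h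

theorem edgeWeight_update [DecidableEq V] (f : Graphon) (x : V → I) {e : Sym2 V} {i : V}
    (hi : i ∉ e) (s : I) : edgeWeight f (Function.update x i s) e = edgeWeight f x e := by
  induction e with
  | _ a b =>
    rw [Sym2.mem_iff, not_or] at hi
    simp [edgeWeight_mk, Function.update_of_ne (Ne.symm hi.1), Function.update_of_ne (Ne.symm hi.2)]

theorem prod_edgeWeight_mem (f : Graphon) (x : V → I) (E : Finset (Sym2 V)) :
    ∏ e ∈ E, edgeWeight f x e ∈ Set.Icc (0 : ℝ) 1 :=
  ⟨Finset.prod_nonneg fun e _ => (edgeWeight_mem f x e).1,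
    Finset.prod_le_one (fun e _ => (edgeWeight_mem f x e).1) fun e _ => (edgeWeight_mem f x e).2⟩

theorem homDensity_eq [Fintype V] (H : SimpleGraph V) [Fintype H.edgeSet] (f : Graphon) :
    homDensity H f = ∫ x : V → I, ∏ e ∈ H.edgeFinset, edgeWeight f x e := rfl

theorem homDensity_relabel [Fintype V] (H : SimpleGraph V) [Fintype H.edgeSet] (f : Graphon)
    (φ : MeasurePreservingBij) : homDensity H (f.relabel φ) = homDensity H f := by
  have hφ : MeasurePreserving (fun x : V → I => fun v => φ.1 (x v)) volume volume :=
    volume_preserving_pi fun _ => φ.2.2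
  have hm : Measurable fun x : V → I => ∏ e ∈ H.edgeFinset, edgeWeight f x e :=
    Finset.measurable_prod _ fun e' _ => measurable_edgeWeight _ e'
  rw [homDensity_eq, homDensity_eq]
  conv_rhs => rw [← hφ.map_eq]
  rw [integral_map hφ.measurable.aemeasurable hm.aestronglyMeasurable]
  rfl

variable [Fintype V] [DecidableEq V]

/-- The other edges are split by whether they contain `i`. Those that do avoid `j`, because the only
edge through both is `e`, so `CutLE.integral_pi_le` applies. The graphon may vary with the edge, as
hybrid products require. -/
theorem integral_edge_swap_le (f g : Graphon) (e : Sym2 V) (he : ¬ e.IsDiag)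
    {E : Finset (Sym2 V)} (hE : e ∉ E) (h : Sym2 V → Graphon) :
    ∫ x : V → I, (edgeWeight f x e - edgeWeight g x e) * ∏ e' ∈ E, edgeWeight (h e') x e' ≤
      cutDist f g := by
  induction e with
  | _ i j =>
    have hij : i ≠ j := by simpa using he
    have hm : ∀ E : Finset (Sym2 V), Measurable fun x : V → I =>
        ∏ e' ∈ E, edgeWeight (h e') x e' := fun E =>
      Finset.measurable_prod _ fun e' _ => measurable_edgeWeight _ e'
    have h01 : ∀ (E : Finset (Sym2 V)) (x : V → I),
        ∏ e' ∈ E, edgeWeight (h e') x e' ∈ Set.Icc (0 : ℝ) 1 := fun E x =>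
      ⟨Finset.prod_nonneg fun e _ => (edgeWeight_mem _ x e).1,
        Finset.prod_le_one (fun e _ => (edgeWeight_mem _ x e).1)
          fun e _ => (edgeWeight_mem _ x e).2⟩
    have := (cutLE_cutDist f g).integral_pi_le (f.measurable_uncurry.sub g.measurable_uncurry)
      (fun z => abs_sub_le_one f g z.1 z.2) hij
      (A := fun x => ∏ e' ∈ E.filter fun e' => i ∉ e', edgeWeight (h e') x e')
      (B := fun x => ∏ e' ∈ E.filter fun e' => ¬ i ∉ e', edgeWeight (h e') x e')
      (hm _) (hm _) (h01 _) (h01 _)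
      (fun x s => Finset.prod_congr rfl fun e' he' =>
        edgeWeight_update _ x (Finset.mem_filter.1 he').2 s)
      (fun x s => Finset.prod_congr rfl fun e' he' => by
        obtain ⟨h1, h2⟩ := Finset.mem_filter.1 he'
        rw [not_not] at h2
        refine edgeWeight_update _ x (fun hj => hE ?_) s
        rwa [← (Sym2.mem_and_mem_iff hij).1 ⟨h2, hj⟩])
    simp only [Finset.prod_filter_mul_prod_filter_not] at this
    exact this

/-- Telescoping: the edges are switched from `f` to `g` one at a time, and `E₂` collects those
already switched. -/
theorem integral_prod_edgeWeight_sub_le (f g : Graphon) (E₁ : Finset (Sym2 V))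
    (h₁ : ∀ e ∈ E₁, ¬ e.IsDiag) : ∀ (E₂ : Finset (Sym2 V)), Disjoint E₁ E₂ →
    (∫ x : V → I, (∏ e ∈ E₁, edgeWeight f x e) * ∏ e ∈ E₂, edgeWeight g x e) -
      ∫ x : V → I, (∏ e ∈ E₁, edgeWeight g x e) * ∏ e ∈ E₂, edgeWeight g x e ≤
      E₁.card * cutDist f g := by
  have hm : ∀ (f : Graphon) (E : Finset (Sym2 V)), Measurable fun x : V → I =>
      ∏ e' ∈ E, edgeWeight f x e' := fun f E =>
    Finset.measurable_prod _ fun e' _ => measurable_edgeWeight _ e'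
  have hi : ∀ (f g : Graphon) (E F : Finset (Sym2 V)), Integrable fun x : V → I =>
      (∏ e ∈ E, edgeWeight f x e) * ∏ e ∈ F, edgeWeight g x e := fun f g E F =>
    Integrable.of_bound ((hm f E).mul (hm g F)).aestronglyMeasurable 1 (.of_forall fun x => by
      have h1 := prod_edgeWeight_mem f x E
      have h2 := prod_edgeWeight_mem g x F
      rw [Real.norm_eq_abs, abs_of_nonneg (mul_nonneg h1.1 h2.1)]
      exact mul_le_one₀ h1.2 h2.1 h2.2)
  induction E₁ using Finset.induction_on with
  | empty => intro E₂ _; simp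
  | insert e E₁ he ih =>
    intro E₂ hd
    rw [Finset.disjoint_insert_left] at hd
    have h2 := ih (fun e' he' => h₁ e' (Finset.mem_insert_of_mem he')) (insert e E₂)
      (Finset.disjoint_insert_right.2 ⟨he, hd.2⟩)
    have h3 := integral_edge_swap_le f g e (h₁ e (Finset.mem_insert_self _ _))
      (E := E₁ ∪ E₂) (by simp [he, hd.1]) (fun e' => if e' ∈ E₁ then f else g)
    have e1 : ∀ x : V → I, ∏ e' ∈ E₁ ∪ E₂, edgeWeight (if e' ∈ E₁ then f else g) x e' =
        (∏ e ∈ E₁, edgeWeight f x e) * ∏ e ∈ E₂, edgeWeight g x e := by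
      intro x
      rw [Finset.prod_union hd.2]
      congr 1
      · exact Finset.prod_congr rfl fun e' he' => by rw [if_pos he']
      · exact Finset.prod_congr rfl fun e' he' => by
          rw [if_neg (Finset.disjoint_right.1 hd.2 he')]
    have e2 : ∫ x : V → I, (edgeWeight f x e - edgeWeight g x e) *
        ∏ e' ∈ E₁ ∪ E₂, edgeWeight (if e' ∈ E₁ then f else g) x e' =
        (∫ x : V → I, (∏ e ∈ insert e E₁, edgeWeight f x e) * ∏ e ∈ E₂, edgeWeight g x e) -
        ∫ x : V → I, (∏ e ∈ E₁, edgeWeight f x e) * ∏ e ∈ insert e E₂, edgeWeight g x e := by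
      rw [← integral_sub (hi _ _ _ _) (hi _ _ _ _)]
      congr 1
      funext x
      rw [e1, Finset.prod_insert he, Finset.prod_insert hd.1]
      ring
    have e3 : ∫ x : V → I, (∏ e ∈ E₁, edgeWeight g x e) * ∏ e ∈ insert e E₂, edgeWeight g x e =
        ∫ x : V → I, (∏ e ∈ insert e E₁, edgeWeight g x e) * ∏ e ∈ E₂, edgeWeight g x e := by
      congr 1
      funext x
      rw [Finset.prod_insert he, Finset.prod_insert hd.1]
      ring
    rw [e2] at h3
    rw [e3] at h2
    rw [Finset.card_insert_of_notMem he]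
    push_cast
    linarith

/-- Counting lemma. -/
theorem homDensity_sub_le_cutDist (H : SimpleGraph V) [Fintype H.edgeSet] (f g : Graphon) :
    homDensity H f - homDensity H g ≤ H.edgeFinset.card * cutDist f g := by
  have := integral_prod_edgeWeight_sub_le f g H.edgeFinset
    (fun e he => H.not_isDiag_of_mem_edgeFinset he) ∅ (Finset.disjoint_empty_right _)
  simp only [Finset.prod_empty, mul_one] at this
  exact this

theorem homDensity_sub_le_cutMetric (H : SimpleGraph V) [Fintype H.edgeSet] (f g : Graphon) :
    homDensity H f - homDensity H g ≤ H.edgeFinset.card * cutMetric f g := by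
  have h : ∀ φ : MeasurePreservingBij,
      homDensity H f - homDensity H g ≤ H.edgeFinset.card * cutDist f (g.relabel φ) := fun φ => by
    rw [← homDensity_relabel H g φ]
    exact homDensity_sub_le_cutDist H f _
  have := le_ciInf (f := fun φ : MeasurePreservingBij =>
    (H.edgeFinset.card : ℝ) * cutDist f (g.relabel φ)) h
  rwa [← Real.mul_iInf_of_nonneg (Nat.cast_nonneg _)] at this

theorem homDensity_eq_of_cutMetric_eq_zero (H : SimpleGraph V) [Fintype H.edgeSet] {f g : Graphon}
    (h : cutMetric f g = 0) : homDensity H f = homDensity H g := by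
  have h1 := homDensity_sub_le_cutMetric H f g
  have h2 := homDensity_sub_le_cutMetric H g f
  rw [cutMetric_comm, h] at h2
  rw [h] at h1
  linarith

theorem continuous_homDensity (H : SimpleGraph V) [Fintype H.edgeSet] (γ : ℝ) :
    Continuous fun f : BlockGraphon γ => homDensity H f := by
  have : LipschitzWith H.edgeFinset.card fun f : BlockGraphon γ => homDensity H f := by
    refine LipschitzWith.of_le_add_mul _ fun f g => ?_
    have h1 := homDensity_sub_le_cutMetric H f g
    have h2 := cutMetric_le_cutMetricOn (blockStabilizer γ) f g
    have h3 : (H.edgeFinset.card : ℝ) * cutMetric f g ≤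
        H.edgeFinset.card * cutMetricOn (blockStabilizer γ) f g := by gcongr
    rw [dist_blockGraphon]
    simp only [NNReal.coe_natCast]
    linarith
  exact this.continuous

end counting


/-! ### Binary relative entropy -/

/-- The relative entropy as a real number, for `0 < p < 1`. -/
noncomputable def binKL (p u : ℝ) : ℝ :=
  -Real.binEntropy u - u * Real.log p - (1 - u) * Real.log (1 - p)

/-- The derivative of `binKL p` at `v`. -/
noncomputable def binKLSlope (p v : ℝ) : ℝ :=
  Real.log v - Real.log (1 - v) - Real.log p + Real.log (1 - p)

theorem binKL_eq {p u : ℝ} (h0 : 0 < p) (h1 : p < 1) :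
    binKL p u = u * Real.log (u / p) + (1 - u) * Real.log ((1 - u) / (1 - p)) := by
  have e1 : u * Real.log (u / p) = u * Real.log u - u * Real.log p := by
    rcases eq_or_ne u 0 with rfl | hu
    · simp
    · rw [Real.log_div hu h0.ne']; ring
  have e2 : (1 - u) * Real.log ((1 - u) / (1 - p)) =
      (1 - u) * Real.log (1 - u) - (1 - u) * Real.log (1 - p) := by
    rcases eq_or_ne (1 - u) 0 with hu | hu
    · simp [hu]
    · rw [Real.log_div hu (by linarith)]; ring
  rw [e1, e2, binKL, Real.binEntropy, Real.log_inv, Real.log_inv]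
  ring

theorem relEntropy_eq_ofReal {p : ℝ} (h0 : 0 < p) (h1 : p < 1) (u : ℝ) :
    relEntropy p u = ENNReal.ofReal (binKL p u) := by
  rw [relEntropy, if_neg (by rintro (⟨h, -⟩ | ⟨h, -⟩) <;> linarith), binKL_eq h0 h1]

theorem binKL_nonneg {p u : ℝ} (h0 : 0 < p) (h1 : p < 1) (hu : u ∈ Set.Icc (0 : ℝ) 1) :
    0 ≤ binKL p u := by
  rw [binKL_eq h0 h1]
  exact relEntropy_formula_nonneg ⟨h0.le, h1.le⟩ hu
    (by rintro (⟨h, -⟩ | ⟨h, -⟩) <;> linarith)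

theorem binKL_self {p : ℝ} (h0 : 0 < p) (h1 : p < 1) : binKL p p = 0 := by
  rw [binKL_eq h0 h1, div_self h0.ne', div_self (by linarith)]
  simp

/-- The difference of the two sides is `binKL v u`, so this is Gibbs' inequality. -/
theorem binKL_tangent (p : ℝ) {u v : ℝ} (h0 : 0 < v) (h1 : v < 1)
    (hu : u ∈ Set.Icc (0 : ℝ) 1) :
    binKL p v + binKLSlope p v * (u - v) ≤ binKL p u := by
  have := binKL_nonneg h0 h1 hu
  unfold binKL binKLSlope at *
  simp only [Real.binEntropy, Real.log_inv] at *
  nlinarith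

theorem continuous_binKL (p : ℝ) : Continuous (binKL p) := by
  unfold binKL
  fun_prop

theorem relEntropy_zero_left (u : ℝ) : relEntropy 0 u = if u = 0 then 0 else ⊤ := by
  unfold relEntropy
  by_cases hu : u = 0 <;> simp [hu]

theorem relEntropy_one_left (u : ℝ) : relEntropy 1 u = if u = 1 then 0 else ⊤ := by
  unfold relEntropy
  by_cases hu : u = 1 <;> simp [hu]

/-! ### Lower semicontinuity -/

theorem ofReal_integral_le_lintegral {α : Type*} [MeasurableSpace α] {μ : Measure α} {f : α → ℝ}
    (hf : Integrable f μ) : ENNReal.ofReal (∫ x, f x ∂μ) ≤ ∫⁻ x, ENNReal.ofReal (f x) ∂μ := by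
  have h1 : Integrable (fun x => max (f x) 0) μ := hf.pos_part
  calc ENNReal.ofReal (∫ x, f x ∂μ) ≤ ENNReal.ofReal (∫ x, max (f x) 0 ∂μ) :=
        ENNReal.ofReal_le_ofReal (integral_mono hf h1 fun x => le_max_left _ _)
    _ = ∫⁻ x, ENNReal.ofReal (max (f x) 0) ∂μ :=
        ofReal_integral_eq_lintegral_ofReal h1 (.of_forall fun x => le_max_right _ _)
    _ = _ := by simp

/-- The value `g z` moved into `[1/(k+2), 1-1/(k+2)]`. -/
noncomputable def clip (k : ℕ) (u : ℝ) : ℝ := max (1 / ((k : ℝ) + 2)) (min (1 - 1 / ((k : ℝ) + 2)) u)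

theorem clip_bounds (k : ℕ) (u : ℝ) :
    1 / ((k : ℝ) + 2) ≤ clip k u ∧ clip k u ≤ 1 - 1 / ((k : ℝ) + 2) := by
  have h : 1 / ((k : ℝ) + 2) ≤ 1 / 2 := by
    apply one_div_le_one_div_of_le <;> linarith [(Nat.cast_nonneg k : (0 : ℝ) ≤ k)]
  exact ⟨le_max_left _ _, max_le (by linarith) (min_le_left _ _)⟩

theorem clip_mem (k : ℕ) (u : ℝ) : 0 < clip k u ∧ clip k u < 1 := by
  have h := clip_bounds k u
  have : (0 : ℝ) < 1 / ((k : ℝ) + 2) := by positivity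
  constructor <;> linarith

theorem measurable_clip (k : ℕ) : Measurable (clip k) :=
  measurable_const.max (measurable_const.min measurable_id)

theorem tendsto_clip {u : ℝ} (hu : u ∈ Set.Icc (0 : ℝ) 1) :
    Tendsto (fun k => clip k u) atTop (𝓝 u) := by
  have h0 : Tendsto (fun k : ℕ => 1 / ((k : ℝ) + 2)) atTop (𝓝 0) := by
    have := tendsto_one_div_add_atTop_nhds_zero_nat (𝕜 := ℝ)
    refine squeeze_zero (fun k => by positivity) (fun k => ?_) this
    apply one_div_le_one_div_of_le <;> linarith [(Nat.cast_nonneg k : (0 : ℝ) ≤ k)]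
  have h1 : Tendsto (fun k => clip k u) atTop (𝓝 (max 0 (min (1 - 0) u))) :=
    h0.max ((tendsto_const_nhds.sub h0).min tendsto_const_nhds)
  rwa [sub_zero, min_eq_right hu.2, max_eq_right hu.1] at h1

/-- Coefficient of the linear term of an affine minorant of the relative entropy. -/
noncomputable def minorantSlope (p : ℝ) (W g : Graphon) (k : ℕ) (z : I × I) : ℝ :=
  if W z.1 z.2 = 0 then (k : ℝ) else if W z.1 z.2 = 1 then -(k : ℝ) else
    binKLSlope p (clip k (g z.1 z.2))

/-- Constant term of an affine minorant of the relative entropy. -/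
noncomputable def minorantConst (p : ℝ) (W g : Graphon) (k : ℕ) (z : I × I) : ℝ :=
  if W z.1 z.2 = 0 then 0 else if W z.1 z.2 = 1 then (k : ℝ) else
    binKL p (clip k (g z.1 z.2)) - binKLSlope p (clip k (g z.1 z.2)) * clip k (g z.1 z.2)

section lsc

variable {p : ℝ} {W : Graphon}

theorem measurable_minorantSlope (p : ℝ) (W g : Graphon) (k : ℕ) :
    Measurable (minorantSlope p W g k) := by
  have hc : Measurable fun z : I × I => clip k (g z.1 z.2) :=
    (measurable_clip k).comp g.measurable_uncurry
  refine Measurable.ite (W.measurable_uncurry (measurableSet_singleton 0)) measurable_const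
    (Measurable.ite (W.measurable_uncurry (measurableSet_singleton 1)) measurable_const ?_)
  unfold binKLSlope
  fun_prop

theorem measurable_minorantConst (p : ℝ) (W g : Graphon) (k : ℕ) :
    Measurable (minorantConst p W g k) := by
  have hc : Measurable fun z : I × I => clip k (g z.1 z.2) :=
    (measurable_clip k).comp g.measurable_uncurry
  refine Measurable.ite (W.measurable_uncurry (measurableSet_singleton 0)) measurable_const
    (Measurable.ite (W.measurable_uncurry (measurableSet_singleton 1)) measurable_const ?_)
  refine ((continuous_binKL p).measurable.comp hc).sub ?_
  unfold binKLSlope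
  fun_prop

theorem exists_minorant_bound (p : ℝ) (W g : Graphon) (k : ℕ) :
    ∃ C, ∀ z, |minorantSlope p W g k z| ≤ C ∧ |minorantConst p W g k z| ≤ C := by
  have hcont : ContinuousOn (binKLSlope p) (Set.Icc (1 / ((k : ℝ) + 2)) (1 - 1 / ((k : ℝ) + 2))) := by
    have : (0 : ℝ) < 1 / ((k : ℝ) + 2) := by positivity
    unfold binKLSlope
    refine ((ContinuousOn.sub ?_ ?_).sub continuousOn_const).add continuousOn_const
    · exact continuousOn_id.log fun x hx => by
        have := hx.1
        change x ≠ 0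
        linarith
    · exact (continuousOn_const.sub continuousOn_id).log fun x hx => by
        have := hx.2
        change 1 - x ≠ 0
        linarith
  obtain ⟨C₁, hC₁⟩ := isCompact_Icc.exists_bound_of_continuousOn hcont
  obtain ⟨C₂, hC₂⟩ := isCompact_Icc.exists_bound_of_continuousOn
    ((continuous_binKL p).continuousOn.sub (hcont.mul continuousOn_id))
  have hk : (0 : ℝ) ≤ k := Nat.cast_nonneg k
  refine ⟨|C₁| + |C₂| + k, fun z => ?_⟩
  have hv := clip_bounds k (g z.1 z.2)
  have h1 := hC₁ _ hv
  have h2 := hC₂ _ hv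
  rw [Real.norm_eq_abs] at h1 h2
  have h3 := le_abs_self C₁
  have h4 := le_abs_self C₂
  have h5 := abs_nonneg C₁
  have h6 := abs_nonneg C₂
  simp only [Pi.sub_apply, Pi.mul_apply, id] at h2
  unfold minorantSlope minorantConst
  split_ifs
  · rw [abs_of_nonneg hk, abs_zero]; constructor <;> linarith
  · rw [abs_neg, abs_of_nonneg hk]; constructor <;> linarith
  · constructor
    · linarith
    · exact h2.trans (by linarith)

/-- The infinite penalties on {W = 0} and {W = 1} are replaced by linear ones of slope `k`, and the
entropy on {W = p} by a tangent at the clipped value of `g`. The result is affine in `f` with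
bounded coefficients, hence weakly continuous. -/
theorem ofReal_minorant_le (h0 : 0 < p) (h1 : p < 1)
    (hW : ∀ x y, W x y = 0 ∨ W x y = 1 ∨ W x y = p) (f g : Graphon) (k : ℕ) (z : I × I) :
    ENNReal.ofReal (minorantConst p W g k z + minorantSlope p W g k z * f z.1 z.2) ≤
      relEntropy (W z.1 z.2) (f z.1 z.2) := by
  unfold minorantSlope minorantConst
  rcases hW z.1 z.2 with h | h | h
  · rw [if_pos h, if_pos h, h, relEntropy_zero_left]
    split_ifs with hu <;> simp [hu]
  · have hne : W z.1 z.2 ≠ 0 := by rw [h]; exact one_ne_zero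
    rw [if_neg hne, if_neg hne, if_pos h, if_pos h, h, relEntropy_one_left]
    split_ifs with hu <;> simp [hu]
  · have hne : W z.1 z.2 ≠ 0 := by rw [h]; exact h0.ne'
    have hne1 : W z.1 z.2 ≠ 1 := by rw [h]; exact h1.ne
    rw [if_neg hne, if_neg hne, if_neg hne1, if_neg hne1, h, relEntropy_eq_ofReal h0 h1]
    refine ENNReal.ofReal_le_ofReal ?_
    have hv := clip_mem k (g z.1 z.2)
    have := binKL_tangent p hv.1 hv.2 (f.mem_Icc_toFun z.1 z.2)
    linarith

/-- A nonnegative lower bound for the minorant at the function it is built from. -/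
noncomputable def minorantLower (p : ℝ) (W g : Graphon) (k : ℕ) (z : I × I) : ℝ :=
  if W z.1 z.2 = 0 then k * g z.1 z.2 else if W z.1 z.2 = 1 then k * (1 - g z.1 z.2) else
    binKL p (clip k (g z.1 z.2))

theorem measurable_minorantLower (p : ℝ) (W g : Graphon) (k : ℕ) :
    Measurable (minorantLower p W g k) := by
  have hc : Measurable fun z : I × I => clip k (g z.1 z.2) :=
    (measurable_clip k).comp g.measurable_uncurry
  exact Measurable.ite (W.measurable_uncurry (measurableSet_singleton 0))
    (measurable_const.mul g.measurable_uncurry)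
    (Measurable.ite (W.measurable_uncurry (measurableSet_singleton 1))
      (measurable_const.mul (measurable_const.sub g.measurable_uncurry))
      ((continuous_binKL p).measurable.comp hc))

theorem binKLSlope_nonneg {v : ℝ} (h0 : 0 < p) (hpv : p ≤ v) (hv : v < 1) :
    0 ≤ binKLSlope p v := by
  have h1 := Real.log_le_log h0 hpv
  have h2 := Real.log_le_log (sub_pos.2 hv) (sub_le_sub_left hpv 1)
  unfold binKLSlope
  linarith

theorem binKLSlope_nonpos {v : ℝ} (h1 : p < 1) (hpv : v ≤ p) (hv : 0 < v) :
    binKLSlope p v ≤ 0 := by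
  have h3 := Real.log_le_log hv hpv
  have h2 := Real.log_le_log (sub_pos.2 h1) (sub_le_sub_left hpv 1)
  unfold binKLSlope
  linarith

/-- Where clipping moves the value, it moves it towards `p`, so the tangent is extrapolated away
from `p` and its slope has the favourable sign. This is why `p` must lie within the clipping range.
-/
theorem minorantLower_le {k : ℕ} (hk : 1 / ((k : ℝ) + 2) ≤ p) (hk1 : p ≤ 1 - 1 / ((k : ℝ) + 2))
    (W g : Graphon) (z : I × I) : minorantLower p W g k z ≤
      minorantConst p W g k z + minorantSlope p W g k z * g z.1 z.2 := by
  have hpos : (0 : ℝ) < 1 / ((k : ℝ) + 2) := by positivity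
  unfold minorantLower minorantConst minorantSlope
  split_ifs
  · linarith
  · linarith
  · set u := g z.1 z.2
    have hm := clip_mem k u
    have hb := clip_bounds k u
    have : 0 ≤ binKLSlope p (clip k u) * (u - clip k u) := by
      rcases lt_trichotomy u (clip k u) with h | h | h
      · have : clip k u = 1 / ((k : ℝ) + 2) := by
          refine le_antisymm ?_ hb.1
          by_contra hcon
          push Not at hcon
          have h2 : clip k u ≤ u := by
            rcases max_choice (1 / ((k : ℝ) + 2)) (min (1 - 1 / ((k : ℝ) + 2)) u) with h3 | h3
            · exact absurd h3 hcon.ne'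
            · exact h3.le.trans (min_le_right _ _)
          linarith
        exact mul_nonneg_of_nonpos_of_nonpos
          (binKLSlope_nonpos (by linarith) (by rw [this]; exact hk) hm.1) (by linarith)
      · rw [← h]; simp
      · have : clip k u = 1 - 1 / ((k : ℝ) + 2) := by
          refine le_antisymm hb.2 ?_
          have h2 : min (1 - 1 / ((k : ℝ) + 2)) u ≤ clip k u := le_max_right _ _
          rcases min_choice (1 - 1 / ((k : ℝ) + 2)) u with h3 | h3 <;> linarith
        exact mul_nonneg
          (binKLSlope_nonneg (by linarith) (by rw [this]; exact hk1) hm.2) (by linarith)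
    linarith

theorem minorantLower_nonneg (h0 : 0 < p) (h1 : p < 1) (W g : Graphon) (k : ℕ) (z : I × I) :
    0 ≤ minorantLower p W g k z := by
  have hm := clip_mem k (g z.1 z.2)
  have hk : (0 : ℝ) ≤ k := Nat.cast_nonneg k
  unfold minorantLower
  split_ifs
  · exact mul_nonneg hk (g.nonneg _ _)
  · exact mul_nonneg hk (sub_nonneg.2 (g.le_one _ _))
  · exact binKL_nonneg h0 h1 ⟨hm.1.le, hm.2.le⟩

theorem tendsto_minorantLower (h0 : 0 < p) (h1 : p < 1)
    (hW : ∀ x y, W x y = 0 ∨ W x y = 1 ∨ W x y = p) (g : Graphon) (z : I × I) :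
    Tendsto (fun k => ENNReal.ofReal (minorantLower p W g k z)) atTop
      (𝓝 (relEntropy (W z.1 z.2) (g z.1 z.2))) := by
  have key : ∀ u : ℝ, 0 ≤ u → Tendsto (fun k : ℕ => ENNReal.ofReal ((k : ℝ) * u)) atTop
      (𝓝 (if u = 0 then 0 else ⊤)) := by
    intro u hu
    split_ifs with h
    · simp [h]
    · refine ENNReal.tendsto_ofReal_nhds_top.2 ?_
      exact tendsto_natCast_atTop_atTop.atTop_mul_const (lt_of_le_of_ne hu (Ne.symm h))
  unfold minorantLower
  rcases hW z.1 z.2 with h | h | h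
  · simp only [h, if_true, relEntropy_zero_left]
    exact key _ (g.nonneg _ _)
  · simp only [h, one_ne_zero, if_false, if_true, relEntropy_one_left]
    have := key _ (sub_nonneg.2 (g.le_one z.1 z.2))
    simp only [sub_eq_zero, eq_comm (a := (1 : ℝ))] at this
    exact this
  · simp only [h, h0.ne', h1.ne, if_false, relEntropy_eq_ofReal h0 h1]
    exact ENNReal.tendsto_ofReal
      (((continuous_binKL p).tendsto _).comp (tendsto_clip (g.mem_Icc_toFun _ _)))

/-- For fixed `k` the affine minorant built from the limit `g` passes to the weak limit; then `k`
tends to infinity by Fatou's lemma. -/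
theorem entropy_le_of_tendsto (h0 : 0 < p) (h1 : p < 1)
    (hW : ∀ x y, W x y = 0 ∨ W x y = 1 ∨ W x y = p) {g : Graphon} {u : ℕ → Graphon} {c : ℝ≥0∞}
    (hu : ∀ n, entropy W (u n) ≤ c) (hlim : Tendsto (fun n => cutDist (u n) g) atTop (𝓝 0)) :
    entropy W g ≤ c := by
  have hk : ∀ k : ℕ, 1 / ((k : ℝ) + 2) ≤ p → p ≤ 1 - 1 / ((k : ℝ) + 2) →
      (1 / 2) * ∫⁻ z, ENNReal.ofReal (minorantLower p W g k z) ≤ c := by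
    intro k hk hk1
    set a := minorantConst p W g k with ha
    set b := minorantSlope p W g k with hb
    obtain ⟨C, hC⟩ := exists_minorant_bound p W g k
    have hai : Integrable a := Integrable.of_bound
      (measurable_minorantConst p W g k).aestronglyMeasurable C (.of_forall fun z => (hC z).2)
    have hbi : Integrable b := Integrable.of_bound
      (measurable_minorantSlope p W g k).aestronglyMeasurable C (.of_forall fun z => (hC z).1)
    have hbf : ∀ f : Graphon, Integrable fun z => b z * f z.1 z.2 := fun f =>
      hbi.mul_bdd (c := 1) f.measurable_uncurry.aestronglyMeasurable (.of_forall fun z => by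
        rw [Real.norm_eq_abs, abs_of_nonneg (f.nonneg _ _)]; exact f.le_one _ _)
    have hw := tendsto_integral_mul_of_rectangles (l := atTop)
      (k := fun n z => u n z.1 z.2 - g z.1 z.2) (C := 1)
      (fun n => (u n).measurable_uncurry.sub g.measurable_uncurry)
      (fun n z => abs_sub_le_one _ _ _ _)
      (fun S T hS hT => squeeze_zero_norm
        (fun n => (cutLE_cutDist (u n) g S T hS hT)) hlim) hbi
    have hconv : Tendsto (fun n => ∫ z, (a z + b z * u n z.1 z.2)) atTop
        (𝓝 (∫ z, (a z + b z * g z.1 z.2))) := by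
      have h2 := hw.add_const (∫ z, (a z + b z * g z.1 z.2))
      rw [zero_add] at h2
      refine h2.congr fun n => ?_
      have e1 : ∀ z, b z * (u n z.1 z.2 - g z.1 z.2) = b z * u n z.1 z.2 - b z * g z.1 z.2 :=
        fun z => by ring
      simp_rw [e1]
      rw [integral_sub (hbf _) (hbf _), integral_add hai (hbf _), integral_add hai (hbf _)]
      ring
    have hle : ∀ n, (1 / 2) * ENNReal.ofReal (∫ z, (a z + b z * u n z.1 z.2)) ≤ c := by
      intro n
      refine le_trans ?_ (hu n)
      unfold entropy
      gcongr
      exact (ofReal_integral_le_lintegral (hai.add (hbf _))).trans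
        (lintegral_mono fun z => ofReal_minorant_le h0 h1 hW (u n) g k z)
    have hlim2 : (1 / 2) * ENNReal.ofReal (∫ z, (a z + b z * g z.1 z.2)) ≤ c :=
      le_of_tendsto' (ENNReal.Tendsto.const_mul (ENNReal.tendsto_ofReal hconv)
        (Or.inr (by norm_num))) hle
    refine le_trans ?_ hlim2
    rw [ofReal_integral_eq_lintegral_ofReal (f := fun z => a z + b z * g z.1 z.2)
      (hai.add (hbf g)) (.of_forall fun z =>
      (minorantLower_nonneg h0 h1 W g k z).trans (minorantLower_le hk hk1 W g z))]
    gcongr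
    exact minorantLower_le hk hk1 W g _
  have hev : ∀ᶠ k : ℕ in atTop, (1 / 2) * ∫⁻ z, ENNReal.ofReal (minorantLower p W g k z) ≤ c := by
    have ht : Tendsto (fun k : ℕ => 1 / ((k : ℝ) + 2)) atTop (𝓝 0) := by
      have := tendsto_one_div_add_atTop_nhds_zero_nat (𝕜 := ℝ)
      refine squeeze_zero (fun k => by positivity) (fun k => ?_) this
      apply one_div_le_one_div_of_le <;> linarith [(Nat.cast_nonneg k : (0 : ℝ) ≤ k)]
    filter_upwards [ht.eventually (ge_mem_nhds h0),
      ht.eventually (ge_mem_nhds (sub_pos.2 h1))] with k hk1 hk2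
    exact hk k hk1 (by linarith)
  have hfatou : ∫⁻ z : I × I, relEntropy (W z.1 z.2) (g z.1 z.2) ≤
      liminf (fun k => ∫⁻ z, ENNReal.ofReal (minorantLower p W g k z)) atTop := by
    calc _ = ∫⁻ z : I × I, liminf (fun k => ENNReal.ofReal (minorantLower p W g k z)) atTop :=
          lintegral_congr fun z => (tendsto_minorantLower h0 h1 hW g z).liminf_eq.symm
      _ ≤ _ := lintegral_liminf_le fun k => (measurable_minorantLower p W g k).ennreal_ofReal
  have h2 : ∫⁻ z : I × I, relEntropy (W z.1 z.2) (g z.1 z.2) ≤ 2 * c := by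
    refine hfatou.trans (liminf_le_of_frequently_le' (hev.mono fun k hk => ?_).frequently)
    calc ∫⁻ z, ENNReal.ofReal (minorantLower p W g k z)
        = 2 * ((1 / 2) * ∫⁻ z, ENNReal.ofReal (minorantLower p W g k z)) := by
          rw [← mul_assoc, one_div, ENNReal.mul_inv_cancel (by norm_num) (by norm_num), one_mul]
      _ ≤ _ := by gcongr
  calc entropy W g ≤ (1 / 2) * (2 * c) := by unfold entropy; gcongr
    _ = c := by
      rw [← mul_assoc, one_div, ENNReal.inv_mul_cancel (by norm_num) (by norm_num), one_mul]

end lsc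

/-! ### The rate function as a minimum -/

theorem measurable_relEntropy : Measurable fun w : ℝ × ℝ => relEntropy w.1 w.2 := by
  unfold relEntropy
  refine Measurable.ite ?_ measurable_const ?_
  · refine MeasurableSet.union ?_ ?_
    · exact (measurable_fst (measurableSet_singleton 0)).inter
        (measurable_snd (measurableSet_singleton 0)).compl
    · exact (measurable_fst (measurableSet_singleton 1)).inter
        (measurable_snd (measurableSet_singleton 1)).compl
  · fun_prop

theorem measurable_relEntropy_comp (W g : Graphon) :
    Measurable fun z : I × I => relEntropy (W z.1 z.2) (g z.1 z.2) :=
  measurable_relEntropy.comp (W.measurable_uncurry.prodMk g.measurable_uncurry)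

theorem entropy_relabel {W : Graphon} (g : Graphon) {φ : MeasurePreservingBij}
    (hφ : W.relabel φ = W) : entropy W (g.relabel φ) = entropy W g := by
  unfold entropy
  congr 1
  rw [← φ.measurePreserving_prodMap.lintegral_comp (measurable_relEntropy_comp W g)]
  refine lintegral_congr fun z => ?_
  have : W z.1 z.2 = W (φ.1 z.1) (φ.1 z.2) := by
    conv_lhs => rw [← hφ]
    rfl
  rw [this]
  rfl

/-- Makes the case distinction in the rate function automatic for classes that contain a graphon of
finite entropy. -/
theorem agreesOffOmega_of_entropy_ne_top {W g : Graphon} (h : entropy W g ≠ ⊤) :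
    AgreesOffOmega W g := by
  have h1 : ∫⁻ z : I × I, relEntropy (W z.1 z.2) (g z.1 z.2) ≠ ⊤ := by
    intro hcon
    refine h ?_
    rw [entropy, hcon, ENNReal.mul_top (by norm_num)]
  have h2 := ae_lt_top (measurable_relEntropy_comp W g) h1
  refine measure_mono_null ?_ (ae_iff.1 h2)
  rintro z ⟨hz1, hz2⟩
  have hW : W z.1 z.2 = 0 ∨ W z.1 z.2 = 1 := by
    by_contra hcon
    push Not at hcon
    exact hz1 ⟨lt_of_le_of_ne (W.nonneg _ _) hcon.1.symm, lt_of_le_of_ne (W.le_one _ _) hcon.2⟩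
  change ¬ relEntropy (W z.1 z.2) (g z.1 z.2) < ⊤
  rw [not_lt_top_iff]
  rcases hW with h | h
  · rw [h] at hz2 ⊢
    rw [relEntropy_zero_left, if_neg hz2]
  · rw [h] at hz2 ⊢
    rw [relEntropy_one_left, if_neg hz2]

/-- The graphons to which the compactness argument applies: the values are `0`, `1` and `p`, and
the blocks `[0,γ]` and `(γ,1]` determine the value. -/
structure IsBlockReference (γ p : ℝ) (W : Graphon) : Prop where
  gamma_pos : 0 < γ
  gamma_lt_one : γ < 1
  pos : 0 < p
  lt_one : p < 1
  values : ∀ x y, W x y = 0 ∨ W x y = 1 ∨ W x y = p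
  relabel_eq : ∀ φ ∈ blockStabilizer γ, W.relabel φ = W

namespace IsBlockReference

variable {γ p : ℝ} {W : Graphon}

/-- Block preserving relabellings turn convergence in the metric into convergence of the cut
distance to 0, without changing any entropy. -/
theorem isClosed_entropy_le (hW : IsBlockReference γ p W) (c : ℝ≥0∞) :
    IsClosed {g : BlockGraphon γ | entropy W g ≤ c} := by
  refine isSeqClosed_iff_isClosed.1 fun u g hu hlim => ?_
  have hlim := (tendsto_iff_dist_tendsto_zero (α := BlockGraphon γ)).1 hlim
  have h : ∀ n : ℕ, ∃ φ ∈ blockStabilizer γ,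
      cutDist g (Graphon.relabel (u n) φ) < dist (u n) g + 1 / ((n : ℝ) + 1) := fun n =>
    exists_lt_of_cutMetricOn_lt ((cutMetricOn_comm _ g (u n)).trans_lt (by
      have : (0 : ℝ) < 1 / ((n : ℝ) + 1) := by positivity
      exact lt_add_of_pos_right _ this))
  choose φ hφ hd using h
  refine entropy_le_of_tendsto hW.pos hW.lt_one hW.values (u := fun n => Graphon.relabel (u n) (φ n))
    (fun n => ?_) ?_
  · exact (entropy_relabel (u n) (hW.relabel_eq _ (hφ n))).trans_le (hu n)
  · have h2 := hlim.add (tendsto_one_div_add_atTop_nhds_zero_nat (𝕜 := ℝ))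
    rw [add_zero] at h2
    exact squeeze_zero (fun n => cutDist_nonneg _ _)
      (fun n => (cutDist_comm _ _).trans_le (hd n).le) h2

theorem lowerSemicontinuous_entropy (hW : IsBlockReference γ p W) :
    LowerSemicontinuous fun g : BlockGraphon γ => entropy W g :=
  lowerSemicontinuous_iff_isClosed_preimage.2 hW.isClosed_entropy_le

theorem exists_entropy_min (hW : IsBlockReference γ p W) {s : Set (BlockGraphon γ)}
    (hs : IsClosed s) (hne : s.Nonempty) :
    ∃ g ∈ s, ∀ f ∈ s, entropy W g ≤ entropy W f := by
  have := compactSpace_blockGraphon hW.gamma_pos hW.gamma_lt_one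
  obtain ⟨g, hg, hmin⟩ := (hW.lowerSemicontinuous_entropy.lowerSemicontinuousOn s).exists_isMinOn
    hne hs.isCompact
  exact ⟨g, hg, fun f hf => hmin hf⟩

theorem rate_le_entropy (f g : Graphon) (h : cutMetric f g = 0) : rate W f ≤ entropy W g := by
  by_cases htop : entropy W g = ⊤
  · rw [htop]; exact le_top
  · unfold rate
    rw [if_pos ⟨g, agreesOffOmega_of_entropy_ne_top htop, h⟩]
    exact iSup₂_le fun η hη => iInf₂_le g (h.le.trans hη.le)

theorem continuous_cutMetric (γ : ℝ) (f : Graphon) :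
    Continuous fun g : BlockGraphon γ => cutMetric f g := by
  have : LipschitzWith 1 fun g : BlockGraphon γ => cutMetric f g := by
    refine LipschitzWith.of_le_add fun g h => ?_
    rw [dist_comm]
    exact (cutMetric_triangle f h g).trans
      (add_le_add_right (cutMetric_le_cutMetricOn _ h g) _)
  exact this.continuous

/-- The class of `f` under all relabellings is closed in the compact space with block preserving
relabellings only, so the entropy has a minimum on it. If the rate were smaller, graphons
approaching `f` with entropies at most some `c` below that minimum would accumulate in the class of
`f`, at a graphon of entropy at most `c`. -/
theorem exists_entropy_eq_rate (hW : IsBlockReference γ p W) (f : Graphon) :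
    ∃ g, cutMetric f g = 0 ∧ entropy W g = rate W f := by
  have hcl : ∀ r, IsClosed {g : BlockGraphon γ | cutMetric f g ≤ r} := fun r =>
    isClosed_le (continuous_cutMetric γ f) continuous_const
  have hset : {g : BlockGraphon γ | cutMetric f g ≤ 0} = {g : BlockGraphon γ | cutMetric f g = 0} :=
    Set.ext fun g => ⟨fun h => le_antisymm h (cutMetric_nonneg _ _), fun h => le_of_eq h⟩
  obtain ⟨g, hg, hmin⟩ := hW.exists_entropy_min (hcl 0) ⟨f, (cutMetric_self f).le⟩
  rw [hset] at hg
  refine ⟨g, hg, le_antisymm ?_ (rate_le_entropy f g hg)⟩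
  unfold rate
  split_ifs
  swap
  · exact le_top
  refine le_of_not_gt fun hlt => ?_
  obtain ⟨c, hc1, hc2⟩ := exists_between hlt
  have hex : ∀ n : ℕ, ∃ h : BlockGraphon γ, cutMetric f h ≤ 1 / ((n : ℝ) + 1) ∧
      entropy W h ≤ c := by
    intro n
    by_contra hcon
    push Not at hcon
    refine absurd hc1 (not_lt.2 ?_)
    refine le_trans ?_ (le_iSup₂ (f := fun (η : ℝ) (_ : 0 < η) =>
      ⨅ (h : Graphon) (_ : cutMetric f h ≤ η), entropy W h) (1 / ((n : ℝ) + 1)) (by positivity))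
    exact le_iInf₂ fun h hh => (hcon h hh).le
  choose h hh1 hh2 using hex
  have := compactSpace_blockGraphon hW.gamma_pos hW.gamma_lt_one
  obtain ⟨a, ψ, hψ, hlim⟩ := CompactSpace.tendsto_subseq h
  have ha1 : entropy W a ≤ c :=
    (hW.isClosed_entropy_le c).mem_of_tendsto hlim (.of_forall fun n => hh2 _)
  have ha2 : cutMetric f a ≤ 0 := by
    have h3 := ((continuous_cutMetric γ f).tendsto a).comp hlim
    have h4 := (tendsto_one_div_add_atTop_nhds_zero_nat (𝕜 := ℝ)).comp hψ.tendsto_atTop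
    exact le_of_tendsto_of_tendsto' h3 h4 fun n => hh1 _
  exact absurd ((hmin a ha2).trans ha1) (not_le.2 hc2)

end IsBlockReference


/-! ### Hölder's inequality on regular graphs -/

/-- Vertices are integrated out one at a time. Exactly `d` factors, each with exponent 1/d, depend
on the current vertex, so Hölder's inequality applies to them; the others are constants. -/
theorem lmarginal_prod_rpow_le {V : Type*} [DecidableEq V] {X : Type*} [MeasurableSpace X] {μ : Measure X}
    [IsProbabilityMeasure μ] (E : Finset (Sym2 V)) {d : ℕ} (hd : d ≠ 0)
    (hreg : ∀ v, (E.filter fun e => v ∈ e).card = d) {f : Sym2 V → (V → X) → ℝ≥0∞}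
    (hf : ∀ e, Measurable (f e))
    (hupd : ∀ e v, v ∉ e → ∀ x y, f e (Function.update x v y) = f e x) (s : Finset V) (x : V → X) :
    (∫⋯∫⁻_s, (fun x => ∏ e ∈ E, f e x ^ (1 / d : ℝ)) ∂fun _ => μ) x ≤
      ∏ e ∈ E, ((∫⋯∫⁻_s, f e ∂fun _ => μ) x) ^ (1 / d : ℝ) := by
  have hd0 : (d : ℝ) ≠ 0 := Nat.cast_ne_zero.2 hd
  induction s using Finset.induction_on generalizing x with
  | empty => simp
  | insert v s hv ih =>
    have hm : Measurable fun x => ∏ e ∈ E, f e x ^ (1 / d : ℝ) :=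
      Finset.measurable_prod _ fun e _ => (hf e).pow_const _
    rw [lmarginal_insert _ hm hv]
    have hG : ∀ e, Measurable (∫⋯∫⁻_s, f e ∂fun _ => μ) := fun e => (hf e).lmarginal _
    have hGconst : ∀ e, v ∉ e → ∀ x y, (∫⋯∫⁻_s, f e ∂fun _ => μ) (Function.update x v y) =
        (∫⋯∫⁻_s, f e ∂fun _ => μ) x := by
      intro e he x y
      rw [lmarginal_update_of_notMem (hf e) hv]
      congr 1
      funext z
      exact hupd e v he z y
    calc _ ≤ ∫⁻ y, ∏ e ∈ E, ((∫⋯∫⁻_s, f e ∂fun _ => μ) (Function.update x v y)) ^ (1 / d : ℝ) ∂μ :=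
          lintegral_mono fun y => ih _
      _ = ∫⁻ y, (∏ e ∈ E.filter fun e => v ∈ e,
            ((∫⋯∫⁻_s, f e ∂fun _ => μ) (Function.update x v y)) ^ (1 / d : ℝ)) *
            ∏ e ∈ E.filter fun e => v ∉ e, ((∫⋯∫⁻_s, f e ∂fun _ => μ) x) ^ (1 / d : ℝ) ∂μ := by
          refine lintegral_congr fun y => ?_
          rw [← Finset.prod_filter_mul_prod_filter_not E (fun e => v ∈ e)]
          congr 1
          refine Finset.prod_congr rfl fun e he => ?_
          rw [hGconst e (Finset.mem_filter.1 he).2]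
      _ = (∫⁻ y, ∏ e ∈ E.filter fun e => v ∈ e,
            ((∫⋯∫⁻_s, f e ∂fun _ => μ) (Function.update x v y)) ^ (1 / d : ℝ) ∂μ) *
            ∏ e ∈ E.filter fun e => v ∉ e, ((∫⋯∫⁻_s, f e ∂fun _ => μ) x) ^ (1 / d : ℝ) := by
          refine lintegral_mul_const _ (Finset.measurable_prod _ fun e _ => ?_)
          exact ((hG e).comp (measurable_update x)).pow_const _
      _ ≤ (∏ e ∈ E.filter fun e => v ∈ e,
            (∫⁻ y, (∫⋯∫⁻_s, f e ∂fun _ => μ) (Function.update x v y) ∂μ) ^ (1 / d : ℝ)) *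
            ∏ e ∈ E.filter fun e => v ∉ e, ((∫⋯∫⁻_s, f e ∂fun _ => μ) x) ^ (1 / d : ℝ) := by
          gcongr
          refine ENNReal.lintegral_prod_norm_pow_le _
            (fun e _ => ((hG e).comp (measurable_update x)).aemeasurable) ?_ fun e _ => by positivity
          rw [Finset.sum_const, hreg, nsmul_eq_mul]
          field_simp
      _ = _ := by
          rw [← Finset.prod_filter_mul_prod_filter_not E (fun e => v ∈ e)]
          congr 1
          · refine Finset.prod_congr rfl fun e _ => ?_
            rw [lmarginal_insert _ (hf e) hv]
          · refine Finset.prod_congr rfl fun e he => ?_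
            rw [lmarginal_insert _ (hf e) hv]
            congr 1
            simp [hGconst e (Finset.mem_filter.1 he).2]

theorem measurePreserving_pair {V : Type*} [Fintype V] {i j : V} (hij : i ≠ j) :
    MeasurePreserving (fun x : V → I => (x i, x j)) volume volume := by
  classical
  have hm : Measurable fun x : V → I => (x i, x j) :=
    (measurable_pi_apply i).prodMk (measurable_pi_apply j)
  refine ⟨hm, ?_⟩
  rw [Measure.volume_eq_prod]
  refine (Measure.prod_eq fun s t hs ht => ?_).symm
  rw [Measure.map_apply hm (hs.prod ht)]
  have : (fun x : V → I => (x i, x j)) ⁻¹' s ×ˢ t =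
      Set.univ.pi fun l => if l = i then s else if l = j then t else Set.univ := by
    ext x
    simp only [Set.mem_preimage, Set.mem_prod, Set.mem_pi, Set.mem_univ, true_imp_iff]
    constructor
    · rintro ⟨h1, h2⟩ l
      split_ifs with h3 h4
      · rwa [h3]
      · rwa [h4]
      · trivial
    · intro h
      have h1 := h i
      have h2 := h j
      rw [if_pos rfl] at h1
      rw [if_neg hij.symm, if_pos rfl] at h2
      exact ⟨h1, h2⟩
  rw [this, volume_pi_pi]
  have h2 : ∀ l, (volume : Measure I) (if l = i then s else if l = j then t else Set.univ) =
      (if l = i then volume s else 1) * (if l = j then volume t else 1) := by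
    intro l
    split_ifs with h3 h4
    · exact absurd (h3.symm.trans h4) hij
    · simp
    · simp
    · simp
  simp_rw [h2]
  rw [Finset.prod_mul_distrib]
  simp

theorem integrable_pow (f : Graphon) (d : ℕ) : Integrable fun z : I × I => f z.1 z.2 ^ d :=
  Integrable.of_bound (f.measurable_uncurry.pow_const d).aestronglyMeasurable 1
    (.of_forall fun z => by
      rw [Real.norm_eq_abs, abs_of_nonneg (pow_nonneg (f.nonneg _ _) _)]
      exact pow_le_one₀ (f.nonneg _ _) (f.le_one _ _))

theorem integrable_prod_edgeWeight {V : Type*} [Fintype V] (f : Graphon) (E : Finset (Sym2 V)) :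
    Integrable fun x : V → I => ∏ e ∈ E, edgeWeight f x e :=
  Integrable.of_bound (Finset.measurable_prod _ fun e' _ =>
    measurable_edgeWeight f e').aestronglyMeasurable 1 (.of_forall fun x => by
      have h1 := prod_edgeWeight_mem f x E
      rw [Real.norm_eq_abs, abs_of_nonneg h1.1]
      exact h1.2)

theorem homDensity_nonneg {V : Type*} [Fintype V] (H : SimpleGraph V) [Fintype H.edgeSet] (f : Graphon) :
    0 ≤ homDensity H f :=
  integral_nonneg fun x => (prod_edgeWeight_mem f x _).1

/-- On a `d`-regular graph the homomorphism density is controlled by the `L^d` norm. -/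
theorem sq_homDensity_le {V : Type*} [Fintype V] [DecidableEq V] {H : SimpleGraph V} [DecidableRel H.Adj] {d : ℕ} (hd : d ≠ 0)
    (hH : H.IsRegularOfDegree d) (f : Graphon) :
    homDensity H f ^ 2 ≤ (∫ z : I × I, f z.1 z.2 ^ d) ^ Fintype.card V := by
  have hd0 : (d : ℝ) ≠ 0 := Nat.cast_ne_zero.2 hd
  set M : ℝ := ∫ z : I × I, f z.1 z.2 ^ d with hM
  have hM0 : 0 ≤ M := integral_nonneg fun z => pow_nonneg (f.nonneg _ _) _
  have hreg : ∀ v, (H.edgeFinset.filter fun e => v ∈ e).card = d := fun v => by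
    rw [← SimpleGraph.incidenceFinset_eq_filter, SimpleGraph.card_incidenceFinset_eq_degree, hH v]
  have key := lmarginal_prod_rpow_le (μ := (volume : Measure I)) H.edgeFinset hd hreg
    (f := fun e x => ENNReal.ofReal (edgeWeight f x e ^ d))
    (fun e => ((measurable_edgeWeight f e).pow_const d).ennreal_ofReal)
    (fun e v hv x y => by simp only [edgeWeight_update f x hv]) Finset.univ (fun _ => 0)
  rw [lmarginal_univ] at key
  have hroot : ∀ (x : V → I) e, ENNReal.ofReal (edgeWeight f x e ^ d) ^ (1 / d : ℝ) =
      ENNReal.ofReal (edgeWeight f x e) := by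
    intro x e
    have h0 := (edgeWeight_mem f x e).1
    rw [ENNReal.ofReal_rpow_of_nonneg (pow_nonneg h0 d) (by positivity), ← Real.rpow_natCast,
      ← Real.rpow_mul h0, mul_one_div_cancel hd0, Real.rpow_one]
  have hedge : ∀ e ∈ H.edgeFinset, (∫⋯∫⁻_Finset.univ,
      (fun x : V → I => ENNReal.ofReal (edgeWeight f x e ^ d)) ∂fun _ => volume) (fun _ => 0) =
      ENNReal.ofReal M := by
    intro e he
    rw [lmarginal_univ]
    induction e with
    | _ i j =>
      have hij : i ≠ j := by
        rw [SimpleGraph.mem_edgeFinset, SimpleGraph.mem_edgeSet] at he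
        exact he.ne
      have h2 := (measurePreserving_pair hij).lintegral_comp
        (f := fun z : I × I => ENNReal.ofReal (f z.1 z.2 ^ d))
        (f.measurable_uncurry.pow_const d).ennreal_ofReal
      rw [hM, ofReal_integral_eq_lintegral_ofReal (integrable_pow f d)
        (.of_forall fun z => pow_nonneg (f.nonneg _ _) _)]
      exact h2
  rw [Finset.prod_congr rfl fun e he => by rw [hedge e he], Finset.prod_const] at key
  simp only [hroot] at key
  have hlhs : ∫⁻ x : V → I, ∏ e ∈ H.edgeFinset, ENNReal.ofReal (edgeWeight f x e)
      ∂(Measure.pi fun _ => volume) =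
      ENNReal.ofReal (homDensity H f) := by
    rw [homDensity_eq, ofReal_integral_eq_lintegral_ofReal (integrable_prod_edgeWeight f _)
      (.of_forall fun x => (prod_edgeWeight_mem f x _).1)]
    refine lintegral_congr fun x => ?_
    rw [ENNReal.ofReal_prod_of_nonneg fun e _ => (edgeWeight_mem f x e).1]
  rw [hlhs, ENNReal.ofReal_rpow_of_nonneg hM0 (by positivity), ← ENNReal.ofReal_pow (by positivity),
    ENNReal.ofReal_le_ofReal_iff (by positivity)] at key
  have hcard : 2 * H.edgeFinset.card = d * Fintype.card V := by
    rw [← H.sum_degrees_eq_twice_card_edges, Finset.sum_congr rfl fun v _ => hH v,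
      Finset.sum_const, smul_eq_mul, Finset.card_univ, mul_comm]
  calc homDensity H f ^ 2 ≤ ((M ^ (1 / d : ℝ)) ^ H.edgeFinset.card) ^ 2 :=
        pow_le_pow_left₀ (homDensity_nonneg H f) key 2
    _ = ((M ^ (1 / d : ℝ)) ^ d) ^ Fintype.card V := by
        rw [← pow_mul, ← pow_mul, mul_comm _ 2, hcard]
    _ = M ^ Fintype.card V := by
        rw [← Real.rpow_natCast (M ^ (1 / d : ℝ)) d, ← Real.rpow_mul hM0, one_div_mul_cancel hd0,
          Real.rpow_one]

/-! ### Two-block graphons as weighted sums over colourings -/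

/-- The value of a two-block graphon as a function of the blocks. -/
def blockValue (a b c : ℝ) (β β' : Bool) : ℝ :=
  if β && β' then a else if !β && !β' then c else b

theorem blockValue_comm (a b c : ℝ) (β β' : Bool) :
    blockValue a b c β β' = blockValue a b c β' β := by
  cases β <;> cases β' <;> rfl

theorem twoBlock_apply (γ : ℝ) (a b c : I) (x y : I) :
    twoBlock γ a b c x y = blockValue a b c (block γ x) (block γ y) := by
  change (if (x : ℝ) ≤ γ ∧ (y : ℝ) ≤ γ then (a : ℝ)
    else if γ < (x : ℝ) ∧ γ < (y : ℝ) then (c : ℝ) else (b : ℝ)) = _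
  simp [blockValue, block]

/-- The factor of an edge under a colouring. -/
def blockEdge {V : Type*} (a b c : ℝ) (χ : V → Bool) (e : Sym2 V) : ℝ :=
  Sym2.lift ⟨fun i j => blockValue a b c (χ i) (χ j), fun _ _ => blockValue_comm _ _ _ _ _⟩ e

/-- The weighted sum over colourings that expresses the homomorphism density of a two-block
graphon. -/
noncomputable def colourSum {V : Type*} [Fintype V] [DecidableEq V] (H : SimpleGraph V)
    [Fintype H.edgeSet] (m : Bool → ℝ) (a b c : ℝ) : ℝ :=
  ∑ χ : V → Bool, (∏ v, m (χ v)) * ∏ e ∈ H.edgeFinset, blockEdge a b c χ e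

theorem volume_block_preimage {γ : ℝ} (h0 : 0 < γ) (h1 : γ < 1) (β : Bool) :
    volume.real {x : I | block γ x = β} = blockLength γ β := by
  have h : volume.real {x : I | block γ x = true} = γ := by
    rw [measureReal_congr (t := Subtype.val ⁻¹' Set.Ioc 0 γ), volume_val_preimage_Ioc le_rfl h0.le
      h1.le, sub_zero]
    filter_upwards [ae_ne_zero] with x hx
    have hx0 : (0 : ℝ) < x := lt_of_le_of_ne x.2.1 (fun h => hx (Subtype.ext h.symm))
    refine propext ?_
    change block γ x = true ↔ 0 < (x : ℝ) ∧ (x : ℝ) ≤ γ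
    simp [block, hx0]
  cases β
  · have h2 : {x : I | block γ x = false} = {x : I | block γ x = true}ᶜ := by ext x; simp
    have hms : MeasurableSet {x : I | block γ x = true} :=
      measurable_block (measurableSet_singleton true)
    rw [h2, probReal_compl_eq_one_sub hms, h]
    rfl
  · exact h

/-- Expansion of an integral over `V → [0,1]` according to the blocks of the coordinates. -/
theorem integral_prod_mul_block {V : Type*} [Fintype V] [DecidableEq V] (γ : ℝ)
    (Φ : (V → Bool) → ℝ) {ψ : I → ℝ} (hψ : Measurable ψ)
    (hψ01 : ∀ x, ψ x ∈ Set.Icc (0 : ℝ) 1) :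
    ∫ x : V → I, (∏ v, ψ (x v)) * Φ (fun v => block γ (x v)) =
      ∑ χ : V → Bool, (∏ v, ∫ y in {y | block γ y = χ v}, ψ y) * Φ χ := by
  have hms : ∀ β, MeasurableSet {y : I | block γ y = β} := fun β =>
    measurable_block (measurableSet_singleton β)
  have h1 : ∀ x : V → I, (∏ v, ψ (x v)) * Φ (fun v => block γ (x v)) =
      ∑ χ : V → Bool, (∏ v, {y | block γ y = χ v}.indicator ψ (x v)) * Φ χ := by
    intro x
    rw [Finset.sum_eq_single_of_mem (fun v => block γ (x v)) (Finset.mem_univ _)]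
    · congr 1
      exact Finset.prod_congr rfl fun v _ => (Set.indicator_of_mem (by simp) _).symm
    · intro χ _ hχ
      obtain ⟨v, hv⟩ := Function.ne_iff.1 hχ
      rw [Finset.prod_eq_zero (Finset.mem_univ v), zero_mul]
      exact Set.indicator_of_notMem (fun h => hv h.symm) _
  have hm : ∀ χ : V → Bool, Measurable fun x : V → I =>
      ∏ v, {y | block γ y = χ v}.indicator ψ (x v) := fun χ =>
    Finset.measurable_prod _ fun v _ => (hψ.indicator (hms _)).comp (measurable_pi_apply v)
  have h01 : ∀ β x, {y | block γ y = β}.indicator ψ x ∈ Set.Icc (0 : ℝ) 1 := by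
    intro β x
    by_cases hx : x ∈ {y | block γ y = β}
    · rw [Set.indicator_of_mem hx]; exact hψ01 x
    · rw [Set.indicator_of_notMem hx]; simp
  have hi : ∀ χ : V → Bool, Integrable fun x : V → I =>
      (∏ v, {y | block γ y = χ v}.indicator ψ (x v)) * Φ χ := fun χ =>
    (Integrable.of_bound (hm χ).aestronglyMeasurable 1 (.of_forall fun x => by
      rw [Real.norm_eq_abs, abs_of_nonneg (Finset.prod_nonneg fun v _ => (h01 _ _).1)]
      exact Finset.prod_le_one (fun v _ => (h01 _ _).1) fun v _ => (h01 _ _).2)).mul_const _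
  simp_rw [h1]
  rw [integral_finsetSum _ fun χ _ => hi χ]
  refine Finset.sum_congr rfl fun χ _ => ?_
  rw [integral_mul_const]
  congr 1
  have := integral_fintype_prod_volume_eq_prod (ι := V) (E := fun _ => I)
    (fun v y => {y | block γ y = χ v}.indicator ψ y)
  rw [this]
  exact Finset.prod_congr rfl fun v _ => integral_indicator (hms _)

theorem homDensity_twoBlock {V : Type*} [Fintype V] [DecidableEq V] {γ : ℝ} (h0 : 0 < γ)
    (h1 : γ < 1) (H : SimpleGraph V)
    [Fintype H.edgeSet] (a b c : I) :
    homDensity H (twoBlock γ a b c) = colourSum H (blockLength γ) a b c := by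
  have h2 : ∀ x : V → I, ∏ e ∈ H.edgeFinset, edgeWeight (twoBlock γ a b c) x e =
      (∏ v, (fun _ : I => (1 : ℝ)) (x v)) *
        ∏ e ∈ H.edgeFinset, blockEdge a b c (fun v => block γ (x v)) e := by
    intro x
    rw [Finset.prod_const_one, one_mul]
    refine Finset.prod_congr rfl fun e _ => ?_
    induction e with
    | _ i j => exact twoBlock_apply γ a b c (x i) (x j)
  rw [homDensity_eq]
  simp_rw [h2]
  rw [integral_prod_mul_block γ (fun χ => ∏ e ∈ H.edgeFinset, blockEdge a b c χ e)
    measurable_const (fun _ => by simp)]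
  refine Finset.sum_congr rfl fun χ _ => ?_
  congr 1
  refine Finset.prod_congr rfl fun v _ => ?_
  rw [setIntegral_const, volume_block_preimage h0 h1]
  simp


/-! ### Strictness of Hölder's inequality for two-block graphons -/

theorem blockValue_not (a b c : ℝ) (β β' : Bool) :
    blockValue a b c (!β) (!β') = blockValue c b a β β' := by
  cases β <;> cases β' <;> rfl

theorem blockValue_nonneg {a b c : ℝ} (ha : 0 ≤ a) (hb : 0 ≤ b) (hc : 0 ≤ c) (β β' : Bool) :
    0 ≤ blockValue a b c β β' := by
  cases β <;> cases β' <;> assumption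

theorem blockValue_mono {a b c a' b' c' : ℝ} (ha : a ≤ a') (hb : b ≤ b') (hc : c ≤ c')
    (β β' : Bool) : blockValue a b c β β' ≤ blockValue a' b' c' β β' := by
  cases β <;> cases β' <;> assumption

theorem blockEdge_nonneg {V : Type*} {a b c : ℝ} (ha : 0 ≤ a) (hb : 0 ≤ b) (hc : 0 ≤ c)
    (χ : V → Bool) (e : Sym2 V) : 0 ≤ blockEdge a b c χ e := by
  induction e with
  | _ i j => exact blockValue_nonneg ha hb hc _ _

theorem blockEdge_mono {V : Type*} {a b c a' b' c' : ℝ} (ha : a ≤ a') (hb : b ≤ b') (hc : c ≤ c')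
    (χ : V → Bool) (e : Sym2 V) : blockEdge a b c χ e ≤ blockEdge a' b' c' χ e := by
  induction e with
  | _ i j => exact blockValue_mono ha hb hc _ _

theorem pow_add_pow_lt {x y : ℝ} (hx : 0 < x) (hy : 0 < y) {k : ℕ} (hk : 2 ≤ k) :
    x ^ k + y ^ k < (x + y) ^ k := by
  induction k, hk using Nat.le_induction with
  | base => nlinarith [mul_pos hx hy]
  | succ k _ ih =>
    have h1 := mul_lt_mul_of_pos_right ih (add_pos hx hy)
    have h2 : 0 < x ^ k * y := by positivity
    have h3 : 0 < y ^ k * x := by positivity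
    rw [pow_succ, pow_succ, pow_succ]
    nlinarith

/-- Cauchy–Schwarz bounds the left side by (x^(2n-2) + y^(2n-2)) (x² + y²), and (n-1)-th powers are
strictly superadditive for n ≥ 3. -/
theorem sq_pow_add_pow_lt {x y : ℝ} (hx : 0 < x) (hy : 0 < y) {n : ℕ} (hn : 3 ≤ n) :
    (x ^ n + y ^ n) ^ 2 < (x ^ 2 + y ^ 2) ^ n := by
  obtain ⟨k, rfl⟩ : ∃ k, n = k + 1 := ⟨n - 1, by omega⟩
  have h1 := pow_add_pow_lt (pow_pos hx 2) (pow_pos hy 2) (k := k) (by omega)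
  have h2 := mul_lt_mul_of_pos_right h1 (show 0 < x ^ 2 + y ^ 2 by positivity)
  rw [pow_succ (x ^ 2 + y ^ 2)]
  refine lt_of_le_of_lt ?_ h2
  rw [← pow_mul, ← pow_mul, mul_comm 2 k, pow_mul, pow_mul, pow_succ x k, pow_succ y k]
  nlinarith [sq_nonneg (x ^ k * y - y ^ k * x)]

/-- Multiplying the weights of the neighbours of all vertices in two ways shows that a proper
2-colouring and its reversal have equal weight; the product of these two weights is the right side.
-/
theorem sq_prod_proper_colouring {V : Type*} [Fintype V] {H : SimpleGraph V}
    [DecidableRel H.Adj] {d : ℕ} (hd : d ≠ 0) (hH : H.IsRegularOfDegree d)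
    {m : Bool → ℝ} (hm : ∀ β, 0 < m β) {χ : V → Bool} (hχ : ∀ v w, H.Adj v w → χ v = !χ w) :
    (∏ v, m (χ v)) ^ 2 = (m true * m false) ^ Fintype.card V := by
  have h1 : ∏ v, ∏ w ∈ H.neighborFinset v, m (χ w) = (∏ v, m (χ v)) ^ d := by
    rw [Finset.prod_comm' (t' := Finset.univ) (s' := fun w => H.neighborFinset w)
      (by simp [SimpleGraph.adj_comm]), ← Finset.prod_pow]
    refine Finset.prod_congr rfl fun w _ => ?_
    rw [Finset.prod_const, SimpleGraph.card_neighborFinset_eq_degree, hH w]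
  have h2 : ∏ v, ∏ w ∈ H.neighborFinset v, m (χ w) = (∏ v, m (!χ v)) ^ d := by
    rw [← Finset.prod_pow]
    refine Finset.prod_congr rfl fun v _ => ?_
    rw [Finset.prod_congr rfl fun w hw => by
      rw [hχ w v ((H.mem_neighborFinset v w).1 hw).symm], Finset.prod_const,
      SimpleGraph.card_neighborFinset_eq_degree, hH v]
  have h3 : ∏ v, m (χ v) = ∏ v, m (!χ v) :=
    (pow_left_inj₀ (Finset.prod_nonneg fun v _ => (hm _).le)
      (Finset.prod_nonneg fun v _ => (hm _).le) hd).1 (h1.symm.trans h2)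
  rw [sq]
  nth_rw 2 [h3]
  rw [← Finset.prod_mul_distrib, Finset.prod_congr rfl (g := fun _ => m true * m false),
    Finset.prod_const, Finset.card_univ]
  intro v _
  cases χ v
  · exact mul_comm _ _
  · rfl

section colourings

variable {V : Type*} [Fintype V] [DecidableEq V]

theorem colourSum_swap (H : SimpleGraph V) [Fintype H.edgeSet] (m : Bool → ℝ) (a b c : ℝ) :
    colourSum H m a b c = colourSum H (fun β => m (!β)) c b a := by
  refine Finset.sum_equiv (Equiv.arrowCongr (Equiv.refl V) Equiv.boolNot) (by simp) fun χ _ => ?_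
  congr 1
  · refine Finset.prod_congr rfl fun v _ => ?_
    simp
  · refine Finset.prod_congr rfl fun e _ => ?_
    induction e with
    | _ i j => exact (blockValue_not _ _ _ _ _).symm

variable {H : SimpleGraph V} [DecidableRel H.Adj] {d : ℕ}

theorem colourSum_one_zero_zero (hd : d ≠ 0) (hH : H.IsRegularOfDegree d) (m : Bool → ℝ) :
    colourSum H m 1 0 0 = m true ^ Fintype.card V := by
  unfold colourSum
  rw [Finset.sum_eq_single_of_mem (fun _ => true) (Finset.mem_univ _)]
  · rw [Finset.prod_const, Finset.card_univ, Finset.prod_eq_one, mul_one]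
    intro e _
    induction e with
    | _ i j => rfl
  · intro χ _ hχ
    obtain ⟨v, hv⟩ := Function.ne_iff.1 hχ
    have hv : χ v = false := by simpa using hv
    obtain ⟨w, hw⟩ : ∃ w, H.Adj v w := by
      have h1 := hH v
      rw [← SimpleGraph.card_neighborFinset_eq_degree] at h1
      obtain ⟨w, hw⟩ := Finset.card_pos.1 (by omega : 0 < (H.neighborFinset v).card)
      exact ⟨w, (H.mem_neighborFinset v w).1 hw⟩
    rw [Finset.prod_eq_zero (SimpleGraph.mem_edgeFinset.2 (H.mem_edgeSet.2 hw)), mul_zero]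
    change blockValue 1 0 0 (χ v) (χ w) = 0
    rw [hv]
    cases χ w <;> rfl

/-- Colourings that are constant on the connected components of a graph of minimum degree at
least `2` have small total weight. -/
theorem sq_sum_constant_colourings_lt [Nonempty V] (hd : 2 ≤ d) (hH : H.IsRegularOfDegree d)
    {m : Bool → ℝ} (hm : ∀ β, 0 < m β) {s : Finset (V → Bool)}
    (hs : ∀ χ ∈ s, ∀ v w, H.Adj v w → χ v = χ w) :
    (∑ χ ∈ s, ∏ v, m (χ v)) ^ 2 < (m true ^ 2 + m false ^ 2) ^ Fintype.card V := by
  classical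
  set n : H.ConnectedComponent → ℕ := fun C =>
    (Finset.univ.filter fun v => H.connectedComponentMk v = C).card with hn
  -- A component contains a vertex and its `d` ≥ 2 neighbours; size at least 3 is what makes
  -- `sq_pow_add_pow_lt` strict.
  have hn3 : ∀ C, 3 ≤ n C := by
    intro C
    induction C using SimpleGraph.ConnectedComponent.ind with
    | _ v =>
      have h1 : insert v (H.neighborFinset v) ⊆
          Finset.univ.filter fun w => H.connectedComponentMk w = H.connectedComponentMk v := by
        intro w hw
        rw [Finset.mem_insert, SimpleGraph.mem_neighborFinset] at hw
        rw [Finset.mem_filter]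
        refine ⟨Finset.mem_univ _, ?_⟩
        rcases hw with rfl | hw
        · rfl
        · exact SimpleGraph.ConnectedComponent.sound hw.symm.reachable
      have h2 := Finset.card_le_card h1
      rw [Finset.card_insert_of_notMem (by simp), SimpleGraph.card_neighborFinset_eq_degree,
        hH v] at h2
      change 3 ≤ (Finset.univ.filter fun w => H.connectedComponentMk w =
        H.connectedComponentMk v).card
      omega
  have hprod : ∀ κ : H.ConnectedComponent → Bool,
      ∏ v, m (κ (H.connectedComponentMk v)) = ∏ C, m (κ C) ^ n C := by
    intro κ
    rw [← Finset.prod_fiberwise Finset.univ (fun v => H.connectedComponentMk v)]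
    refine Finset.prod_congr rfl fun C _ => ?_
    rw [Finset.prod_congr rfl fun v hv => by rw [(Finset.mem_filter.1 hv).2], Finset.prod_const]
  have hZ : ∑ κ : H.ConnectedComponent → Bool, ∏ v, m (κ (H.connectedComponentMk v)) =
      ∏ C, (m true ^ n C + m false ^ n C) := by
    simp_rw [hprod]
    have := Finset.prod_univ_sum (t := fun _ : H.ConnectedComponent => (Finset.univ : Finset Bool))
      (f := fun C β => m β ^ n C)
    rw [Fintype.piFinset_univ] at this
    rw [← this]
    simp
  have hle : ∑ χ ∈ s, ∏ v, m (χ v) ≤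
      ∑ κ : H.ConnectedComponent → Bool, ∏ v, m (κ (H.connectedComponentMk v)) := by
    have hinj : Function.Injective fun (κ : H.ConnectedComponent → Bool) (v : V) =>
        κ (H.connectedComponentMk v) := by
      intro κ κ' h
      funext C
      induction C using SimpleGraph.ConnectedComponent.ind with
      | _ v => exact congrFun h v
    rw [← Finset.sum_image (f := fun χ : V → Bool => ∏ v, m (χ v)) hinj.injOn]
    refine Finset.sum_le_sum_of_subset_of_nonneg (fun χ hχ => ?_) fun χ _ _ =>
      Finset.prod_nonneg fun v _ => (hm _).le
    rw [Finset.mem_image]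
    have hreach : ∀ v w, H.Reachable v w → χ v = χ w := by
      rintro v w ⟨p⟩
      induction p with
      | nil => rfl
      | cons h _ ih => exact (hs χ hχ _ _ h).trans ih
    refine ⟨fun C => χ C.out, Finset.mem_univ _, ?_⟩
    funext v
    exact hreach _ _ (SimpleGraph.ConnectedComponent.exact (Quot.out_eq _))
  have hnn : 0 ≤ ∑ χ ∈ s, ∏ v, m (χ v) :=
    Finset.sum_nonneg fun _ _ => Finset.prod_nonneg fun v _ => (hm _).le
  calc (∑ χ ∈ s, ∏ v, m (χ v)) ^ 2 ≤ (∏ C, (m true ^ n C + m false ^ n C)) ^ 2 :=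
        pow_le_pow_left₀ hnn (hle.trans hZ.le) 2
    _ = ∏ C, (m true ^ n C + m false ^ n C) ^ 2 := (Finset.prod_pow _ _ _).symm
    _ < ∏ C, (m true ^ 2 + m false ^ 2) ^ n C := by
        have := hm true
        have := hm false
        refine Finset.prod_lt_prod_of_nonempty (fun C _ => by positivity)
          (fun C _ => sq_pow_add_pow_lt (hm _) (hm _) (hn3 C))
          ⟨H.connectedComponentMk (Classical.arbitrary V), Finset.mem_univ _⟩
    _ = _ := by
        rw [Finset.prod_pow_eq_pow_sum]
        congr 1
        have := Finset.card_eq_sum_card_fiberwise (s := (Finset.univ : Finset V))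
          (t := Finset.univ) (f := fun v => H.connectedComponentMk v) (fun _ _ => by simp)
        exact this.symm

/-- Only colourings that are constant along edges contribute. -/
theorem sq_colourSum_one_zero_one_lt [Nonempty V] (hd : 2 ≤ d) (hH : H.IsRegularOfDegree d)
    {m : Bool → ℝ} (hm : ∀ β, 0 < m β) :
    colourSum H m 1 0 1 ^ 2 < (m true ^ 2 + m false ^ 2) ^ Fintype.card V := by
  classical
  have h := sq_sum_constant_colourings_lt hd hH hm
    (s := Finset.univ.filter fun χ => ∀ v w, H.Adj v w → χ v = χ w)
    (fun χ hχ => (Finset.mem_filter.1 hχ).2)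
  refine lt_of_eq_of_lt ?_ h
  congr 1
  rw [Finset.sum_filter]
  refine Finset.sum_congr rfl fun χ _ => ?_
  split_ifs with hχ
  · suffices hE : ∏ e ∈ H.edgeFinset, blockEdge 1 0 1 χ e = 1 by rw [hE, mul_one]
    refine Finset.prod_eq_one fun e he => ?_
    induction e with
    | _ i j =>
      rw [SimpleGraph.mem_edgeFinset, SimpleGraph.mem_edgeSet] at he
      change blockValue 1 0 1 (χ i) (χ j) = 1
      rw [hχ i j he]
      cases χ j <;> rfl
  · push Not at hχ
    obtain ⟨v, w, hvw, hne⟩ := hχ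
    rw [Finset.prod_eq_zero (SimpleGraph.mem_edgeFinset.2 (H.mem_edgeSet.2 hvw)), mul_zero]
    change blockValue 1 0 1 (χ v) (χ w) = 0
    cases h1 : χ v <;> cases h2 : χ w <;> simp_all [blockValue]

/-- The contributing colourings are the proper 2-colourings, and by regularity they all have the
same weight. It remains to count them. -/
theorem sq_colourSum_zero_one_zero_lt [Nonempty V] (hd : 2 ≤ d) (hH : H.IsRegularOfDegree d)
    {m : Bool → ℝ} (hm : ∀ β, 0 < m β) :
    colourSum H m 0 1 0 ^ 2 < (2 * (m true * m false)) ^ Fintype.card V := by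
  classical
  set P := Finset.univ.filter fun χ : V → Bool => ∀ v w, H.Adj v w → χ v = !χ w with hP
  have hPmem : ∀ χ ∈ P, ∀ v w, H.Adj v w → χ v = !χ w := fun χ hχ => (Finset.mem_filter.1 hχ).2
  have h1 : colourSum H m 0 1 0 = ∑ χ ∈ P, ∏ v, m (χ v) := by
    rw [hP, Finset.sum_filter]
    refine Finset.sum_congr rfl fun χ _ => ?_
    split_ifs with hχ
    · suffices hE : ∏ e ∈ H.edgeFinset, blockEdge 0 1 0 χ e = 1 by rw [hE, mul_one]
      refine Finset.prod_eq_one fun e he => ?_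
      induction e with
      | _ i j =>
        rw [SimpleGraph.mem_edgeFinset, SimpleGraph.mem_edgeSet] at he
        change blockValue 0 1 0 (χ i) (χ j) = 1
        rw [hχ i j he]
        cases χ j <;> rfl
    · push Not at hχ
      obtain ⟨v, w, hvw, hne⟩ := hχ
      rw [Finset.prod_eq_zero (SimpleGraph.mem_edgeFinset.2 (H.mem_edgeSet.2 hvw)), mul_zero]
      change blockValue 0 1 0 (χ v) (χ w) = 0
      cases h1 : χ v <;> cases h2 : χ w <;> simp_all [blockValue]
  have hmm : 0 < m true * m false := mul_pos (hm _) (hm _)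
  have hw : ∀ χ ∈ P, ∏ v, m (χ v) = Real.sqrt ((m true * m false) ^ Fintype.card V) := by
    intro χ hχ
    rw [← sq_prod_proper_colouring (by omega) hH hm (hPmem χ hχ),
      Real.sqrt_sq (Finset.prod_nonneg fun v _ => (hm _).le)]
  rw [h1, Finset.sum_congr rfl hw, Finset.sum_const, nsmul_eq_mul, mul_pow,
    Real.sq_sqrt (by positivity), mul_pow 2 (m true * m false)]
  refine mul_lt_mul_of_pos_right ?_ (by positivity)
  rcases P.eq_empty_or_nonempty with h0 | ⟨χ₀, hχ₀⟩
  · rw [h0]; simp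
  -- Adding a fixed proper colouring modulo 2 sends proper colourings injectively to colourings
  -- constant along edges; uniform weights 1/2 turn the bound on weights into a bound on their
  -- number.
  have h2 := sq_sum_constant_colourings_lt hd hH (m := fun _ => (1 / 2 : ℝ)) (fun _ => by norm_num)
    (s := P.image fun χ v => xor (χ v) (χ₀ v)) (by
      intro χ' hχ' v w hvw
      obtain ⟨χ, hχ, rfl⟩ := Finset.mem_image.1 hχ'
      change xor (χ v) (χ₀ v) = xor (χ w) (χ₀ w)
      rw [hPmem χ hχ v w hvw, hPmem χ₀ hχ₀ v w hvw]
      cases χ w <;> cases χ₀ w <;> rfl)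
  have hinj : Function.Injective fun (χ : V → Bool) (v : V) => xor (χ v) (χ₀ v) := by
    intro χ χ' h
    funext v
    have := congrFun h v
    simpa using this
  simp only [Finset.prod_const, Finset.card_univ, Finset.sum_const, nsmul_eq_mul,
    Finset.card_image_of_injective _ hinj] at h2
  norm_num at h2
  have h3 : ((1 / 2 : ℝ) ^ Fintype.card V) * (2 ^ Fintype.card V) = 1 := by
    rw [← mul_pow]; norm_num
  have h4 : (0 : ℝ) < 2 ^ Fintype.card V := by positivity
  rw [mul_pow] at h2
  have h5 := mul_lt_mul_of_pos_right (mul_lt_mul_of_pos_right h2 h4) h4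
  set x := (1 / 2 : ℝ) ^ Fintype.card V
  set y := (2 : ℝ) ^ Fintype.card V
  set N : ℝ := (P.card : ℝ)
  calc N ^ 2 = N ^ 2 * x ^ 2 * y * y := by
        rw [show N ^ 2 * x ^ 2 * y * y = N ^ 2 * (x * y) ^ 2 by ring, h3]; ring
    _ < x * y * y := h5
    _ = y := by rw [h3, one_mul]

end colourings

theorem add_pow_le_add_mul {S x : ℝ} (hS0 : 0 ≤ S) (hS1 : S ≤ 1) (hx0 : 0 ≤ x) (hx1 : x ≤ 1)
    (n : ℕ) : (S + x) ^ n ≤ S ^ n + x * 3 ^ n := by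
  induction n with
  | zero => simp [hx0]
  | succ n ih =>
    have h1 := mul_le_mul_of_nonneg_right ih (add_nonneg hS0 hx0)
    have h2 : S ^ n ≤ 1 := pow_le_one₀ hS0 hS1
    have h3 : (1 : ℝ) ≤ 3 ^ n := one_le_pow₀ (by norm_num)
    have h4 : x * 3 ^ n * (S + x) ≤ x * 3 ^ n * 2 :=
      mul_le_mul_of_nonneg_left (by linarith) (by positivity)
    rw [pow_succ, pow_succ, pow_succ]
    nlinarith [mul_le_mul_of_nonneg_left h2 hx0, mul_le_mul_of_nonneg_left h3 hx0]


/-! ### The mass of two-block graphons -/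

theorem integral_comp_block {γ : ℝ} (h0 : 0 < γ) (h1 : γ < 1) (Ψ : Bool → ℝ) :
    ∫ x : I, Ψ (block γ x) = γ * Ψ true + (1 - γ) * Ψ false := by
  have hms : MeasurableSet {x : I | block γ x = true} :=
    measurable_block (measurableSet_singleton true)
  have hmΨ : Measurable fun x : I => Ψ (block γ x) := (measurable_of_countable Ψ).comp measurable_block
  have hi : Integrable fun x : I => Ψ (block γ x) :=
    Integrable.of_bound hmΨ.aestronglyMeasurable (|Ψ true| + |Ψ false|) (.of_forall fun x => by
      rw [Real.norm_eq_abs]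
      cases block γ x
      · linarith [abs_nonneg (Ψ true)]
      · linarith [abs_nonneg (Ψ false)])
  have h2 : {x : I | block γ x = true}ᶜ = {x : I | block γ x = false} := by ext x; simp
  rw [← integral_add_compl hms hi, setIntegral_congr_fun (g := fun _ => Ψ true) hms (fun x hx => by
      change block γ x = true at hx
      rw [hx]),
    setIntegral_congr_fun (g := fun _ => Ψ false) hms.compl (fun x hx => by
      rw [h2] at hx
      change block γ x = false at hx
      rw [hx]), setIntegral_const, setIntegral_const, h2, volume_block_preimage h0 h1,
    volume_block_preimage h0 h1]
  rfl

/-- The integral of the function with values `a`, `b`, `c` on the blocks. -/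
def blockMass (γ a b c : ℝ) : ℝ := γ ^ 2 * a + 2 * γ * (1 - γ) * b + (1 - γ) ^ 2 * c

theorem integral_twoBlock_pow {γ : ℝ} (h0 : 0 < γ) (h1 : γ < 1) (a b c : I) (d : ℕ) :
    ∫ z : I × I, twoBlock γ a b c z.1 z.2 ^ d =
      blockMass γ ((a : ℝ) ^ d) ((b : ℝ) ^ d) ((c : ℝ) ^ d) := by
  rw [Measure.volume_eq_prod, integral_prod _ (integrable_pow (twoBlock γ a b c) d)]
  have h2 : ∀ x : I, ∫ y : I, twoBlock γ a b c x y ^ d =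
      (fun β => γ * blockValue a b c β true ^ d + (1 - γ) * blockValue a b c β false ^ d)
        (block γ x) := by
    intro x
    simp_rw [twoBlock_apply]
    exact integral_comp_block h0 h1 fun β => blockValue a b c (block γ x) β ^ d
  simp_rw [h2]
  rw [integral_comp_block h0 h1 fun β =>
    γ * blockValue a b c β true ^ d + (1 - γ) * blockValue a b c β false ^ d]
  simp only [blockMass, blockValue, Bool.and_self, Bool.not_true, Bool.not_false, Bool.and_false,
    Bool.and_true, if_true, if_false, Bool.false_eq_true]
  ring

theorem integral_twoBlock {γ : ℝ} (h0 : 0 < γ) (h1 : γ < 1) (a b c : I) :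
    ∫ z : I × I, twoBlock γ a b c z.1 z.2 = blockMass γ a b c := by
  have := integral_twoBlock_pow h0 h1 a b c 1
  simpa using this

theorem blockLength_one_sub (γ : ℝ) (β : Bool) : blockLength (1 - γ) β = blockLength γ (!β) := by
  cases β <;> simp [blockLength]

theorem blockMass_one_sub (γ a b c : ℝ) : blockMass (1 - γ) a b c = blockMass γ c b a := by
  unfold blockMass; ring

theorem exists_adj_of_regular {V : Type*} [Fintype V] [Nonempty V] {H : SimpleGraph V}
    [DecidableRel H.Adj] {d : ℕ} (hd : d ≠ 0) (hH : H.IsRegularOfDegree d) :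
    ∃ v w, H.Adj v w := by
  have h1 := hH (Classical.arbitrary V)
  rw [← SimpleGraph.card_neighborFinset_eq_degree] at h1
  obtain ⟨w, hw⟩ := Finset.card_pos.1
    (by omega : 0 < (H.neighborFinset (Classical.arbitrary V)).card)
  exact ⟨_, w, (H.mem_neighborFinset _ w).1 hw⟩

section strict

variable {V : Type*} [Fintype V] [DecidableEq V]

theorem homDensity_twoBlock_one_sub {γ : ℝ} (h0 : 0 < γ) (h1 : γ < 1) (H : SimpleGraph V)
    [Fintype H.edgeSet] (a b c : I) :
    homDensity H (twoBlock (1 - γ) a b c) = homDensity H (twoBlock γ c b a) := by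
  rw [homDensity_twoBlock (by linarith) (by linarith), homDensity_twoBlock h0 h1, colourSum_swap]
  congr 1
  funext β
  rw [blockLength_one_sub, Bool.not_not]

variable {H : SimpleGraph V} [DecidableRel H.Adj] {d : ℕ}

theorem homDensity_twoBlock_one_zero_zero {γ : ℝ} (h0 : 0 < γ) (h1 : γ < 1) (hd : d ≠ 0)
    (hH : H.IsRegularOfDegree d) : homDensity H (twoBlock γ 1 0 0) = γ ^ Fintype.card V := by
  rw [homDensity_twoBlock h0 h1]
  exact colourSum_one_zero_zero hd hH _

theorem homDensity_twoBlock_zero_zero_one {γ : ℝ} (h0 : 0 < γ) (h1 : γ < 1) (hd : d ≠ 0)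
    (hH : H.IsRegularOfDegree d) : homDensity H (twoBlock γ 0 0 1) = (1 - γ) ^ Fintype.card V := by
  rw [← homDensity_twoBlock_one_sub h0 h1,
    homDensity_twoBlock_one_zero_zero (by linarith) (by linarith) hd hH]

theorem colourSum_zero_zero_zero [Nonempty V] (hd : d ≠ 0) (hH : H.IsRegularOfDegree d)
    (m : Bool → ℝ) : colourSum H m 0 0 0 = 0 := by
  obtain ⟨v, w, hvw⟩ := exists_adj_of_regular hd hH
  refine Finset.sum_eq_zero fun χ _ => ?_
  rw [Finset.prod_eq_zero (SimpleGraph.mem_edgeFinset.2 (H.mem_edgeSet.2 hvw)), mul_zero]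
  change blockValue 0 0 0 (χ v) (χ w) = 0
  cases χ v <;> cases χ w <;> rfl

/-- Raising the weight of the second block of `f_{1,1,0}` increases the density linearly. -/
theorem exists_colourSum_add_le [Nonempty V] (hd : d ≠ 0) (hH : H.IsRegularOfDegree d)
    {m : Bool → ℝ} (hm : ∀ β, 0 < m β) :
    ∃ κ : ℝ, 0 < κ ∧ ∀ c : ℝ, 0 ≤ c → colourSum H m 1 1 0 + κ * c ≤ colourSum H m 1 1 c := by
  obtain ⟨v, w, hvw⟩ := exists_adj_of_regular hd hH
  -- Only the endpoints of a single edge lie in the second block, so exactly one edge carries the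
  -- factor `c` and the gain is linear.
  set χ₀ : V → Bool := fun u => !(decide (u = v) || decide (u = w)) with hχ₀
  have hmem : s(v, w) ∈ H.edgeFinset := SimpleGraph.mem_edgeFinset.2 (H.mem_edgeSet.2 hvw)
  have hval : ∀ c : ℝ, ∏ e ∈ H.edgeFinset, blockEdge 1 1 c χ₀ e = c := by
    intro c
    rw [Finset.prod_eq_single_of_mem _ hmem]
    · change blockValue 1 1 c (χ₀ v) (χ₀ w) = c
      simp [hχ₀, blockValue]
    · intro e he hne
      induction e with
      | _ i j =>
        rw [SimpleGraph.mem_edgeFinset, SimpleGraph.mem_edgeSet] at he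
        change blockValue 1 1 c (χ₀ i) (χ₀ j) = 1
        have h1 : χ₀ i = true ∨ χ₀ j = true := by
          by_contra hcon
          push Not at hcon
          simp only [hχ₀, ne_eq, Bool.not_eq_false, Bool.not_eq_eq_eq_not,
            Bool.not_true, Bool.or_eq_true, decide_eq_true_eq] at hcon
          have hij := he.ne
          apply hne
          rw [Sym2.eq_iff]
          rcases hcon with ⟨rfl | rfl, rfl | rfl⟩
          · exact absurd rfl hij
          · exact Or.inl ⟨rfl, rfl⟩
          · exact Or.inr ⟨rfl, rfl⟩
          · exact absurd rfl hij
        rcases h1 with h1 | h1 <;> rw [h1]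
        · cases χ₀ j <;> rfl
        · cases χ₀ i <;> rfl
  refine ⟨∏ u, m (χ₀ u), Finset.prod_pos fun u _ => hm _, fun c hc => ?_⟩
  unfold colourSum
  rw [← Finset.add_sum_erase _ _ (Finset.mem_univ χ₀), ← Finset.add_sum_erase _ _ (Finset.mem_univ χ₀),
    hval 0, hval c, mul_zero, zero_add, add_comm]
  refine add_le_add le_rfl (Finset.sum_le_sum fun χ _ => mul_le_mul_of_nonneg_left
    (Finset.prod_le_prod (fun _ _ => blockEdge_nonneg zero_le_one zero_le_one le_rfl _ _)
      fun _ _ => blockEdge_mono le_rfl le_rfl hc _ _) (Finset.prod_nonneg fun _ _ => (hm _).le))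

/-- In case of equality, raising the value on the second square from 0 to `c` would increase the
density at a linear rate, but the integral of the d-th power only by a multiple of c^d ≤ c². For
small `c` this contradicts Hölder's inequality. -/
theorem sq_homDensity_one_one_zero_lt [Nonempty V] (hd : 2 ≤ d) (hH : H.IsRegularOfDegree d)
    {γ : ℝ} (h0 : 0 < γ) (h1 : γ < 1) :
    homDensity H (twoBlock γ 1 1 0) ^ 2 < blockMass γ 1 1 0 ^ Fintype.card V := by
  by_contra hcon
  push Not at hcon
  obtain ⟨κ, hκ, hlin⟩ := exists_colourSum_add_le (m := blockLength γ) (by omega) hH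
    (blockLength_pos h0 h1)
  have hS : blockMass γ 1 1 0 = 2 * γ - γ ^ 2 := by unfold blockMass; ring
  have hS0 : 0 < blockMass γ 1 1 0 := by rw [hS]; nlinarith
  have hS1 : blockMass γ 1 1 0 ≤ 1 := by rw [hS]; nlinarith [sq_nonneg (1 - γ)]
  set S := blockMass γ 1 1 0 with hSdef
  set T := homDensity H (twoBlock γ 1 1 0) with hT
  have hT0 : 0 < T := by
    have h2 : 0 ≤ T := homDensity_nonneg H _
    have h3 : 0 < T ^ 2 := lt_of_lt_of_le (by positivity) hcon
    exact lt_of_le_of_ne h2 (by rintro h; rw [← h] at h3; norm_num at h3)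
  have key : ∀ c : ℝ, 0 < c → c ≤ 1 → 2 * T * κ ≤ c * 3 ^ Fintype.card V := by
    intro c hc0 hc1
    have h2 := sq_homDensity_le (by omega : d ≠ 0) hH (twoBlock γ 1 1 ⟨c, hc0.le, hc1⟩)
    rw [integral_twoBlock_pow h0 h1] at h2
    have h3 : T + κ * c ≤ homDensity H (twoBlock γ 1 1 ⟨c, hc0.le, hc1⟩) := by
      rw [hT, homDensity_twoBlock h0 h1, homDensity_twoBlock h0 h1]
      exact hlin c hc0.le
    have h4 : blockMass γ (((1 : I) : ℝ) ^ d) (((1 : I) : ℝ) ^ d) (c ^ d) ≤ S + c ^ 2 := by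
      have h5 : c ^ d ≤ c ^ 2 := pow_le_pow_of_le_one hc0.le hc1 hd
      have h6 : 0 ≤ c ^ d := by positivity
      have h7 : (1 - γ) ^ 2 ≤ 1 := by nlinarith
      rw [hSdef]
      simp only [blockMass, Set.Icc.coe_one, one_pow]
      nlinarith [mul_le_mul_of_nonneg_right h7 h6]
    have h5 : 0 ≤ blockMass γ (((1 : I) : ℝ) ^ d) (((1 : I) : ℝ) ^ d) (c ^ d) := by
      have : 0 ≤ c ^ d := by positivity
      have : 0 ≤ 1 - γ := by linarith
      simp only [blockMass, Set.Icc.coe_one, one_pow]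
      positivity
    have h6 : (T + κ * c) ^ 2 ≤ S ^ Fintype.card V + c ^ 2 * 3 ^ Fintype.card V :=
      calc (T + κ * c) ^ 2 ≤ _ := pow_le_pow_left₀ (by positivity) h3 2
        _ ≤ _ := h2
        _ ≤ (S + c ^ 2) ^ Fintype.card V := pow_le_pow_left₀ h5 h4 _
        _ ≤ _ := add_pow_le_add_mul hS0.le hS1 (by positivity) (pow_le_one₀ hc0.le hc1) _
    have h7 : c * (2 * T * κ) ≤ c * (c * 3 ^ Fintype.card V) := by
      nlinarith [sq_nonneg (κ * c)]
    exact le_of_mul_le_mul_left h7 hc0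
  have h3 : (0 : ℝ) < 3 ^ Fintype.card V := by positivity
  have h2 : 0 < T * κ / 3 ^ Fintype.card V := by positivity
  -- With this `c` the inequality `key` reads 2Tκ ≤ Tκ at best.
  have h4 := key (min 1 (T * κ / 3 ^ Fintype.card V)) (lt_min one_pos h2) (min_le_left _ _)
  have h5 := mul_le_mul_of_nonneg_right (min_le_right 1 (T * κ / 3 ^ Fintype.card V)) h3.le
  rw [div_mul_cancel₀ _ h3.ne'] at h5
  nlinarith [mul_pos hT0 hκ]

theorem eq_zero_or_one_of_le_pow {x : ℝ} (h0 : 0 ≤ x) (h1 : x ≤ 1) (hd : 2 ≤ d) (h : x ≤ x ^ d) :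
    x = 0 ∨ x = 1 := by
  have h2 : x ≤ x ^ 2 := h.trans (pow_le_pow_of_le_one h0 h1 hd)
  rcases h0.eq_or_lt with h3 | h3
  · exact Or.inl h3.symm
  · exact Or.inr (le_antisymm h1 (by nlinarith))

/-- A two-block graphon of density at least `s ^ v(H)` has mass greater than `s ^ 2`, unless it is
the indicator function of a square. -/
theorem sq_lt_blockMass [Nonempty V] (hd : 2 ≤ d) (hH : H.IsRegularOfDegree d)
    {γ : ℝ} (h0 : 0 < γ) (h1 : γ < 1) {s : ℝ} (hs : 0 < s) {a b c : I}
    (hT : s ^ Fintype.card V ≤ homDensity H (twoBlock γ a b c)) :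
    s ^ 2 < blockMass γ a b c ∨ (a = 1 ∧ b = 0 ∧ c = 0) ∨ (a = 0 ∧ b = 0 ∧ c = 1) ∨
      (a = 1 ∧ b = 1 ∧ c = 1) := by
  by_contra! hcon
  obtain ⟨hM, hc1, hc2, hc3⟩ := hcon
  have hv : Fintype.card V ≠ 0 := Fintype.card_ne_zero
  have hδ : 0 < 1 - γ := by linarith
  have hH1 := sq_homDensity_le (by omega : d ≠ 0) hH (twoBlock γ a b c)
  rw [integral_twoBlock_pow h0 h1] at hH1
  have hsT : (s ^ 2) ^ Fintype.card V ≤ homDensity H (twoBlock γ a b c) ^ 2 := by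
    rw [← pow_mul, mul_comm, pow_mul]
    exact pow_le_pow_left₀ (by positivity) hT 2
  have hpa : (a : ℝ) ^ d ≤ a := pow_le_of_le_one a.2.1 a.2.2 (by omega)
  have hpb : (b : ℝ) ^ d ≤ b := pow_le_of_le_one b.2.1 b.2.2 (by omega)
  have hpc : (c : ℝ) ^ d ≤ c := pow_le_of_le_one c.2.1 c.2.2 (by omega)
  have hMd0 : 0 ≤ blockMass γ ((a : ℝ) ^ d) ((b : ℝ) ^ d) ((c : ℝ) ^ d) := by
    have := a.2.1; have := b.2.1; have := c.2.1
    unfold blockMass; positivity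
  have hle : s ^ 2 ≤ blockMass γ ((a : ℝ) ^ d) ((b : ℝ) ^ d) ((c : ℝ) ^ d) :=
    (pow_le_pow_iff_left₀ (by positivity) hMd0 hv).1 (hsT.trans hH1)
  -- Passing to d-th powers loses no mass, although each value can only decrease; as all blocks have
  -- positive measure, every value is 0 or 1.
  have hge : blockMass γ a b c ≤ blockMass γ ((a : ℝ) ^ d) ((b : ℝ) ^ d) ((c : ℝ) ^ d) :=
    hM.trans hle
  have hwa : 0 < γ ^ 2 := by positivity
  have hwb : 0 < 2 * γ * (1 - γ) := by positivity
  have hwc : 0 < (1 - γ) ^ 2 := by positivity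
  unfold blockMass at hge
  have ia := mul_le_mul_of_nonneg_left hpa hwa.le
  have ib := mul_le_mul_of_nonneg_left hpb hwb.le
  have ic := mul_le_mul_of_nonneg_left hpc hwc.le
  have ea := eq_zero_or_one_of_le_pow a.2.1 a.2.2 hd (le_of_mul_le_mul_left (by linarith) hwa)
  have eb := eq_zero_or_one_of_le_pow b.2.1 b.2.2 hd (le_of_mul_le_mul_left (by linarith) hwb)
  have ec := eq_zero_or_one_of_le_pow c.2.1 c.2.2 hd (le_of_mul_le_mul_left (by linarith) hwc)
  -- Equality in Hölder's inequality, which is refuted below for each pattern of zeros and ones that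
  -- is not excluded by assumption.
  have hfin : blockMass γ a b c ^ Fintype.card V ≤ homDensity H (twoBlock γ a b c) ^ 2 := by
    refine (pow_le_pow_left₀ ?_ hM _).trans hsT
    have := a.2.1; have := b.2.1; have := c.2.1
    unfold blockMass; positivity
  have hpos : 0 < homDensity H (twoBlock γ a b c) := lt_of_lt_of_le (by positivity) hT
  have cast : ∀ x : I, (x : ℝ) = 0 ∨ (x : ℝ) = 1 → x = 0 ∨ x = 1 := fun x hx =>
    hx.imp (fun h => Subtype.ext h) fun h => Subtype.ext h
  have hm := blockLength_pos h0 h1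
  rcases cast a ea with rfl | rfl <;> rcases cast b eb with rfl | rfl <;>
    rcases cast c ec with rfl | rfl
  · rw [homDensity_twoBlock h0 h1] at hpos
    exact hpos.ne' (colourSum_zero_zero_zero (by omega) hH _)
  · exact hc2 rfl rfl rfl
  · rw [homDensity_twoBlock h0 h1] at hfin
    refine absurd (sq_colourSum_zero_one_zero_lt hd hH hm) (not_lt.2 (le_trans (le_of_eq ?_) hfin))
    congr 1
    simp [blockMass, blockLength, mul_assoc]
  · rw [← homDensity_twoBlock_one_sub h0 h1, ← blockMass_one_sub] at hfin
    exact absurd (sq_homDensity_one_one_zero_lt hd hH hδ (by linarith)) (not_lt.2 hfin)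
  · exact hc1 rfl rfl rfl
  · rw [homDensity_twoBlock h0 h1] at hfin
    refine absurd (sq_colourSum_one_zero_one_lt hd hH hm) (not_lt.2 (le_trans (le_of_eq ?_) hfin))
    congr 1
    simp [blockMass, blockLength]
  · exact absurd (sq_homDensity_one_one_zero_lt hd hH h0 h1) (not_lt.2 hfin)
  · exact hc3 rfl rfl rfl

end strict


/-! ### Graphons equivalent to a two-block graphon -/

theorem integral_eq_of_cutMetric_eq_zero {f g : Graphon} (h : cutMetric f g = 0) :
    ∫ z : I × I, f z.1 z.2 = ∫ z : I × I, g z.1 z.2 := by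
  have key : ∀ r : ℝ, 0 < r → |(∫ z : I × I, f z.1 z.2) - ∫ z : I × I, g z.1 z.2| ≤ r := by
    intro r hr
    obtain ⟨φ, hφ⟩ := exists_cutDist_lt_of_cutMetric_lt (h.trans_lt hr)
    have h1 := cutLE_cutDist f (g.relabel φ) Set.univ Set.univ .univ .univ
    rw [Set.univ_prod_univ, setIntegral_univ,
      integral_sub f.integrable_uncurry (g.relabel φ).integrable_uncurry] at h1
    have h2 : ∫ z : I × I, g.relabel φ z.1 z.2 = ∫ z : I × I, g z.1 z.2 :=
      φ.measurePreserving_prodMap.integral_comp φ.measurableEmbedding_prodMap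
        fun z : I × I => g z.1 z.2
    rw [h2] at h1
    exact h1.trans hφ.le
  have h2 : |(∫ z : I × I, f z.1 z.2) - ∫ z : I × I, g z.1 z.2| ≤ 0 :=
    le_of_forall_pos_le_add fun r hr => by rw [zero_add]; exact key r hr
  exact sub_eq_zero.1 (abs_nonpos_iff.1 h2)

/-- `g` is almost everywhere equal to `w` on the square of the block `β`. -/
def EqOnBlock (γ : ℝ) (g : Graphon) (β : Bool) (w : ℝ) : Prop :=
  ∀ᵐ z : I × I, block γ z.1 = β → block γ z.2 = β → g z.1 z.2 = w

theorem measurableSet_block (γ : ℝ) (β : Bool) : MeasurableSet {x : I | block γ x = β} :=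
  measurable_block (measurableSet_singleton β)

/-- The test rectangle is the square of the part of block `β` that φ sends into block `β'`, where
both graphons are constant almost everywhere. -/
theorem sq_mul_abs_sub_le_cutDist {γ : ℝ} {g : Graphon} {β β' : Bool} {w : ℝ}
    (hg : EqOnBlock γ g β w) (a b c : I) (φ : MeasurePreservingBij) :
    volume.real ({x | block γ x = β} ∩ φ.1 ⁻¹' {x | block γ x = β'}) ^ 2 *
      |w - blockValue a b c β' β'| ≤ cutDist g ((twoBlock γ a b c).relabel φ) := by
  set S := {x | block γ x = β} ∩ φ.1 ⁻¹' {x | block γ x = β'} with hS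
  have hSm : MeasurableSet S :=
    (measurableSet_block γ β).inter (φ.2.2.measurable (measurableSet_block γ β'))
  have h1 := cutLE_cutDist g ((twoBlock γ a b c).relabel φ) S S hSm hSm
  refine le_trans (le_of_eq ?_) h1
  have h2 : ∫ z in S ×ˢ S, (g z.1 z.2 - (twoBlock γ a b c).relabel φ z.1 z.2) =
      ∫ z in S ×ˢ S, (w - blockValue a b c β' β') := by
    refine setIntegral_congr_ae (hSm.prod hSm) ?_
    filter_upwards [hg] with z hz hzS
    obtain ⟨⟨h3, h4⟩, ⟨h5, h6⟩⟩ := hzS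
    rw [hz h3 h5]
    change w - twoBlock γ a b c (φ.1 z.1) (φ.1 z.2) = _
    rw [twoBlock_apply]
    change block γ (φ.1 z.1) = β' at h4
    change block γ (φ.1 z.2) = β' at h6
    rw [h4, h6]
  rw [h2, setIntegral_const, Measure.volume_eq_prod, measureReal_prod_prod, smul_eq_mul, abs_mul,
    abs_of_nonneg (mul_nonneg measureReal_nonneg measureReal_nonneg : 0 ≤ volume.real S * volume.real S),
    sq]

/-- α is a limit of the measure in which the first block overlaps its preimage under nearly optimal
relabellings; a limit is taken since the infimum need not be attained. The other overlaps are then γ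
- α, γ - α and 1 - 2γ + α, and a value known on a block must match the parameter of every block it
overlaps. -/
theorem exists_overlap {γ : ℝ} (h0 : 0 < γ) (h1 : γ < 1) {g : Graphon} {a b c : I}
    (h : cutMetric g (twoBlock γ a b c) = 0) :
    ∃ α : ℝ, 0 ≤ α ∧ α ≤ γ ∧ 2 * γ - 1 ≤ α ∧
      (∀ w, EqOnBlock γ g true w → α ^ 2 * |w - a| = 0 ∧ (γ - α) ^ 2 * |w - c| = 0) ∧
      (∀ w, EqOnBlock γ g false w →
        (γ - α) ^ 2 * |w - a| = 0 ∧ (1 - 2 * γ + α) ^ 2 * |w - c| = 0) := by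
  have hex : ∀ n : ℕ, ∃ φ : MeasurePreservingBij,
      cutDist g ((twoBlock γ a b c).relabel φ) < 1 / ((n : ℝ) + 1) := fun n =>
    exists_cutDist_lt_of_cutMetric_lt (h.trans_lt Nat.one_div_pos_of_nat)
  choose φ hφ using hex
  set A : Bool → Set I := fun β => {x | block γ x = β} with hA
  have hAm : ∀ β, MeasurableSet (A β) := measurableSet_block γ
  have hAc : A false = (A true)ᶜ := by ext x; simp [hA]
  set α : ℕ → ℝ := fun n => volume.real (A true ∩ (φ n).1 ⁻¹' A true) with hα
  have hpre : ∀ n β, volume.real ((φ n).1 ⁻¹' A β) = blockLength γ β := fun n β => by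
    rw [(φ n).2.2.measureReal_preimage (hAm β).nullMeasurableSet]
    exact volume_block_preimage h0 h1 β
  have e1 : ∀ n, volume.real (A true ∩ (φ n).1 ⁻¹' A false) = γ - α n := by
    intro n
    have h2 := measureReal_inter_add_sdiff (μ := volume) (s := A true)
      ((φ n).2.2.measurable (hAm true))
    have h3 : A true \ (φ n).1 ⁻¹' A true = A true ∩ (φ n).1 ⁻¹' A false := by
      rw [hAc]; rfl
    rw [h3, volume_block_preimage h0 h1] at h2
    change α n + _ = γ at h2
    linarith
  have e2 : ∀ n, volume.real (A false ∩ (φ n).1 ⁻¹' A true) = γ - α n := by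
    intro n
    have h2 := measureReal_inter_add_sdiff (μ := volume) (s := (φ n).1 ⁻¹' A true) (hAm true)
    have h3 : (φ n).1 ⁻¹' A true \ A true = A false ∩ (φ n).1 ⁻¹' A true := by
      rw [hAc, Set.inter_comm]; rfl
    rw [h3, hpre, Set.inter_comm] at h2
    change α n + _ = γ at h2
    linarith
  have e3 : ∀ n, volume.real (A false ∩ (φ n).1 ⁻¹' A false) = 1 - 2 * γ + α n := by
    intro n
    have h2 := measureReal_inter_add_sdiff (μ := volume) (s := A false)
      ((φ n).2.2.measurable (hAm true))
    have h3 : A false \ (φ n).1 ⁻¹' A true = A false ∩ (φ n).1 ⁻¹' A false := by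
      rw [hAc]; rfl
    rw [h3, e2, volume_block_preimage h0 h1] at h2
    change _ = 1 - γ at h2
    linarith
  have hmem : ∀ n, α n ∈ Set.Icc (0 : ℝ) 1 := fun n =>
    ⟨measureReal_nonneg, by
      have h2 : 0 ≤ γ - α n := by rw [← e1 n]; exact measureReal_nonneg
      linarith⟩
  obtain ⟨α₀, -, s, hs, hlim⟩ := isCompact_Icc.tendsto_subseq hmem
  have hzero : Tendsto (fun n => 1 / (((s n : ℕ) : ℝ) + 1)) atTop (𝓝 0) :=
    (tendsto_one_div_add_atTop_nhds_zero_nat (𝕜 := ℝ)).comp hs.tendsto_atTop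
  have hsq : ∀ (x : ℝ) (ℓ : ℝ → ℝ), Continuous ℓ →
      (∀ n, ℓ (α n) ^ 2 * |x| ≤ cutDist g ((twoBlock γ a b c).relabel (φ n))) →
      ℓ α₀ ^ 2 * |x| = 0 := by
    intro x ℓ hℓ hle
    have h2 : Tendsto (fun n => ℓ (α (s n)) ^ 2 * |x|) atTop (𝓝 (ℓ α₀ ^ 2 * |x|)) :=
      (((hℓ.tendsto α₀).comp hlim).pow 2).mul_const _
    exact le_antisymm (le_of_tendsto_of_tendsto' h2 hzero fun n => (hle _).trans (hφ _).le)
      (by positivity)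
  refine ⟨α₀, ge_of_tendsto' hlim fun n => (hmem _).1, le_of_tendsto' hlim fun n => ?_,
    ge_of_tendsto' hlim fun n => ?_, fun w hw => ⟨?_, ?_⟩, fun w hw => ⟨?_, ?_⟩⟩
  · have h2 : 0 ≤ γ - α (s n) := by rw [← e1]; exact measureReal_nonneg
    change α (s n) ≤ γ
    linarith
  · have h2 : 0 ≤ 1 - 2 * γ + α (s n) := by rw [← e3]; exact measureReal_nonneg
    change 2 * γ - 1 ≤ α (s n)
    linarith
  · exact hsq _ (fun x => x) (by fun_prop) fun n => sq_mul_abs_sub_le_cutDist (β' := true) hw a b c (φ n)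
  · refine hsq _ (fun x => γ - x) (by fun_prop) fun n => ?_
    rw [← e1 n]
    exact sq_mul_abs_sub_le_cutDist (β' := false) hw a b c (φ n)
  · refine hsq _ (fun x => γ - x) (by fun_prop) fun n => ?_
    rw [← e2 n]
    exact sq_mul_abs_sub_le_cutDist (β' := true) hw a b c (φ n)
  · refine hsq _ (fun x => 1 - 2 * γ + x) (by fun_prop) fun n => ?_
    rw [← e3 n]
    exact sq_mul_abs_sub_le_cutDist (β' := false) hw a b c (φ n)

/-- A positive overlap gives a = w. Overlap 0 is possible only for γ ≤ 1/2, and then the first block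
falls entirely into the second. -/
theorem eq_or_eq_of_eqOnBlock {γ : ℝ} (h0 : 0 < γ) (h1 : γ < 1) {g : Graphon} {a b c w : I}
    (h : cutMetric g (twoBlock γ a b c) = 0) (hw : EqOnBlock γ g true w) :
    a = w ∨ (c = w ∧ γ ≤ 1 / 2) := by
  obtain ⟨α, hα0, hαγ, hα, hh, -⟩ := exists_overlap h0 h1 h
  obtain ⟨e1, e2⟩ := hh w hw
  rcases mul_eq_zero.1 e1 with e1 | e1
  · have e1 : α = 0 := by simpa using e1
    rw [e1] at e2 hα
    rcases mul_eq_zero.1 e2 with e2 | e2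
    · simp at e2; exact absurd e2 h0.ne'
    · exact Or.inr ⟨Subtype.ext (sub_eq_zero.1 (abs_eq_zero.1 e2)).symm, by linarith⟩
  · exact Or.inl (Subtype.ext (sub_eq_zero.1 (abs_eq_zero.1 e1)).symm)

/-- Blocks with the different values 1 and 0 cannot overlap the same target block, so the overlap is
all or nothing; a complete exchange requires equal lengths. -/
theorem values_of_eqOnBlock {γ : ℝ} (h0 : 0 < γ) (h1 : γ < 1) {g : Graphon} {a b c : I}
    (h : cutMetric g (twoBlock γ a b c) = 0) (hw1 : EqOnBlock γ g true 1)
    (hw0 : EqOnBlock γ g false 0) :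
    (a = 1 ∧ c = 0) ∨ (a = 0 ∧ c = 1 ∧ γ = 1 / 2) := by
  obtain ⟨α, hα0, hαγ, hα, hh, hh'⟩ := exists_overlap h0 h1 h
  obtain ⟨e1, e2⟩ := hh 1 hw1
  obtain ⟨e3, e4⟩ := hh' 0 hw0
  simp only [mul_eq_zero, abs_eq_zero, ne_eq, OfNat.ofNat_ne_zero, not_false_eq_true,
    pow_eq_zero_iff, zero_sub, neg_eq_zero] at e1 e2 e3 e4
  have ext1 : ∀ x : I, (1 : ℝ) - x = 0 → x = 1 := fun x hx => Subtype.ext (by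
    rw [Set.Icc.coe_one]; linarith)
  have ext0 : ∀ x : I, (x : ℝ) = 0 → x = 0 := fun x hx => Subtype.ext hx
  have n1 : ∀ x : I, (1 : ℝ) - x = 0 → (x : ℝ) = 0 → False := fun x hx hx' => by linarith
  rcases e1 with e1 | e1
  · refine Or.inr ?_
    rw [e1] at e2 e3 e4
    have ha : (a : ℝ) = 0 := e3.resolve_left (by linarith)
    have hc : (1 : ℝ) - c = 0 := e2.resolve_left (by linarith)
    refine ⟨ext0 a ha, ext1 c hc, ?_⟩
    rcases e4 with e4 | e4
    · linarith
    · exact (n1 c hc e4).elim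
  · refine Or.inl ⟨ext1 a e1, ?_⟩
    have e5 : γ - α = 0 := e3.resolve_right (fun h' => n1 a e1 h')
    exact ext0 c (e4.resolve_left (by linarith))

/-- As `c` is an extreme value, `g` - `c` has constant sign, so the cut distance controls its L¹
norm on the preimage of the second square. Markov's inequality then makes `g` close to `c` on almost
the full measure, and the tolerance tends to 0. -/
theorem sq_le_volume_eq {γ : ℝ} (h0 : 0 < γ) (h1 : γ < 1) {g : Graphon} {a b c : I}
    (h : cutMetric g (twoBlock γ a b c) = 0) (hc : c = 0 ∨ c = 1) :
    (1 - γ) ^ 2 ≤ volume.real {z : I × I | g z.1 z.2 = c} := by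
  have hkm : Measurable fun z : I × I => |g z.1 z.2 - c| :=
    (g.measurable_uncurry.sub_const _).abs
  have key : ∀ r : ℝ, 0 < r → ∃ U : Set (I × I), MeasurableSet U ∧
      volume.real U = (1 - γ) ^ 2 ∧ ∫ z in U, |g z.1 z.2 - c| ≤ r := by
    intro r hr
    obtain ⟨φ, hφ⟩ := exists_cutDist_lt_of_cutMetric_lt (h.trans_lt hr)
    set S := φ.1 ⁻¹' {x | block γ x = false} with hS
    have hSm : MeasurableSet S := φ.2.2.measurable (measurableSet_block γ false)
    have hSv : volume.real S = 1 - γ := by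
      rw [hS, φ.2.2.measureReal_preimage (measurableSet_block γ false).nullMeasurableSet,
        volume_block_preimage h0 h1]
      rfl
    refine ⟨S ×ˢ S, hSm.prod hSm, ?_, ?_⟩
    · rw [Measure.volume_eq_prod, measureReal_prod_prod, hSv, sq]
    · have h2 := cutLE_cutDist g ((twoBlock γ a b c).relabel φ) S S hSm hSm
      have h3 : ∫ z in S ×ˢ S, (g z.1 z.2 - (twoBlock γ a b c).relabel φ z.1 z.2) =
          ∫ z in S ×ˢ S, (g z.1 z.2 - c) := by
        refine setIntegral_congr_fun (hSm.prod hSm) fun z hz => ?_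
        change g z.1 z.2 - twoBlock γ a b c (φ.1 z.1) (φ.1 z.2) = _
        have h4 : block γ (φ.1 z.1) = false := hz.1
        have h5 : block γ (φ.1 z.2) = false := hz.2
        rw [twoBlock_apply, h4, h5]
        rfl
      rw [h3] at h2
      refine le_trans ?_ (h2.trans hφ.le)
      rcases hc with rfl | rfl
      · refine le_trans (le_of_eq ?_) (le_abs_self _)
        refine setIntegral_congr_fun (hSm.prod hSm) fun z _ => ?_
        simp [abs_of_nonneg (g.nonneg _ _)]
      · refine le_trans (le_of_eq ?_) (neg_le_abs _)
        rw [← integral_neg]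
        refine setIntegral_congr_fun (hSm.prod hSm) fun z _ => ?_
        exact abs_of_nonpos (sub_nonpos.2 (g.le_one _ _))
  have hη : ∀ η : ℝ, 0 < η →
      (1 - γ) ^ 2 ≤ volume.real {z : I × I | |g z.1 z.2 - c| < η} := by
    intro η hη
    refine le_of_forall_pos_le_add fun r hr => ?_
    obtain ⟨U, hUm, hU, hint⟩ := key (η * r) (mul_pos hη hr)
    have hki : IntegrableOn (fun z : I × I => |g z.1 z.2 - c|) U :=
      (g.integrable_uncurry.sub (integrable_const _)).abs.integrableOn
    have h2 := mul_meas_ge_le_integral_of_nonneg (μ := volume.restrict U)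
      (f := fun z : I × I => |g z.1 z.2 - c|) (.of_forall fun z => abs_nonneg _) hki η
    have h3 : (volume.restrict U).real {z : I × I | η ≤ |g z.1 z.2 - c|} ≤ r :=
      le_of_mul_le_mul_left (h2.trans hint) hη
    rw [measureReal_restrict_apply (measurableSet_le measurable_const hkm)] at h3
    have h4 : U ⊆ {z : I × I | |g z.1 z.2 - c| < η} ∪ {z : I × I | η ≤ |g z.1 z.2 - c|} ∩ U := by
      intro z hz
      rcases lt_or_ge (|g z.1 z.2 - c|) η with h5 | h5
      · exact Or.inl h5
      · exact Or.inr ⟨h5, hz⟩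
    calc (1 - γ) ^ 2 = volume.real U := hU.symm
      _ ≤ _ := measureReal_mono h4
      _ ≤ _ := measureReal_union_le _ _
      _ ≤ _ := add_le_add le_rfl h3
  have hanti : Antitone fun n : ℕ => {z : I × I | |g z.1 z.2 - c| < 1 / ((n : ℝ) + 1)} := by
    intro n m hnm z hz
    change |g z.1 z.2 - c| < _ at hz
    exact lt_of_lt_of_le hz (Nat.one_div_le_one_div hnm)
  have hlim := tendsto_measure_iInter_atTop (μ := (volume : Measure (I × I)))
    (fun n : ℕ => (measurableSet_lt hkm (measurable_const (a := 1 / ((n : ℝ) + 1)))).nullMeasurableSet)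
    hanti ⟨0, measure_ne_top _ _⟩
  have hInter : ⋂ n : ℕ, {z : I × I | |g z.1 z.2 - c| < 1 / ((n : ℝ) + 1)} =
      {z : I × I | g z.1 z.2 = c} := by
    ext z
    simp only [Set.mem_iInter]
    constructor
    · intro hz
      have h2 : |g z.1 z.2 - c| ≤ 0 :=
        ge_of_tendsto' (tendsto_one_div_add_atTop_nhds_zero_nat (𝕜 := ℝ)) fun n => (hz n).le
      exact sub_eq_zero.1 (abs_nonpos_iff.1 h2)
    · intro hz n
      change |g z.1 z.2 - c| < _
      rw [show g z.1 z.2 = c from hz, sub_self, abs_zero]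
      exact Nat.one_div_pos_of_nat
  rw [hInter] at hlim
  have hlim' := (ENNReal.tendsto_toReal (measure_ne_top _ _)).comp hlim
  exact ge_of_tendsto' hlim' fun n => hη _ Nat.one_div_pos_of_nat


/-! ### Entropy estimates -/

section binary

variable {p : ℝ}

theorem binKL_one (p : ℝ) : binKL p 1 = -Real.log p := by simp [binKL]

theorem binKL_zero (p : ℝ) : binKL p 0 = -Real.log (1 - p) := by simp [binKL]

theorem neg_log_one_sub_le (h2 : p ≤ 1 / 2) : -Real.log (1 - p) ≤ Real.log 2 := by
  rw [← Real.log_inv]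
  refine Real.log_le_log (inv_pos.2 (by linarith)) ?_
  rw [inv_le_comm₀ (by linarith) (by norm_num)]
  linarith

/-- Binary entropy is at most log 2, so the cost of the value `u` is u log(1/p) up to an error
independent of `p`. -/
theorem sub_log_two_le_binKL (h0 : 0 < p) (h1 : p < 1) {u : ℝ} (hu : u ∈ Set.Icc (0 : ℝ) 1) :
    u * -Real.log p - Real.log 2 ≤ binKL p u := by
  have h2 : Real.binEntropy u ≤ Real.log 2 := Real.binEntropy_le_log_two
  have h3 := mul_nonneg (sub_nonneg.2 hu.2) (neg_nonneg.2 (Real.log_nonpos (by linarith)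
    (by linarith : 1 - p ≤ 1)))
  unfold binKL
  linarith

theorem binKL_le (h0 : 0 < p) (h1 : p < 1) {u : ℝ} (hu : u ∈ Set.Icc (0 : ℝ) 1) :
    binKL p u ≤ -Real.log p - Real.log (1 - p) := by
  have h2 : 0 ≤ Real.binEntropy u := Real.binEntropy_nonneg hu.1 hu.2
  have h3 := mul_nonneg hu.1 (neg_nonneg.2 (Real.log_nonpos (by linarith)
    (by linarith : 1 - p ≤ 1)))
  have h4 := mul_nonneg (sub_nonneg.2 hu.2) (neg_nonneg.2 (Real.log_nonpos h0.le h1.le))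
  unfold binKL
  linarith

theorem binKL_convex {u s : ℝ} (hu : u ∈ Set.Icc (0 : ℝ) 1) (hs : s ∈ Set.Icc (0 : ℝ) 1) :
    binKL p (u + s * (1 - u)) ≤ (1 - s) * binKL p u + s * binKL p 1 := by
  have h := Real.strictConcave_binEntropy.concaveOn.2 hu (Set.right_mem_Icc.2 zero_le_one)
    (sub_nonneg.2 hs.2) hs.1 (by ring)
  simp only [smul_eq_mul] at h
  rw [show (1 - s) * u + s * 1 = u + s * (1 - u) by ring] at h
  unfold binKL
  linarith

theorem binKL_min_le (h0 : 0 < p) {u v : ℝ} (hu : u ∈ Set.Icc (0 : ℝ) 1) (hv1 : v < 1)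
    (hpv : p ≤ v) : binKL p (min u v) ≤ binKL p u := by
  rcases le_total u v with h | h
  · rw [min_eq_left h]
  · rw [min_eq_right h]
    have h2 := binKL_tangent p (h0.trans_le hpv) hv1 hu
    have h3 := mul_nonneg (binKLSlope_nonneg h0 hpv hv1) (sub_nonneg.2 h)
    linarith

/-- Binary entropy has infinite slope at 1, so lowering the value 1 by ε saves at least ε log(1/ε),
more than any linear cost. -/
theorem binKL_one_sub_le (h0 : 0 < p) (h2 : p ≤ 1 / 2) {ε : ℝ} (hε0 : 0 < ε) (hε1 : ε < 1) :
    binKL p (1 - ε) ≤ binKL p 1 - ε * -Real.log ε := by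
  have h3 : Real.log p ≤ Real.log (1 - p) := Real.log_le_log h0 (by linarith)
  have h4 : (1 - ε) * Real.log (1 - ε) ≤ 0 :=
    mul_nonpos_of_nonneg_of_nonpos (by linarith) (Real.log_nonpos (by linarith) (by linarith))
  have h5 := mul_le_mul_of_nonneg_left h3 hε0.le
  rw [binKL_one]
  unfold binKL
  rw [Real.binEntropy, Real.log_inv, Real.log_inv]
  rw [sub_sub_cancel]
  linarith

end binary

/-! ### Entropy against mass -/

/-- The measure of the set where a graphon is equal to `1`. -/
noncomputable def oneMass (W : Graphon) : ℝ := volume.real {z : I × I | W z.1 z.2 = 1}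

theorem measurableSet_eq_const (W : Graphon) (w : ℝ) : MeasurableSet {z : I × I | W z.1 z.2 = w} :=
  W.measurable_uncurry (measurableSet_singleton w)

theorem integral_indicator_one (W : Graphon) :
    ∫ z : I × I, {z : I × I | W z.1 z.2 = 1}.indicator (fun _ => (1 : ℝ)) z = oneMass W := by
  rw [integral_indicator (measurableSet_eq_const W 1), setIntegral_const, smul_eq_mul, mul_one]
  rfl

theorem integrable_indicator_one (W : Graphon) :
    Integrable fun z : I × I => {z : I × I | W z.1 z.2 = 1}.indicator (fun _ => (1 : ℝ)) z :=
  (integrable_const (1 : ℝ)).indicator (measurableSet_eq_const W 1)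

theorem integrable_excess (W g : Graphon) : Integrable fun z : I × I =>
    g z.1 z.2 - {z : I × I | W z.1 z.2 = 1}.indicator (fun _ => (1 : ℝ)) z :=
  g.integrable_uncurry.sub (integrable_indicator_one W)

theorem integral_excess (W g : Graphon) (L r : ℝ) : ∫ z : I × I,
    (L * (g z.1 z.2 - {z : I × I | W z.1 z.2 = 1}.indicator (fun _ => (1 : ℝ)) z) + r) =
      L * ((∫ z : I × I, g z.1 z.2) - oneMass W) + r := by
  rw [integral_add ((integrable_excess W g).const_mul L) (integrable_const r), integral_const_mul,
    integral_sub g.integrable_uncurry (integrable_indicator_one W), integral_indicator_one]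
  simp

section compare

variable {p : ℝ} {W : Graphon}

theorem le_entropy (h0 : 0 < p) (h1 : p < 1) (hW : ∀ x y, W x y = 0 ∨ W x y = 1 ∨ W x y = p)
    (g : Graphon) :
    1 / 2 * ENNReal.ofReal (-Real.log p * ((∫ z : I × I, g z.1 z.2) - oneMass W) - Real.log 2) ≤
      entropy W g := by
  have hlog : 0 ≤ -Real.log p := neg_nonneg.2 (Real.log_nonpos h0.le h1.le)
  have hlog2 : 0 ≤ Real.log 2 := Real.log_nonneg (by norm_num)
  set k : I × I → ℝ := fun z => -Real.log p *
    (g z.1 z.2 - {z : I × I | W z.1 z.2 = 1}.indicator (fun _ => (1 : ℝ)) z) - Real.log 2 with hk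
  have hki : Integrable k :=
    ((integrable_excess W g).const_mul _).sub (integrable_const _)
  have hint : ∫ z, k z = -Real.log p * ((∫ z : I × I, g z.1 z.2) - oneMass W) - Real.log 2 :=
    integral_excess W g (-Real.log p) (-Real.log 2)
  rw [← hint]
  refine mul_le_mul_right ?_ _
  refine (ofReal_integral_le_lintegral hki).trans (lintegral_mono fun z => ?_)
  have hg := g.mem_Icc_toFun z.1 z.2
  rcases hW z.1 z.2 with h | h | h
  · rw [h, relEntropy_zero_left]
    split_ifs with h3
    · rw [hk, nonpos_iff_eq_zero, ENNReal.ofReal_eq_zero]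
      have : z ∉ {z : I × I | W z.1 z.2 = 1} := fun h4 => by
        rw [show W z.1 z.2 = 1 from h4] at h; norm_num at h
      simp only [Set.indicator_of_notMem this, h3]
      linarith
    · exact le_top
  · rw [h, relEntropy_one_left]
    split_ifs with h3
    · rw [hk, nonpos_iff_eq_zero, ENNReal.ofReal_eq_zero]
      have : z ∈ {z : I × I | W z.1 z.2 = 1} := h
      simp only [Set.indicator_of_mem this, h3]
      linarith
    · exact le_top
  · rw [h, relEntropy_eq_ofReal h0 h1]
    refine ENNReal.ofReal_le_ofReal ?_
    have : z ∉ {z : I × I | W z.1 z.2 = 1} := fun h4 => by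
      rw [show W z.1 z.2 = 1 from h4] at h; exact h1.ne h.symm
    simp only [hk, Set.indicator_of_notMem this]
    have := sub_log_two_le_binKL h0 h1 hg
    linarith

/-- On {W = p} the value 1 costs log(1/p) and the value 0 at most log 2; elsewhere the cost is zero.
-/
theorem entropy_le (h0 : 0 < p) (h2 : p ≤ 1 / 2)
    (hW : ∀ x y, W x y = 0 ∨ W x y = 1 ∨ W x y = p) {g : Graphon}
    (hg : ∀ x y, g x y = 0 ∨ g x y = 1)
    (hgW : ∀ x y, W x y = 0 ∨ W x y = 1 → g x y = W x y) :
    entropy W g ≤ 1 / 2 *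
      ENNReal.ofReal (-Real.log p * ((∫ z : I × I, g z.1 z.2) - oneMass W) + Real.log 2) := by
  have h1 : p < 1 := by linarith
  have hlog : 0 ≤ -Real.log p := neg_nonneg.2 (Real.log_nonpos h0.le h1.le)
  have hlog2 : 0 ≤ Real.log 2 := Real.log_nonneg (by norm_num)
  set k : I × I → ℝ := fun z => -Real.log p *
    (g z.1 z.2 - {z : I × I | W z.1 z.2 = 1}.indicator (fun _ => (1 : ℝ)) z) + Real.log 2 with hk
  have hki : Integrable k :=
    ((integrable_excess W g).const_mul _).add (integrable_const _)
  have hint : ∫ z, k z = -Real.log p * ((∫ z : I × I, g z.1 z.2) - oneMass W) + Real.log 2 :=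
    integral_excess W g _ _
  have hpt : ∀ z : I × I, 0 ≤ k z ∧ relEntropy (W z.1 z.2) (g z.1 z.2) ≤ ENNReal.ofReal (k z) := by
    intro z
    rcases hW z.1 z.2 with h | h | h
    · have h3 := hgW _ _ (Or.inl h)
      have : z ∉ {z : I × I | W z.1 z.2 = 1} := fun h4 => by
        rw [show W z.1 z.2 = 1 from h4] at h; norm_num at h
      simp only [hk, Set.indicator_of_notMem this, h3, h, relEntropy_zero_left, if_true]
      exact ⟨by linarith, bot_le⟩
    · have h3 := hgW _ _ (Or.inr h)
      have : z ∈ {z : I × I | W z.1 z.2 = 1} := h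
      simp only [hk, Set.indicator_of_mem this, h3, h, relEntropy_one_left, if_true]
      exact ⟨by linarith, bot_le⟩
    · have : z ∉ {z : I × I | W z.1 z.2 = 1} := fun h4 => by
        rw [show W z.1 z.2 = 1 from h4] at h; exact h1.ne h.symm
      rw [h, relEntropy_eq_ofReal h0 h1]
      simp only [hk, Set.indicator_of_notMem this]
      rcases hg z.1 z.2 with h3 | h3
      · rw [h3, binKL_zero]
        have := neg_log_one_sub_le h2
        exact ⟨by linarith, ENNReal.ofReal_le_ofReal (by linarith)⟩
      · rw [h3, binKL_one]
        exact ⟨by linarith, ENNReal.ofReal_le_ofReal (by linarith)⟩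
  rw [← hint, ofReal_integral_eq_lintegral_ofReal hki (.of_forall fun z => (hpt z).1)]
  exact mul_le_mul_right (lintegral_mono fun z => (hpt z).2) _

theorem half_mul_lt_half_mul {x y : ℝ≥0∞} (h : x < y) : 1 / 2 * x < 1 / 2 * y :=
  ENNReal.mul_lt_mul_right (by simp) (by simp) h

/-- For small `p`, among graphons of finite entropy those of smaller mass have smaller entropy. -/
theorem entropy_lt_entropy_of_integral (h0 : 0 < p) (h2 : p ≤ 1 / 2)
    (hW : ∀ x y, W x y = 0 ∨ W x y = 1 ∨ W x y = p) {g g' : Graphon}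
    (hg' : ∀ x y, g' x y = 0 ∨ g' x y = 1)
    (hgW : ∀ x y, W x y = 0 ∨ W x y = 1 → g' x y = W x y)
    (hlt : -Real.log p * (∫ z : I × I, g' z.1 z.2) + 2 * Real.log 2 <
      -Real.log p * ∫ z : I × I, g z.1 z.2) : entropy W g' < entropy W g := by
  refine (entropy_le h0 h2 hW hg' hgW).trans_lt
    (lt_of_lt_of_le (half_mul_lt_half_mul ?_) (le_entropy h0 (by linarith) hW g))
  have hlog : 0 ≤ -Real.log p := neg_nonneg.2 (Real.log_nonpos h0.le (by linarith))
  have hlog2 : 0 ≤ Real.log 2 := Real.log_nonneg (by norm_num)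
  have h3 : oneMass W ≤ ∫ z : I × I, g' z.1 z.2 := by
    rw [← integral_indicator_one W]
    refine integral_mono (integrable_indicator_one W) g'.integrable_uncurry fun z => ?_
    by_cases hz : z ∈ {z : I × I | W z.1 z.2 = 1}
    · change Set.indicator _ _ z ≤ _
      rw [Set.indicator_of_mem hz, hgW _ _ (Or.inr hz), show W z.1 z.2 = 1 from hz]
    · change Set.indicator _ _ z ≤ _
      rw [Set.indicator_of_notMem hz]
      exact g'.nonneg _ _
  have h4 := mul_nonneg hlog (sub_nonneg.2 h3)
  rw [ENNReal.ofReal_lt_ofReal_iff_of_nonneg (by linarith)]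
  linarith

end compare


/-! ### Lowering the entropy by modifying a graphon pointwise -/

/-- The pointwise combination of two graphons. -/
def combine (F : ℝ → ℝ → ℝ) (hF : Measurable (Function.uncurry F))
    (hF01 : ∀ u ∈ Set.Icc (0 : ℝ) 1, ∀ v ∈ Set.Icc (0 : ℝ) 1, F u v ∈ Set.Icc (0 : ℝ) 1)
    (f g : Graphon) : Graphon where
  toFun x y := F (f x y) (g x y)
  measurable_toFun := hF.comp (f.measurable_uncurry.prodMk g.measurable_uncurry)
  symm_toFun x y := by rw [f.symm_toFun, g.symm_toFun]
  mem_Icc_toFun x y := hF01 _ (f.mem_Icc_toFun x y) _ (g.mem_Icc_toFun x y)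

theorem measurable_uncurry_max : Measurable (Function.uncurry (max : ℝ → ℝ → ℝ)) :=
  measurable_fst.max measurable_snd

theorem max_mem_Icc (u : ℝ) (hu : u ∈ Set.Icc (0 : ℝ) 1) (v : ℝ) (hv : v ∈ Set.Icc (0 : ℝ) 1) :
    max u v ∈ Set.Icc (0 : ℝ) 1 :=
  ⟨le_max_of_le_left hu.1, max_le hu.2 hv.2⟩

/-- The pointwise maximum of two graphons. -/
noncomputable def sup (f g : Graphon) : Graphon :=
  combine max measurable_uncurry_max max_mem_Icc f g

theorem sup_apply (f g : Graphon) (x y : I) : sup f g x y = max (f x y) (g x y) := rfl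

theorem homDensity_mono {V : Type*} [Fintype V] (H : SimpleGraph V) [Fintype H.edgeSet]
    {f g : Graphon} (h : ∀ x y, f x y ≤ g x y) : homDensity H f ≤ homDensity H g := by
  rw [homDensity_eq, homDensity_eq]
  refine integral_mono (integrable_prod_edgeWeight f _) (integrable_prod_edgeWeight g _) fun x =>
    Finset.prod_le_prod (fun e _ => (edgeWeight_mem f x e).1) fun e _ => ?_
  induction e with
  | _ i j => exact h _ _

theorem homDensity_le_one {V : Type*} [Fintype V] (H : SimpleGraph V) [Fintype H.edgeSet]
    (f : Graphon) : homDensity H f ≤ 1 := by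
  rw [homDensity_eq]
  calc _ ≤ ∫ _x : V → I, (1 : ℝ) := integral_mono (integrable_prod_edgeWeight f _)
        (integrable_const _) fun x => (prod_edgeWeight_mem f x _).2
    _ = 1 := by simp

section

variable {p : ℝ} {W : Graphon}

theorem relEntropy_self (h0 : 0 < p) (h1 : p < 1) (hW : ∀ x y, W x y = 0 ∨ W x y = 1 ∨ W x y = p)
    (x y : I) : relEntropy (W x y) (W x y) = 0 := by
  rcases hW x y with h | h | h
  · rw [h, relEntropy_zero_left, if_pos rfl]
  · rw [h, relEntropy_one_left, if_pos rfl]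
  · rw [h, relEntropy_eq_ofReal h0 h1, binKL_self h0 h1, ENNReal.ofReal_zero]

theorem relEntropy_sup_le (h0 : 0 < p) (h1 : p < 1)
    (hW : ∀ x y, W x y = 0 ∨ W x y = 1 ∨ W x y = p) (g : Graphon) (x y : I) :
    relEntropy (W x y) (sup g W x y) ≤ relEntropy (W x y) (g x y) := by
  rw [sup_apply]
  rcases le_total (g x y) (W x y) with h | h
  · rw [max_eq_right h, relEntropy_self h0 h1 hW]
    exact bot_le
  · rw [max_eq_left h]

theorem entropy_sup_le (h0 : 0 < p) (h1 : p < 1)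
    (hW : ∀ x y, W x y = 0 ∨ W x y = 1 ∨ W x y = p) (g : Graphon) :
    entropy W (sup g W) ≤ entropy W g :=
  mul_le_mul_right (lintegral_mono fun z : I × I => relEntropy_sup_le h0 h1 hW g z.1 z.2) _

/-- Raising a graphon to the reference strictly lowers a finite entropy if the graphon vanishes
on a nonnegligible part of `{W = p}`. -/
theorem entropy_sup_lt (h0 : 0 < p) (h1 : p < 1)
    (hW : ∀ x y, W x y = 0 ∨ W x y = 1 ∨ W x y = p) {g : Graphon} (hfin : entropy W g ≠ ⊤)
    (hvol : volume {z : I × I | g z.1 z.2 = 0 ∧ W z.1 z.2 = p} ≠ 0) :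
    entropy W (sup g W) < entropy W g := by
  refine half_mul_lt_half_mul ?_
  have hfin' : ∫⁻ z : I × I, relEntropy (W z.1 z.2) (sup g W z.1 z.2) ≠ ⊤ := by
    intro hcon
    have h3 := entropy_sup_le h0 h1 hW g
    rw [entropy, hcon, ENNReal.mul_top (by simp), top_le_iff] at h3
    exact hfin h3
  refine lintegral_strict_mono_of_ae_le_of_frequently_ae_lt (measurable_relEntropy_comp W g).aemeasurable
    hfin' (.of_forall fun z => relEntropy_sup_le h0 h1 hW g z.1 z.2) ?_
  refine (frequently_ae_mem_iff.2 hvol).mono ?_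
  rintro z ⟨hz1, hz2⟩
  rw [sup_apply, hz1, max_eq_right (W.nonneg _ _), relEntropy_self h0 h1 hW, hz2,
    relEntropy_eq_ofReal h0 h1, binKL_zero]
  exact (ENNReal.ofReal_pos.2 (neg_pos.2 (Real.log_neg (by linarith) (by linarith)))).ne

/-- The entropy density relative to a reference with values in `{1, p}`. -/
noncomputable def densityKL (p : ℝ) (W f : Graphon) (z : I × I) : ℝ :=
  {z : I × I | W z.1 z.2 = p}.indicator (fun z => binKL p (f z.1 z.2)) z

theorem densityKL_nonneg (h0 : 0 < p) (h1 : p < 1) (f : Graphon) (z : I × I) :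
    0 ≤ densityKL p W f z :=
  Set.indicator_nonneg (fun _ _ => binKL_nonneg h0 h1 (f.mem_Icc_toFun _ _)) _

theorem integrable_densityKL (h0 : 0 < p) (h1 : p < 1) (f : Graphon) :
    Integrable (densityKL p W f) := by
  refine Integrable.of_bound (((continuous_binKL p).measurable.comp f.measurable_uncurry).indicator
    (measurableSet_eq_const W p)).aestronglyMeasurable (-Real.log p - Real.log (1 - p))
    (.of_forall fun z => ?_)
  rw [Real.norm_eq_abs, abs_of_nonneg (densityKL_nonneg h0 h1 f z)]
  have h3 := binKL_le h0 h1 (f.mem_Icc_toFun z.1 z.2)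
  have h4 := binKL_nonneg h0 h1 (f.mem_Icc_toFun z.1 z.2)
  exact Set.indicator_le' (fun z _ => binKL_le h0 h1 (f.mem_Icc_toFun z.1 z.2))
    (fun _ _ => h4.trans h3) z

theorem entropy_eq_densityKL (h0 : 0 < p) (h1 : p < 1) (hW : ∀ x y, W x y = 1 ∨ W x y = p)
    {f : Graphon} (hf : ∀ x y, W x y = 1 → f x y = 1) :
    entropy W f = 1 / 2 * ENNReal.ofReal (∫ z, densityKL p W f z) := by
  rw [entropy, ofReal_integral_eq_lintegral_ofReal (integrable_densityKL h0 h1 f)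
    (.of_forall fun z => densityKL_nonneg h0 h1 f z)]
  congr 1
  refine lintegral_congr fun z => ?_
  rcases hW z.1 z.2 with h | h
  · have h3 : z ∉ {z : I × I | W z.1 z.2 = p} := fun h4 => by
      rw [show W z.1 z.2 = p from h4] at h; exact h1.ne h
    rw [densityKL, Set.indicator_of_notMem h3, h, hf _ _ h, relEntropy_one_left]
    simp
  · have h3 : z ∈ {z : I × I | W z.1 z.2 = p} := h
    rw [densityKL, Set.indicator_of_mem h3, h, relEntropy_eq_ofReal h0 h1]

end

/-! ### Compensating a loss of density -/

/-- The lower bound `p` on all factors keeps the gain of one factor from being annihilated by the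
others; hence the power of `p`. -/
theorem prod_add_mul_one_sub_ge {ι : Type*} [DecidableEq ι] (E : Finset ι) (x : ι → ℝ)
    {p s : ℝ} (hp : 0 ≤ p) (hs : 0 ≤ s) (hx : ∀ e, p ≤ x e) (hx1 : ∀ e, x e ≤ 1) :
    ∏ e ∈ E, x e + s * p ^ E.card * (1 - ∏ e ∈ E, x e) ≤ ∏ e ∈ E, (x e + s * (1 - x e)) := by
  induction E using Finset.induction_on with
  | empty => simp
  | insert e E he ih =>
    rw [Finset.prod_insert he, Finset.prod_insert he, Finset.card_insert_of_notMem he, pow_succ]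
    set P := ∏ e ∈ E, x e with hP
    have hP0 : 0 ≤ P := Finset.prod_nonneg fun e _ => hp.trans (hx e)
    have hP1 : P ≤ 1 := Finset.prod_le_one (fun e _ => hp.trans (hx e)) fun e _ => hx1 e
    have hx0 : 0 ≤ x e := hp.trans (hx e)
    have hxe : 0 ≤ 1 - x e := sub_nonneg.2 (hx1 e)
    have hp1 : p ≤ 1 := (hx e).trans (hx1 e)
    set q := p ^ E.card with hq
    have hq0 : 0 ≤ q := by positivity
    have hq1 : q * p ≤ 1 := mul_le_one₀ (pow_le_one₀ hp hp1) hp hp1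
    have h1 := mul_le_mul_of_nonneg_left ih (add_nonneg hx0 (mul_nonneg hs hxe))
    refine le_trans ?_ h1
    have h2 : 0 ≤ s * q * (1 - P) * (x e - p) :=
      mul_nonneg (mul_nonneg (mul_nonneg hs hq0) (sub_nonneg.2 hP1)) (sub_nonneg.2 (hx e))
    have h3 : 0 ≤ s * (1 - x e) * P * (1 - q * p) :=
      mul_nonneg (mul_nonneg (mul_nonneg hs hxe) hP0) (sub_nonneg.2 hq1)
    have h4 : 0 ≤ s * (1 - x e) * (s * q * (1 - P)) :=
      mul_nonneg (mul_nonneg hs hxe) (mul_nonneg (mul_nonneg hs hq0) (sub_nonneg.2 hP1))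
    nlinarith

theorem measurable_uncurry_towards_one (s : ℝ) :
    Measurable (Function.uncurry fun u _v : ℝ => u + s * (1 - u)) := by
  unfold Function.uncurry; fun_prop

/-- The graphon `g + s (1 - g)`. -/
noncomputable def towardsOne (s : I) (g : Graphon) : Graphon :=
  combine (fun u _ => u + s * (1 - u)) (measurable_uncurry_towards_one s)
    (fun u hu _ _ => ⟨add_nonneg hu.1 (mul_nonneg s.2.1 (sub_nonneg.2 hu.2)), by
      nlinarith [hu.2, s.2.2, mul_nonneg (sub_nonneg.2 s.2.2) (sub_nonneg.2 hu.2)]⟩) g g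

theorem towardsOne_apply (s : I) (g : Graphon) (x y : I) :
    towardsOne s g x y = g x y + s * (1 - g x y) := rfl

theorem homDensity_towardsOne {V : Type*} [Fintype V] [DecidableEq V] (H : SimpleGraph V)
    [Fintype H.edgeSet] {p : ℝ} (hp : 0 ≤ p) (s : I) {g : Graphon} (hg : ∀ x y, p ≤ g x y) :
    homDensity H g + s * p ^ H.edgeFinset.card * (1 - homDensity H g) ≤
      homDensity H (towardsOne s g) := by
  set k : ℝ := s * p ^ H.edgeFinset.card with hk
  have h1 : ∀ x : V → I, (1 - k) * ∏ e ∈ H.edgeFinset, edgeWeight g x e + k ≤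
      ∏ e ∈ H.edgeFinset, edgeWeight (towardsOne s g) x e := by
    intro x
    have h2 := prod_add_mul_one_sub_ge H.edgeFinset (edgeWeight g x) hp s.2.1 (fun e => by
      induction e with
      | _ i j => exact hg _ _) fun e => (edgeWeight_mem g x e).2
    refine le_trans (le_of_eq ?_) (h2.trans (le_of_eq (Finset.prod_congr rfl fun e _ => ?_)))
    · rw [← hk]; ring
    · induction e with
      | _ i j => rfl
  have hi := integrable_prod_edgeWeight g H.edgeFinset
  have h2 := integral_mono ((hi.const_mul (1 - k)).add (integrable_const k))
    (integrable_prod_edgeWeight (towardsOne s g) H.edgeFinset) h1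
  refine le_trans (le_of_eq ?_) h2
  refine Eq.trans ?_ (integral_add (hi.const_mul (1 - k)) (integrable_const k)).symm
  rw [integral_const_mul, ← homDensity_eq]
  simp
  ring


theorem measurable_uncurry_truncate (r : ℝ) :
    Measurable (Function.uncurry fun w u : ℝ => max w (min u r)) :=
  measurable_fst.max (measurable_snd.min measurable_const)

/-- The graphon `max W (min g r)`. -/
noncomputable def truncate (W g : Graphon) (r : I) : Graphon :=
  combine (fun w u => max w (min u r)) (measurable_uncurry_truncate r)
    (fun _ hw _ hu => max_mem_Icc _ hw _ ⟨le_min hu.1 r.2.1, (min_le_right _ _).trans r.2.2⟩) W g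

theorem truncate_apply (W g : Graphon) (r : I) (x y : I) :
    truncate W g r x y = max (W x y) (min (g x y) r) := rfl

theorem cutDist_le_of_abs_sub_le {f g : Graphon} {ε : ℝ} (h : ∀ x y, |f x y - g x y| ≤ ε) :
    cutDist f g ≤ ε := by
  refine cutDist_le (cutLE_of_integral_abs_le (f.integrable_sub g) ?_)
  calc ∫ z : I × I, |f z.1 z.2 - g z.1 z.2| ≤ ∫ _z : I × I, ε :=
        integral_mono (f.integrable_sub g).abs (integrable_const ε) fun z => h _ _
    _ = ε := by simp

/-- A graphon that is equal to `1` on a nonnegligible part of `{W = p}` does not minimize the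
entropy under a density constraint below `1`: truncating it slightly below `1` saves more entropy
than the compensation of the loss of density costs. -/
theorem exists_entropy_lt_of_volume_one {V : Type*} [Fintype V] [DecidableEq V]
    (H : SimpleGraph V) [Fintype H.edgeSet] {p t : ℝ} {W g : Graphon} (h0 : 0 < p)
    (h2 : p ≤ 1 / 2) (hW : ∀ x y, W x y = 1 ∨ W x y = p) (ht : t < 1) (hg : t ≤ homDensity H g)
    (hvol : volume {z : I × I | g z.1 z.2 = 1 ∧ W z.1 z.2 = p} ≠ 0) :
    ∃ g' : Graphon, t ≤ homDensity H g' ∧ entropy W g' < entropy W g := by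
  have h1 : p < 1 := by linarith
  have hW' : ∀ x y, W x y = 0 ∨ W x y = 1 ∨ W x y = p := fun x y => Or.inr (hW x y)
  have hWp : ∀ x y, p ≤ W x y := fun x y => by
    rcases hW x y with h | h <;> rw [h]
    exact h1.le
  -- Raising `g` to the reference does not increase the entropy. It makes the values at least `p`
  -- and equal to 1 on {W = 1}, so the entropy becomes a finite real integral.
  set g₁ := sup g W with hg₁
  have hW1 : ∀ x y, W x y = 1 → g₁ x y = 1 := fun x y h => by
    rw [hg₁, sup_apply, h, max_eq_right (g.le_one _ _)]
  have hg₁p : ∀ x y, p ≤ g₁ x y := fun x y => (hWp x y).trans (le_max_right _ _)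
  have ht₁ : t ≤ homDensity H g₁ := hg.trans (homDensity_mono H fun x y => le_max_left _ _)
  set E := {z : I × I | g z.1 z.2 = 1 ∧ W z.1 z.2 = p} with hE
  have hEm : MeasurableSet E := (measurableSet_eq_const g 1).inter (measurableSet_eq_const W p)
  have hη : 0 < volume.real E := ENNReal.toReal_pos hvol (measure_ne_top _ _)
  set e := H.edgeFinset.card with he
  set L := -Real.log p with hL
  have hL0 : 0 < L := neg_pos.2 (Real.log_neg h0 h1)
  have hq : 0 < p ^ e * (1 - t) := mul_pos (pow_pos h0 _) (by linarith)
  -- Truncation by ε loses density at most eε by the counting lemma. Moving the fraction s = Mε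
  -- towards 1 gains s p^e (1 - t) = eε while the density is below `t`.
  set M := (e : ℝ) / (p ^ e * (1 - t)) with hM
  have hM0 : 0 ≤ M := by positivity
  -- The saving |E| ε log(1/ε) exceeds the cost MεL of the compensation once log(1/ε) is large.
  obtain ⟨ε, hε0, hε2, hεM, hεlog⟩ : ∃ ε : ℝ, 0 < ε ∧ ε < 1 / 2 ∧ M * ε < 1 ∧
      M * L < volume.real E * -Real.log ε := by
    have l1 : ∀ᶠ ε : ℝ in 𝓝[>] 0, ε < 1 / 2 :=
      mem_nhdsWithin_of_mem_nhds (Iio_mem_nhds (by norm_num))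
    have l2 : ∀ᶠ ε : ℝ in 𝓝[>] 0, M * ε < 1 := by
      have : Tendsto (fun ε : ℝ => M * ε) (𝓝[>] 0) (𝓝 (M * 0)) :=
        ((continuous_const.mul continuous_id).tendsto 0).mono_left nhdsWithin_le_nhds
      rw [mul_zero] at this
      exact this.eventually (Iio_mem_nhds one_pos)
    have l3 : ∀ᶠ ε : ℝ in 𝓝[>] 0, Real.log ε < -(M * L / volume.real E) :=
      Real.tendsto_log_nhdsGT_zero.eventually (eventually_lt_atBot _)
    obtain ⟨ε, ⟨h3, h4, h5⟩, h6⟩ := ((l1.and (l2.and l3)).and self_mem_nhdsWithin).exists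
    refine ⟨ε, h6, h3, h4, ?_⟩
    have h7 : M * L / volume.real E < -Real.log ε := by linarith
    rw [div_lt_iff₀ hη] at h7
    linarith
  have hr : (1 - ε) ∈ I := ⟨by linarith, by linarith⟩
  set g₂ := truncate W g₁ ⟨1 - ε, hr⟩ with hg₂
  have hg₂1 : ∀ x y, W x y = 1 → g₂ x y = 1 := fun x y h => by
    rw [hg₂, truncate_apply, h, max_eq_left ((min_le_left _ _).trans (g₁.le_one _ _))]
  have hg₂p : ∀ x y, W x y = p → g₂ x y = min (g₁ x y) (1 - ε) := fun x y h => by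
    rw [hg₂, truncate_apply, h, max_eq_right]
    exact le_min (hg₁p x y) (by change p ≤ 1 - ε; linarith)
  have hdist : cutDist g₁ g₂ ≤ ε := by
    refine cutDist_le_of_abs_sub_le fun x y => ?_
    rcases hW x y with h | h
    · rw [hW1 x y h, hg₂1 x y h, sub_self, abs_zero]; exact hε0.le
    · rw [hg₂p x y h]
      have := g₁.le_one x y
      rw [abs_of_nonneg (sub_nonneg.2 (min_le_left _ _))]
      rcases min_choice (g₁ x y) (1 - ε) with h3 | h3 <;> rw [h3] <;> linarith
  have ht₂ : homDensity H g₁ - e * ε ≤ homDensity H g₂ := by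
    have h3 := homDensity_sub_le_cutDist H g₁ g₂
    have h4 := mul_le_mul_of_nonneg_left hdist (Nat.cast_nonneg (α := ℝ) e)
    linarith
  set s : I := ⟨M * ε, mul_nonneg hM0 hε0.le, hεM.le⟩ with hs
  have hsv : (s : ℝ) = M * ε := rfl
  set g₃ := towardsOne s g₂ with hg₃
  have hg₃1 : ∀ x y, W x y = 1 → g₃ x y = 1 := fun x y h => by
    rw [hg₃, towardsOne_apply, hg₂1 x y h]; ring
  refine ⟨g₃, ?_, ?_⟩
  · have h3 := homDensity_towardsOne H h0.le s
      (fun x y => (hWp x y).trans (le_max_left _ _) : ∀ x y, p ≤ g₂ x y)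
    refine le_trans ?_ h3
    have h4 := homDensity_le_one H g₂
    have h5 : (0 : ℝ) ≤ s * p ^ e := mul_nonneg s.2.1 (pow_nonneg h0.le _)
    rcases le_or_gt t (homDensity H g₂) with h6 | h6
    · have := mul_nonneg h5 (sub_nonneg.2 h4)
      linarith
    · have h7 : (s : ℝ) * p ^ e * (1 - t) = e * ε := by
        rw [hsv, hM]
        field_simp [(by linarith : (1 - t) ≠ 0)]
      have h8 := mul_le_mul_of_nonneg_left (by linarith : 1 - t ≤ 1 - homDensity H g₂) h5
      linarith
  · refine lt_of_lt_of_le ?_ (entropy_sup_le h0 h1 hW' g)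
    rw [entropy_eq_densityKL h0 h1 hW hg₃1, entropy_eq_densityKL h0 h1 hW hW1]
    refine half_mul_lt_half_mul ?_
    have hi := fun f => integrable_densityKL (W := W) h0 h1 f
    have hiE : Integrable fun z : I × I => E.indicator (fun _ => ε * -Real.log ε) z :=
      (integrable_const _).indicator hEm
    have hpt : ∀ z : I × I, densityKL p W g₃ z ≤
        densityKL p W g₁ z - E.indicator (fun _ => ε * -Real.log ε) z + s * L := by
      intro z
      have hsL : 0 ≤ (s : ℝ) * L := mul_nonneg s.2.1 hL0.le
      rcases hW z.1 z.2 with h | h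
      · have h3 : z ∉ {z : I × I | W z.1 z.2 = p} := fun h4 => by
          rw [show W z.1 z.2 = p from h4] at h; exact h1.ne h
        have h4 : z ∉ E := fun h5 => h3 h5.2
        rw [densityKL, densityKL, Set.indicator_of_notMem h3, Set.indicator_of_notMem h3,
          Set.indicator_of_notMem h4]
        linarith
      · have h3 : z ∈ {z : I × I | W z.1 z.2 = p} := h
        rw [densityKL, densityKL, Set.indicator_of_mem h3, Set.indicator_of_mem h3]
        -- Convexity limits the pointwise cost of moving towards 1 to `s * L`, since the value 1
        -- costs `L`.
        have h4 : binKL p (g₃ z.1 z.2) ≤ (1 - s) * binKL p (g₂ z.1 z.2) + s * L := by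
          have := binKL_convex (p := p) (g₂.mem_Icc_toFun z.1 z.2) s.2
          rwa [binKL_one] at this
        have h5 : 0 ≤ s * binKL p (g₂ z.1 z.2) :=
          mul_nonneg s.2.1 (binKL_nonneg h0 h1 (g₂.mem_Icc_toFun z.1 z.2))
        have h6 : binKL p (g₂ z.1 z.2) ≤
            binKL p (g₁ z.1 z.2) - E.indicator (fun _ => ε * -Real.log ε) z := by
          rw [hg₂p _ _ h]
          by_cases hz : z ∈ E
          · have h7 : g₁ z.1 z.2 = 1 := by
              rw [hg₁, sup_apply, hz.1, max_eq_left (W.le_one _ _)]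
            rw [Set.indicator_of_mem hz, h7, min_eq_right (by linarith)]
            exact binKL_one_sub_le h0 h2 hε0 (by linarith)
          · rw [Set.indicator_of_notMem hz, sub_zero]
            exact binKL_min_le h0 (g₁.mem_Icc_toFun z.1 z.2) (by linarith) (by linarith)
        linarith
    have h3 := integral_mono (hi g₃) (((hi g₁).sub hiE).add (integrable_const ((s : ℝ) * L))) hpt
    have h4 : ∫ z : I × I, (densityKL p W g₁ z - E.indicator (fun _ => ε * -Real.log ε) z + s * L) =
        (∫ z, densityKL p W g₁ z) - volume.real E * (ε * -Real.log ε) + s * L := by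
      have hiD : Integrable fun z : I × I =>
        densityKL p W g₁ z - E.indicator (fun _ => ε * -Real.log ε) z := (hi g₁).sub hiE
      rw [integral_add hiD (integrable_const _), integral_sub (hi g₁) hiE,
        integral_indicator hEm, setIntegral_const]
      simp
    have h5 : (s : ℝ) * L < volume.real E * (ε * -Real.log ε) := by
      rw [hsv]
      have := mul_lt_mul_of_pos_right hεlog hε0
      linarith
    have h6 : ∫ z, densityKL p W g₃ z < ∫ z, densityKL p W g₁ z := by
      refine h3.trans_lt ?_
      change ∫ z : I × I, (densityKL p W g₁ z - E.indicator (fun _ => ε * -Real.log ε) z + s * L) < _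
      rw [h4]
      linarith
    exact (ENNReal.ofReal_lt_ofReal_iff_of_nonneg
      (integral_nonneg fun z => densityKL_nonneg h0 h1 g₃ z)).2 h6


/-! ### Hub graphons -/

theorem prod_edge_mul {V : Type*} [Fintype V] [DecidableEq V] {H : SimpleGraph V}
    [DecidableRel H.Adj] {d : ℕ} (hH : H.IsRegularOfDegree d) (φ : V → ℝ) :
    ∏ e ∈ H.edgeFinset, (e.map φ).mul = ∏ v, φ v ^ d := by
  have h1 : ∀ e ∈ H.edgeFinset, (e.map φ).mul = ∏ v, if v ∈ e then φ v else 1 := by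
    intro e he
    induction e with
    | _ i j =>
      rw [SimpleGraph.mem_edgeFinset, SimpleGraph.mem_edgeSet] at he
      have h2 : (Finset.univ.filter fun v => v ∈ s(i, j)) = {i, j} := by
        ext v; simp
      rw [← Finset.prod_filter, h2, Finset.prod_pair he.ne]
      rfl
  rw [Finset.prod_congr rfl h1, Finset.prod_comm]
  refine Finset.prod_congr rfl fun v _ => ?_
  rw [← Finset.prod_filter, Finset.prod_const, ← SimpleGraph.incidenceFinset_eq_filter,
    SimpleGraph.card_incidenceFinset_eq_degree, hH v]

theorem blockValue_one_one_zero_mem (β β' : Bool) :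
    blockValue 1 1 0 β β' ∈ Set.Icc (0 : ℝ) 1 := by
  cases β <;> cases β' <;> simp [blockValue]

/-- The graphon `ψ(x) ψ(y)`, restricted to pairs that meet the first block. -/
noncomputable def hub (γ : ℝ) (ψ : I → ℝ) (hψ : Measurable ψ)
    (hψ01 : ∀ x, ψ x ∈ Set.Icc (0 : ℝ) 1) : Graphon where
  toFun x y := blockValue 1 1 0 (block γ x) (block γ y) * (ψ x * ψ y)
  measurable_toFun := by
    have h1 : Measurable fun z : I × I => blockValue 1 1 0 (block γ z.1) (block γ z.2) :=
      (measurable_of_countable fun w : Bool × Bool => blockValue 1 1 0 w.1 w.2).comp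
        ((measurable_block.comp measurable_fst).prodMk (measurable_block.comp measurable_snd))
    exact h1.mul ((hψ.comp measurable_fst).mul (hψ.comp measurable_snd))
  symm_toFun x y := by rw [blockValue_comm, mul_comm (ψ x)]
  mem_Icc_toFun x y := by
    have h1 := blockValue_one_one_zero_mem (block γ x) (block γ y)
    have h2 := hψ01 x
    have h3 := hψ01 y
    exact ⟨mul_nonneg h1.1 (mul_nonneg h2.1 h3.1),
      mul_le_one₀ h1.2 (mul_nonneg h2.1 h3.1) (mul_le_one₀ h2.2 h3.1 h3.2)⟩

section density

variable {V : Type*} [Fintype V] [DecidableEq V] {H : SimpleGraph V} [DecidableRel H.Adj] {d : ℕ}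

/-- Each vertex lies on `d` edges, so the edge factors ψ(x)ψ(y) amount to a vertex weight ψ^d. Only
its integrals over the two blocks matter. -/
theorem homDensity_hub (hH : H.IsRegularOfDegree d) (γ : ℝ) {ψ : I → ℝ} (hψ : Measurable ψ)
    (hψ01 : ∀ x, ψ x ∈ Set.Icc (0 : ℝ) 1) :
    homDensity H (hub γ ψ hψ hψ01) =
      colourSum H (fun β => ∫ y in {y | block γ y = β}, ψ y ^ d) 1 1 0 := by
  have h1 : ∀ x : V → I, ∏ e ∈ H.edgeFinset, edgeWeight (hub γ ψ hψ hψ01) x e =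
      (∏ v, ψ (x v) ^ d) * ∏ e ∈ H.edgeFinset, blockEdge 1 1 0 (fun v => block γ (x v)) e := by
    intro x
    rw [← prod_edge_mul hH fun v => ψ (x v), mul_comm, ← Finset.prod_mul_distrib]
    refine Finset.prod_congr rfl fun e _ => ?_
    induction e with
    | _ i j => rfl
  rw [homDensity_eq]
  simp_rw [h1]
  exact integral_prod_mul_block γ (fun χ => ∏ e ∈ H.edgeFinset, blockEdge 1 1 0 χ e)
    (hψ.pow_const d) fun x => ⟨pow_nonneg (hψ01 x).1 d, pow_le_one₀ (hψ01 x).1 (hψ01 x).2⟩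

/-- The lengths of a first block of length `γ` and a second block of length `r`. -/
noncomputable def hubLength (γ r : ℝ) (β : Bool) : ℝ := if β then γ else r

theorem continuous_colourSum_hubLength (H : SimpleGraph V) [DecidableRel H.Adj] (γ : ℝ) :
    Continuous fun r => colourSum H (hubLength γ r) 1 1 0 := by
  unfold colourSum
  refine continuous_finsetSum _ fun χ _ => Continuous.mul ?_ continuous_const
  refine continuous_finsetProd _ fun v _ => ?_
  unfold hubLength
  cases χ v
  · simpa using continuous_id'
  · simpa using continuous_const

/-- This graphon is the hub with weight 1 on the first block and `b` on the second. Its density is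
that of a 0-1 valued hub whose second part has length (1-γ)b^d, while its mass involves (1-γ)b. -/
theorem homDensity_twoBlock_one_zero {γ : ℝ} (h0 : 0 < γ) (h1 : γ < 1)
    (hH : H.IsRegularOfDegree d) (b : I) :
    homDensity H (twoBlock γ 1 b 0) =
      colourSum H (hubLength γ ((1 - γ) * (b : ℝ) ^ d)) 1 1 0 := by
  have hψ : Measurable fun x : I => if block γ x = true then (1 : ℝ) else b :=
    Measurable.ite (measurableSet_block γ true) measurable_const measurable_const
  have hψ01 : ∀ x : I, (if block γ x = true then (1 : ℝ) else b) ∈ Set.Icc (0 : ℝ) 1 := by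
    intro x
    split_ifs
    exacts [⟨zero_le_one, le_rfl⟩, b.2]
  have h2 : twoBlock γ 1 b 0 = hub γ _ hψ hψ01 := by
    refine ext' fun x y => ?_
    rw [twoBlock_apply]
    change _ = blockValue 1 1 0 (block γ x) (block γ y) * ((if block γ x = true then (1 : ℝ) else b) *
      if block γ y = true then (1 : ℝ) else b)
    cases block γ x <;> cases block γ y <;> simp [blockValue]
  rw [h2, homDensity_hub hH]
  congr 1
  funext β
  cases β
  · rw [setIntegral_congr_fun (g := fun _ => (b : ℝ) ^ d) (measurableSet_block γ false) fun x hx => by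
      have hx : block γ x = false := hx
      simp [hx], setIntegral_const, volume_block_preimage h0 h1]
    rfl
  · rw [setIntegral_congr_fun (g := fun _ => (1 : ℝ)) (measurableSet_block γ true) fun x hx => by
      have hx : block γ x = true := hx
      simp [hx], setIntegral_const, volume_block_preimage h0 h1]
    simp [hubLength, blockLength]

end density

/-! ### Hubs on an initial interval -/

theorem measurable_initial (u : ℝ) : Measurable fun x : I => if (x : ℝ) ≤ u then (1 : ℝ) else 0 :=
  Measurable.ite (measurableSet_le measurable_subtype_coe measurable_const) measurable_const
    measurable_const

theorem initial_mem (u : ℝ) (x : I) : (if (x : ℝ) ≤ u then (1 : ℝ) else 0) ∈ Set.Icc (0 : ℝ) 1 := by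
  split_ifs <;> simp

/-- The indicator function of the pairs of points of `[0, γ + r]` that meet `[0, γ]`. -/
noncomputable def initialHub (γ r : ℝ) : Graphon :=
  hub γ _ (measurable_initial (γ + r)) (initial_mem (γ + r))

theorem initialHub_apply (γ r : ℝ) (x y : I) : initialHub γ r x y =
    blockValue 1 1 0 (block γ x) (block γ y) *
      ((if (x : ℝ) ≤ γ + r then (1 : ℝ) else 0) * if (y : ℝ) ≤ γ + r then (1 : ℝ) else 0) := rfl

theorem initialHub_eq_zero_or_one (γ r : ℝ) (x y : I) :
    initialHub γ r x y = 0 ∨ initialHub γ r x y = 1 := by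
  rw [initialHub_apply]
  cases block γ x <;> cases block γ y <;> split_ifs <;> simp [blockValue]

theorem integral_initial {u : ℝ} (h0 : 0 ≤ u) (h1 : u ≤ 1) :
    ∫ x : I, (if (x : ℝ) ≤ u then (1 : ℝ) else 0) = u := by
  have hm : MeasurableSet {x : I | (x : ℝ) ≤ u} :=
    measurableSet_le measurable_subtype_coe measurable_const
  have h2 : ∀ x : I, (if (x : ℝ) ≤ u then (1 : ℝ) else 0) =
      {x : I | (x : ℝ) ≤ u}.indicator (fun _ => (1 : ℝ)) x := fun x => by
    simp [Set.indicator_apply]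
  simp_rw [h2]
  rw [integral_indicator hm, setIntegral_const, smul_eq_mul, mul_one,
    measureReal_congr (t := Subtype.val ⁻¹' Set.Ioc 0 u), volume_val_preimage_Ioc le_rfl h0 h1,
    sub_zero]
  filter_upwards [ae_ne_zero] with x hx
  have hx0 : (0 : ℝ) < x := lt_of_le_of_ne x.2.1 (fun h => hx (Subtype.ext h.symm))
  refine propext ?_
  change (x : ℝ) ≤ u ↔ 0 < (x : ℝ) ∧ (x : ℝ) ≤ u
  simp [hx0]

theorem integral_initialHub {γ r : ℝ} (h0 : 0 < γ) (hr0 : 0 ≤ r) (hr1 : γ + r ≤ 1) :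
    ∫ z : I × I, initialHub γ r z.1 z.2 = γ ^ 2 + 2 * γ * r := by
  set k : ℝ → I → ℝ := fun u x => if (x : ℝ) ≤ u then (1 : ℝ) else 0 with hk
  have hki : ∀ u v, Integrable fun z : I × I => k u z.1 * k v z.2 := fun u v => by
    refine Integrable.of_bound (((measurable_initial u).comp measurable_fst).mul
      ((measurable_initial v).comp measurable_snd)).aestronglyMeasurable 1 (.of_forall fun z => ?_)
    have h2 := initial_mem u z.1
    have h3 := initial_mem v z.2
    rw [Real.norm_eq_abs]
    change |(if (z.1 : ℝ) ≤ u then (1 : ℝ) else 0) * (if (z.2 : ℝ) ≤ v then (1 : ℝ) else 0)| ≤ 1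
    rw [abs_of_nonneg (mul_nonneg h2.1 h3.1)]
    exact mul_le_one₀ h2.2 h3.1 h3.2
  have h2 : ∀ z : I × I, initialHub γ r z.1 z.2 =
      k γ z.1 * k (γ + r) z.2 + k (γ + r) z.1 * k γ z.2 - k γ z.1 * k γ z.2 := by
    rintro ⟨x, y⟩
    rw [initialHub_apply]
    simp only [hk, block, blockValue]
    by_cases hx : (x : ℝ) ≤ γ <;> by_cases hy : (y : ℝ) ≤ γ <;> simp [hx, hy]
    · simp [hx.trans (by linarith : γ ≤ γ + r), hy.trans (by linarith : γ ≤ γ + r)]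
    · simp [hx.trans (by linarith : γ ≤ γ + r)]
    · simp [hy.trans (by linarith : γ ≤ γ + r)]
  have hint : ∀ u v, 0 ≤ u → u ≤ 1 → 0 ≤ v → v ≤ 1 →
      ∫ z : I × I, k u z.1 * k v z.2 = u * v := fun u v hu0 hu1 hv0 hv1 => by
    rw [Measure.volume_eq_prod, integral_prod_mul (k u) (k v)]
    exact congrArg₂ (· * ·) (integral_initial hu0 hu1) (integral_initial hv0 hv1)
  simp_rw [h2]
  have hadd : Integrable fun z : I × I => k γ z.1 * k (γ + r) z.2 + k (γ + r) z.1 * k γ z.2 :=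
    (hki _ _).add (hki _ _)
  rw [integral_sub hadd (hki _ _), integral_add (hki _ _) (hki _ _),
    hint _ _ h0.le (by linarith) (by linarith) hr1, hint _ _ (by linarith) hr1 h0.le (by linarith),
    hint _ _ h0.le (by linarith) h0.le (by linarith)]
  ring

section threshold

variable {V : Type*} [Fintype V] [DecidableEq V] {H : SimpleGraph V} [DecidableRel H.Adj] {d : ℕ}

theorem homDensity_initialHub (hd : d ≠ 0) (hH : H.IsRegularOfDegree d) {γ r : ℝ} (h0 : 0 < γ)
    (h1 : γ < 1) (hr0 : 0 ≤ r) (hr1 : γ + r ≤ 1) :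
    homDensity H (initialHub γ r) = colourSum H (hubLength γ r) 1 1 0 := by
  rw [initialHub, homDensity_hub hH]
  congr 1
  funext β
  have hpow : ∀ y : I, (if (y : ℝ) ≤ γ + r then (1 : ℝ) else 0) ^ d =
      if (y : ℝ) ≤ γ + r then (1 : ℝ) else 0 := fun y => by
    split_ifs <;> simp [hd]
  simp_rw [hpow]
  have htrue : ∫ y in {y : I | block γ y = true}, (if (y : ℝ) ≤ γ + r then (1 : ℝ) else 0) = γ := by
    rw [setIntegral_congr_fun (g := fun _ => (1 : ℝ)) (measurableSet_block γ true) fun x hx => by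
      have hx : (x : ℝ) ≤ γ := by simpa [block] using hx
      simp [hx.trans (by linarith : γ ≤ γ + r)], setIntegral_const, volume_block_preimage h0 h1]
    simp [blockLength]
  cases β
  · have hi : Integrable fun y : I => if (y : ℝ) ≤ γ + r then (1 : ℝ) else 0 :=
      Integrable.of_bound (measurable_initial _).aestronglyMeasurable 1 (.of_forall fun x => by
        rw [Real.norm_eq_abs, abs_of_nonneg (initial_mem _ x).1]
        exact (initial_mem _ x).2)
    have h2 := integral_add_compl (measurableSet_block γ true) hi
    have h3 : {x : I | block γ x = true}ᶜ = {x : I | block γ x = false} := by ext x; simp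
    rw [htrue, h3, integral_initial (by linarith) hr1] at h2
    change _ = r
    linarith
  · exact htrue

/-- A hub of sufficiently large density that is smaller than every admissible two-block graphon. -/
theorem exists_initialHub (hd : 2 ≤ d) (hH : H.IsRegularOfDegree d) {γ t : ℝ} (h0 : 0 < γ)
    (h1 : γ < 1) (ht0 : homDensity H (twoBlock γ 1 0 0) < t)
    (ht1 : t < homDensity H (twoBlock γ 1 1 0)) :
    ∃ r : ℝ, 0 ≤ r ∧ γ + r ≤ 1 ∧ t ≤ homDensity H (initialHub γ r) ∧
      ∀ b : I, t ≤ homDensity H (twoBlock γ 1 b 0) → r < (1 - γ) * b := by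
  have hδ : 0 < 1 - γ := by linarith
  set f := fun r => colourSum H (hubLength γ r) 1 1 0 with hf
  have hfc : Continuous f := continuous_colourSum_hubLength H γ
  have hf0 : f 0 < t := by
    rw [homDensity_twoBlock_one_zero h0 h1 hH] at ht0
    rwa [Set.Icc.coe_zero, zero_pow (by omega), mul_zero] at ht0
  have hf1 : t < f (1 - γ) := by
    rw [homDensity_twoBlock_one_zero h0 h1 hH] at ht1
    simpa using ht1
  have hcomp : IsCompact (Set.Icc 0 (1 - γ) ∩ f ⁻¹' Set.Ici t) :=
    isCompact_Icc.inter_right (isClosed_Ici.preimage hfc)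
  -- The least length that reaches the density `t`; leastness makes monotonicity of `f` unnecessary.
  obtain ⟨r, ⟨⟨hr0, hr1⟩, hrt⟩, hleast⟩ :=
    hcomp.exists_isLeast ⟨1 - γ, ⟨hδ.le, le_rfl⟩, hf1.le⟩
  have hrpos : 0 < r := lt_of_le_of_ne hr0 (by rintro rfl; exact absurd hrt (not_le.2 hf0))
  have hrlt : r < 1 - γ := by
    have h2 : ∀ᶠ u in 𝓝[<] (1 - γ), t < f u :=
      mem_nhdsWithin_of_mem_nhds (hfc.continuousAt.eventually (Ioi_mem_nhds hf1))
    have h3 : ∀ᶠ u in 𝓝[<] (1 - γ), 0 < u := mem_nhdsWithin_of_mem_nhds (Ioi_mem_nhds hδ)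
    obtain ⟨u, ⟨h4, h5⟩, h6⟩ := ((h2.and h3).and self_mem_nhdsWithin).exists
    exact (hleast ⟨⟨h5.le, le_of_lt h6⟩, h4.le⟩).trans_lt h6
  refine ⟨r, hr0, by linarith, ?_, fun b hb => ?_⟩
  · rw [homDensity_initialHub (by omega) hH h0 h1 hr0 (by linarith)]
    exact hrt
  · rw [homDensity_twoBlock_one_zero h0 h1 hH] at hb
    have hbd : (b : ℝ) ^ d ≤ 1 := pow_le_one₀ b.2.1 b.2.2
    have h2 : r ≤ (1 - γ) * (b : ℝ) ^ d :=
      hleast ⟨⟨mul_nonneg hδ.le (pow_nonneg b.2.1 d), by nlinarith⟩, hb⟩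
    -- For b < 1 the inequality is strict because b^d < b. For b = 1 it rests on r < 1 - γ, which
    -- holds because the density of the full hub exceeds `t`.
    rcases b.2.2.eq_or_lt with h3 | h3
    · rw [h3, mul_one]; exact hrlt
    · have h4 : (0 : ℝ) < b := by
        refine lt_of_le_of_ne b.2.1 fun h5 => ?_
        rw [← h5, zero_pow (by omega), mul_zero] at h2
        exact absurd h2 (not_le.2 hrpos)
      have h5 : (b : ℝ) ^ d < b := by
        calc (b : ℝ) ^ d ≤ (b : ℝ) ^ 2 := pow_le_pow_of_le_one b.2.1 b.2.2 hd
          _ < b := by nlinarith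
      exact h2.trans_lt (mul_lt_mul_of_pos_left h5 hδ)

end threshold


/-! ### Minimizers of the rate function -/

theorem abs_twoBlock_sub_le (γ : ℝ) (q q' : I × I × I) (x y : I) :
    |twoBlock γ q.1 q.2.1 q.2.2 x y - twoBlock γ q'.1 q'.2.1 q'.2.2 x y| ≤ dist q q' := by
  rw [twoBlock_apply, twoBlock_apply]
  have h1 : |(q.1 : ℝ) - q'.1| ≤ dist q q' := le_max_left _ _
  have h2 : |(q.2.1 : ℝ) - q'.2.1| ≤ dist q q' := (le_max_left _ _).trans (le_max_right _ _)
  have h3 : |(q.2.2 : ℝ) - q'.2.2| ≤ dist q q' := (le_max_right _ _).trans (le_max_right _ _)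
  cases block γ x <;> cases block γ y <;> assumption

/-- It is the projection of a closed set along the compact cube of parameters (a, b, c). -/
theorem isClosed_isSymmetric (γ : ℝ) : IsClosed {g : BlockGraphon γ | IsSymmetric γ g} := by
  have hc : Continuous fun w : (I × I × I) × BlockGraphon γ =>
      cutMetric w.2 (twoBlock γ w.1.1 w.1.2.1 w.1.2.2) := by
    have : LipschitzWith 2 fun w : (I × I × I) × BlockGraphon γ =>
        cutMetric w.2 (twoBlock γ w.1.1 w.1.2.1 w.1.2.2) := by
      refine LipschitzWith.of_le_add_mul _ fun w w' => ?_
      have h1 : cutMetric w.2 w'.2 ≤ dist w w' :=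
        (cutMetric_le_cutMetricOn _ _ _).trans (le_max_right _ _)
      have h2 : cutMetric (twoBlock γ w'.1.1 w'.1.2.1 w'.1.2.2)
          (twoBlock γ w.1.1 w.1.2.1 w.1.2.2) ≤ dist w w' :=
        (cutMetric_le_cutDist _ _).trans (cutDist_le_of_abs_sub_le fun x y =>
          (abs_twoBlock_sub_le γ w'.1 w.1 x y).trans
            ((dist_comm _ _).trans_le (le_max_left _ _)))
      have h3 := cutMetric_triangle w.2 w'.2 (twoBlock γ w.1.1 w.1.2.1 w.1.2.2)
      have h4 := cutMetric_triangle w'.2 (twoBlock γ w'.1.1 w'.1.2.1 w'.1.2.2)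
        (twoBlock γ w.1.1 w.1.2.1 w.1.2.2)
      have h5 : (2 : ℝ) * dist w w' = dist w w' + dist w w' := two_mul _
      change _ ≤ _ + (2 : ℝ) * dist w w'
      linarith
    exact this.continuous
  have h1 := isClosedMap_snd_of_compactSpace _ (isClosed_eq hc (continuous_const (y := (0 : ℝ))))
  convert h1 using 1
  ext g
  constructor
  · rintro ⟨a, b, c, h⟩
    exact ⟨((a, b, c), g), h, rfl⟩
  · rintro ⟨⟨⟨a, b, c⟩, g'⟩, h, rfl⟩
    exact ⟨a, b, c, h⟩

theorem IsSymmetric.of_cutMetric_eq_zero {γ : ℝ} {f g : Graphon} (hf : IsSymmetric γ f)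
    (h : cutMetric f g = 0) : IsSymmetric γ g := by
  obtain ⟨a, b, c, habc⟩ := hf
  refine ⟨a, b, c, le_antisymm ?_ (cutMetric_nonneg _ _)⟩
  have h1 := cutMetric_triangle g f (twoBlock γ a b c)
  rw [cutMetric_comm g f, h, habc, add_zero] at h1
  exact h1

/-- If the entropy of every admissible symmetric graphon can be lowered within the admissible
graphons, then the optimizers of the rate function are not symmetric. -/
theorem rate_optimizers_not_symmetric {V : Type*} [Fintype V] [DecidableEq V] (H : SimpleGraph V)
    [Fintype H.edgeSet] {γ p t : ℝ} {W : Graphon} (hW : IsBlockReference γ p W)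
    (hne : ∃ a b c : I, t ≤ homDensity H (twoBlock γ a b c))
    (himp : ∀ g, IsSymmetric γ g → t ≤ homDensity H g →
      ∃ g', t ≤ homDensity H g' ∧ entropy W g' < entropy W g) :
    (∃ m₁ m₂ : ℝ≥0∞,
      IsLeast {r | ∃ g : Graphon, t ≤ homDensity H g ∧ r = rate W g} m₁ ∧
      IsLeast {r | ∃ g : Graphon, IsSymmetric γ g ∧ t ≤ homDensity H g ∧ r = rate W g} m₂ ∧
      m₁ < m₂) ∧
    ∀ g : Graphon, IsOptimizer H W t g → ¬ IsSymmetric γ g := by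
  obtain ⟨a, b, c, habc⟩ := hne
  have hcl : IsClosed {g : BlockGraphon γ | t ≤ homDensity H g} :=
    isClosed_le continuous_const (continuous_homDensity H γ)
  have hrate : ∀ f : Graphon, t ≤ homDensity H f →
      ∃ g, t ≤ homDensity H g ∧ cutMetric f g = 0 ∧ entropy W g = rate W f := by
    intro f hf
    obtain ⟨g, hg1, hg2⟩ := hW.exists_entropy_eq_rate f
    exact ⟨g, hf.trans_eq (homDensity_eq_of_cutMetric_eq_zero H hg1), hg1, hg2⟩
  obtain ⟨g₁, hg₁, hmin₁⟩ := hW.exists_entropy_min hcl ⟨twoBlock γ a b c, habc⟩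
  obtain ⟨g₂, ⟨hg₂s, hg₂⟩, hmin₂⟩ := hW.exists_entropy_min ((isClosed_isSymmetric γ).inter hcl)
    ⟨twoBlock γ a b c, ⟨a, b, c, cutMetric_self _⟩, habc⟩
  have hl₁ : ∀ f : Graphon, t ≤ homDensity H f → entropy W g₁ ≤ rate W f := by
    intro f hf
    obtain ⟨g, h1, -, h3⟩ := hrate f hf
    rw [← h3]
    exact hmin₁ g h1
  have hl₂ : ∀ f : Graphon, IsSymmetric γ f → t ≤ homDensity H f → entropy W g₂ ≤ rate W f := by
    intro f hfs hf
    obtain ⟨g, h1, h2, h3⟩ := hrate f hf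
    rw [← h3]
    exact hmin₂ g ⟨hfs.of_cutMetric_eq_zero h2, h1⟩
  -- A minimizer of the entropy already minimizes it within its own class, so its rate and its
  -- entropy coincide.
  have hr₁ : rate W g₁ = entropy W g₁ :=
    le_antisymm (IsBlockReference.rate_le_entropy g₁ g₁ (cutMetric_self _)) (hl₁ g₁ hg₁)
  have hr₂ : rate W g₂ = entropy W g₂ :=
    le_antisymm (IsBlockReference.rate_le_entropy g₂ g₂ (cutMetric_self _)) (hl₂ g₂ hg₂s hg₂)
  have hlt : entropy W g₁ < entropy W g₂ := by
    obtain ⟨g', h1, h2⟩ := himp g₂ hg₂s hg₂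
    exact (hmin₁ g' h1).trans_lt h2
  refine ⟨⟨entropy W g₁, entropy W g₂, ⟨⟨g₁, hg₁, hr₁.symm⟩, ?_⟩, ⟨⟨g₂, hg₂s, hg₂, hr₂.symm⟩, ?_⟩,
    hlt⟩, fun g hg hgs => ?_⟩
  · rintro r ⟨f, hf, rfl⟩
    exact hl₁ f hf
  · rintro r ⟨f, hfs, hf, rfl⟩
    exact hl₂ f hfs hf
  · have h1 := hg.2 g₁ hg₁
    rw [hr₁] at h1
    exact absurd ((hl₂ g hgs hg.1).trans h1) (not_le.2 hlt)

/-! ### A gap for the mass of admissible two-block graphons -/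

theorem continuous_colourSum {V : Type*} [Fintype V] [DecidableEq V] (H : SimpleGraph V)
    [Fintype H.edgeSet] (m : Bool → ℝ) :
    Continuous fun q : I × I × I => colourSum H m q.1 q.2.1 q.2.2 := by
  unfold colourSum
  refine continuous_finsetSum _ fun χ _ => continuous_const.mul
    (continuous_finsetProd _ fun e _ => ?_)
  induction e with
  | _ i j =>
    change Continuous fun q : I × I × I => blockValue q.1 q.2.1 q.2.2 (χ i) (χ j)
    unfold blockValue
    split_ifs <;> fun_prop

/-- Density and mass are continuous in the parameters, which range over a compact set. The gap does
not involve `p`, so `p` can be chosen after it. -/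
theorem exists_mass_gap {V : Type*} [Fintype V] [DecidableEq V] (H : SimpleGraph V)
    [Fintype H.edgeSet] {γ t m : ℝ} (h0 : 0 < γ) (h1 : γ < 1) {C : Set (I × I × I)}
    (hC : IsClosed C)
    (hm : ∀ q ∈ C, t ≤ homDensity H (twoBlock γ q.1 q.2.1 q.2.2) →
      m < blockMass γ q.1 q.2.1 q.2.2) :
    ∃ η : ℝ, 0 < η ∧ ∀ q ∈ C, t ≤ homDensity H (twoBlock γ q.1 q.2.1 q.2.2) →
      m + η ≤ blockMass γ q.1 q.2.1 q.2.2 := by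
  have hTc : Continuous fun q : I × I × I => homDensity H (twoBlock γ q.1 q.2.1 q.2.2) := by
    simp_rw [homDensity_twoBlock h0 h1]
    exact continuous_colourSum H _
  have hMc : Continuous fun q : I × I × I => blockMass γ q.1 q.2.1 q.2.2 := by
    unfold blockMass; fun_prop
  have hK : IsCompact (C ∩ {q | t ≤ homDensity H (twoBlock γ q.1 q.2.1 q.2.2)}) :=
    (hC.inter (isClosed_le continuous_const hTc)).isCompact
  rcases (C ∩ {q | t ≤ homDensity H (twoBlock γ q.1 q.2.1 q.2.2)}).eq_empty_or_nonempty with he | hne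
  · refine ⟨1, one_pos, fun q hq hqt => ?_⟩
    have : q ∈ C ∩ {q | t ≤ homDensity H (twoBlock γ q.1 q.2.1 q.2.2)} := ⟨hq, hqt⟩
    rw [he] at this
    exact this.elim
  · obtain ⟨q₀, hq₀, hmin⟩ := hK.exists_isMinOn hne hMc.continuousOn
    refine ⟨blockMass γ q₀.1 q₀.2.1 q₀.2.2 - m, sub_pos.2 (hm q₀ hq₀.1 hq₀.2), fun q hq hqt => ?_⟩
    have := hmin (show q ∈ C ∩ _ from ⟨hq, hqt⟩)
    change blockMass γ q₀.1 q₀.2.1 q₀.2.2 ≤ blockMass γ q.1 q.2.1 q.2.2 at this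
    linarith


/-! ### Lowering the entropy of symmetric graphons -/

theorem isBlockReference_twoBlock {γ : ℝ} (h0 : 0 < γ) (h1 : γ < 1) {p : ℝ} (hp0 : 0 < p)
    (hp1 : p < 1) {a b c : I} (ha : (a : ℝ) = 0 ∨ (a : ℝ) = 1 ∨ (a : ℝ) = p)
    (hb : (b : ℝ) = 0 ∨ (b : ℝ) = 1 ∨ (b : ℝ) = p) (hc : (c : ℝ) = 0 ∨ (c : ℝ) = 1 ∨ (c : ℝ) = p) :
    IsBlockReference γ p (twoBlock γ a b c) where
  gamma_pos := h0
  gamma_lt_one := h1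
  pos := hp0
  lt_one := hp1
  values x y := by
    rw [twoBlock_apply]
    cases block γ x <;> cases block γ y <;> assumption
  relabel_eq _ hφ := twoBlock_relabel hφ

theorem AgreesOffOmega.eqOnBlock {γ : ℝ} {W g : Graphon} (h : AgreesOffOmega W g) {β : Bool} {w : ℝ}
    (hw : w = 0 ∨ w = 1) (hW : ∀ x y, block γ x = β → block γ y = β → W x y = w) :
    EqOnBlock γ g β w := by
  refine measure_mono_null ?_ h
  intro z hz
  change ¬ (block γ z.1 = β → block γ z.2 = β → g z.1 z.2 = w) at hz
  push Not at hz
  obtain ⟨h1, h2, h3⟩ := hz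
  have h4 := hW _ _ h1 h2
  refine ⟨?_, by rw [h4]; exact h3⟩
  rw [h4]
  rcases hw with rfl | rfl <;> simp

/-- The value `c` is taken on measure at least (1-γ)², which exceeds the measure γ² of the first
block square. -/
theorem volume_eq_off_block_ne_zero {γ : ℝ} (h0 : 0 < γ) (h2 : γ < 1 / 2) {g : Graphon}
    {a b c : I} (h : cutMetric g (twoBlock γ a b c) = 0) (hc : c = 0 ∨ c = 1) :
    volume {z : I × I | g z.1 z.2 = c ∧ ¬ (block γ z.1 = true ∧ block γ z.2 = true)} ≠ 0 := by
  intro hcon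
  have h3 := sq_le_volume_eq h0 (by linarith) h hc
  set B := {x : I | block γ x = true}
  have h4 : volume.real (B ×ˢ B) = γ ^ 2 := by
    rw [Measure.volume_eq_prod, measureReal_prod_prod, volume_block_preimage h0 (by linarith), sq]
    rfl
  have h5 : {z : I × I | g z.1 z.2 = c} ⊆
      {z : I × I | g z.1 z.2 = c ∧ ¬ (block γ z.1 = true ∧ block γ z.2 = true)} ∪ B ×ˢ B := by
    intro z hz
    by_cases hz' : block γ z.1 = true ∧ block γ z.2 = true
    · exact Or.inr hz'
    · exact Or.inl ⟨hz, hz'⟩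
  have h6 := (measureReal_mono (μ := volume) h5).trans (measureReal_union_le _ _)
  have h7 := congrArg ENNReal.toReal hcon
  rw [← measureReal_def, ENNReal.toReal_zero] at h7
  rw [h7, zero_add, h4] at h6
  nlinarith

theorem exists_log_threshold {η : ℝ} (hη : 0 < η) : ∃ p₀ : ℝ, 0 < p₀ ∧
    ∀ p : ℝ, 0 < p → p < p₀ → p ≤ 1 / 2 ∧ 2 * Real.log 2 < -Real.log p * η := by
  refine ⟨min (1 / 2) (Real.exp (-(2 * Real.log 2 / η))), lt_min (by norm_num) (Real.exp_pos _),
    fun p h0 hp => ⟨(hp.trans_le (min_le_left _ _)).le, ?_⟩⟩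
  have h1 := (Real.log_lt_iff_lt_exp h0).2 (hp.trans_le (min_le_right _ _))
  have h2 : 2 * Real.log 2 / η < -Real.log p := by linarith
  rwa [div_lt_iff₀ hη] at h2

theorem entropy_lt_of_gap {p η : ℝ} {W g g' : Graphon} (h0 : 0 < p) (h2 : p ≤ 1 / 2)
    (hη : 2 * Real.log 2 < -Real.log p * η) (hW : ∀ x y, W x y = 0 ∨ W x y = 1 ∨ W x y = p)
    (hg' : ∀ x y, g' x y = 0 ∨ g' x y = 1)
    (hgW : ∀ x y, W x y = 0 ∨ W x y = 1 → g' x y = W x y)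
    (hgap : entropy W g ≠ ⊤ →
      (∫ z : I × I, g' z.1 z.2) + η ≤ ∫ z : I × I, g z.1 z.2) :
    entropy W g' < entropy W g := by
  by_cases htop : entropy W g = ⊤
  · rw [htop]
    exact (entropy_le h0 h2 hW hg' hgW).trans_lt (ENNReal.mul_lt_top (by simp) ENNReal.ofReal_lt_top)
  · refine entropy_lt_entropy_of_integral h0 h2 hW hg' hgW ?_
    have hlog : 0 ≤ -Real.log p := neg_nonneg.2 (Real.log_nonpos h0.le (by linarith))
    have := mul_le_mul_of_nonneg_left (hgap htop) hlog
    linarith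

theorem isClosed_constraint (w : I) (P : Prop) :
    IsClosed ({q : I × I × I | q.1 = w} ∪ {q : I × I × I | q.2.2 = w ∧ P}) :=
  (isClosed_eq continuous_fst continuous_const).union
    ((isClosed_eq (continuous_snd.comp continuous_snd) continuous_const).inter isClosed_const)

section cases

variable {V : Type*} [Fintype V] [DecidableEq V] {H : SimpleGraph V}
  [DecidableRel H.Adj] {d : ℕ} {γ t : ℝ}

theorem exists_pow_card_eq (V : Type*) [Fintype V] [Nonempty V] (ht : 0 < t) :
    ∃ s : ℝ, 0 < s ∧ s ^ Fintype.card V = t :=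
  ⟨t ^ ((Fintype.card V : ℝ)⁻¹), Real.rpow_pos_of_pos ht _,
    Real.rpow_inv_natCast_pow ht.le Fintype.card_ne_zero⟩

/-- The competitor is the indicator of (1-s,1]², with s^|V| = t. Since s < 1-γ, it vanishes on the
square where the reference is 0. -/
theorem exists_entropy_lt_first_zero [Nonempty V] (hd : 2 ≤ d) (hH : H.IsRegularOfDegree d) (h0 : 0 < γ)
    (h1 : γ < 1) (ht0 : 0 < t) (ht1 : t < homDensity H (twoBlock γ 0 0 1)) :
    ∃ p₀ : ℝ, 0 < p₀ ∧ ∀ p : I, 0 < (p : ℝ) → (p : ℝ) < p₀ → ∀ g, IsSymmetric γ g →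
      t ≤ homDensity H g →
        ∃ g', t ≤ homDensity H g' ∧ entropy (twoBlock γ 0 p p) g' < entropy (twoBlock γ 0 p p) g := by
  obtain ⟨s, hs0, rfl⟩ := exists_pow_card_eq V ht0
  rw [homDensity_twoBlock_zero_zero_one h0 h1 (by omega) hH] at ht1
  have hs1 : s < 1 - γ := lt_of_pow_lt_pow_left₀ _ (by linarith) ht1
  obtain ⟨η, hη, hgap⟩ := exists_mass_gap H (t := s ^ Fintype.card V) (m := s ^ 2) h0 h1
    (isClosed_constraint 0 (γ = 1 / 2)) (by
      rintro ⟨a, b, c⟩ hC hq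
      have hss : s ^ 2 < (1 - γ) ^ 2 := pow_lt_pow_left₀ hs1 hs0.le two_ne_zero
      rcases sq_lt_blockMass hd hH h0 h1 hs0 hq with h | ⟨rfl, rfl, rfl⟩ | ⟨rfl, rfl, rfl⟩ |
        ⟨rfl, rfl, rfl⟩
      · exact h
      · have hγ : γ = 1 / 2 := hC.elim (fun h => absurd h (by simp)) fun h => h.2
        simp only [blockMass, Set.Icc.coe_one, Set.Icc.coe_zero]
        rw [hγ] at hss ⊢
        linarith
      · simp only [blockMass, Set.Icc.coe_one, Set.Icc.coe_zero]
        linarith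
      · exact hC.elim (fun h => absurd h (by simp)) fun h => absurd h.1 (by simp))
  obtain ⟨p₀, hp₀, hlog⟩ := exists_log_threshold hη
  refine ⟨p₀, hp₀, fun p hp0 hpp g ⟨a, b, c, hg⟩ hgt => ?_⟩
  obtain ⟨hp2, hlogp⟩ := hlog p hp0 hpp
  have hp1 : (p : ℝ) < 1 := by linarith
  have hW := (isBlockReference_twoBlock (a := 0) (b := p) (c := p) h0 h1 hp0 hp1 (by simp) (by simp)
    (by simp)).values
  -- For c = 0 and γ < 1/2 the mass bound may fail, for instance for a displaced indicator of a
  -- square of side γ. Then `g` vanishes on part of {W = p}, and raising it to the reference is a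
  -- strict gain, provided its entropy is finite.
  by_cases hex : entropy (twoBlock γ 0 p p) g ≠ ⊤ ∧ c = 0 ∧ γ < 1 / 2
  · obtain ⟨hfin, rfl, hγ⟩ := hex
    refine ⟨sup g (twoBlock γ 0 p p), hgt.trans (homDensity_mono H fun x y => le_max_left _ _),
      entropy_sup_lt hp0 hp1 hW hfin fun hcon =>
        volume_eq_off_block_ne_zero h0 hγ hg (Or.inl rfl) (measure_mono_null ?_ hcon)⟩
    rintro z ⟨hz1, hz2⟩
    refine ⟨hz1, ?_⟩
    rw [twoBlock_apply]
    revert hz2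
    cases block γ z.1 <;> cases block γ z.2 <;> simp [blockValue]
  · refine ⟨twoBlock (1 - s) 0 0 1, ?_, entropy_lt_of_gap hp0 hp2 hlogp hW (fun x y => ?_)
      (fun x y h => ?_) fun hfin => ?_⟩
    · rw [homDensity_twoBlock_zero_zero_one (by linarith) (by linarith) (by omega) hH, sub_sub_cancel]
    · rw [twoBlock_apply]
      cases block (1 - s) x <;> cases block (1 - s) y <;> simp [blockValue]
    · rw [twoBlock_apply, twoBlock_apply] at *
      by_cases hx : (x : ℝ) ≤ γ <;> by_cases hy : (y : ℝ) ≤ γ <;>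
        simp only [block, hx, hy, blockValue, decide_true, decide_false, Bool.and_self, Bool.not_true,
          Bool.not_false, Bool.and_false, Bool.and_true, if_true, if_false, Bool.false_eq_true] at h ⊢
      · simp [hx.trans (by linarith : γ ≤ 1 - s), hy.trans (by linarith : γ ≤ 1 - s)]
      all_goals exact absurd h (by rintro (h | h) <;> linarith)
    · rw [integral_twoBlock (by linarith) (by linarith), integral_eq_of_cutMetric_eq_zero hg,
        integral_twoBlock h0 h1]
      have hag := agreesOffOmega_of_entropy_ne_top hfin
      have hblock : EqOnBlock γ g true ((0 : I) : ℝ) := hag.eqOnBlock (Or.inl rfl) fun x y hx hy => by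
        rw [twoBlock_apply, hx, hy]; rfl
      have hmem : (a, b, c) ∈ {q : I × I × I | q.1 = 0} ∪ {q : I × I × I | q.2.2 = 0 ∧ γ = 1 / 2} := by
        rcases eq_or_eq_of_eqOnBlock h0 h1 hg hblock with h | ⟨h, h'⟩
        · exact Or.inl h
        · refine Or.inr ⟨h, le_antisymm h' (not_lt.1 fun h'' => hex ⟨hfin, h, h''⟩)⟩
      rw [homDensity_eq_of_cutMetric_eq_zero H hg] at hgt
      refine le_trans (le_of_eq ?_) (hgap (a, b, c) hmem hgt)
      simp [blockMass]

/-- The competitor is the indicator of [0,s]², with s^|V| = t. Since γ < s, it equals 1 on the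
square where the reference is 1. -/
theorem exists_entropy_lt_first_one [Nonempty V] (hd : 2 ≤ d) (hH : H.IsRegularOfDegree d) (h0 : 0 < γ)
    (h1 : γ < 1) (ht0 : homDensity H (twoBlock γ 1 0 0) < t) (ht1 : t < 1) :
    ∃ p₀ : ℝ, 0 < p₀ ∧ ∀ p : I, 0 < (p : ℝ) → (p : ℝ) < p₀ → ∀ g, IsSymmetric γ g →
      t ≤ homDensity H g →
        ∃ g', t ≤ homDensity H g' ∧ entropy (twoBlock γ 1 p p) g' < entropy (twoBlock γ 1 p p) g := by
  have hγt := ht0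
  rw [homDensity_twoBlock_one_zero_zero h0 h1 (by omega) hH] at hγt
  obtain ⟨s, hs0, rfl⟩ := exists_pow_card_eq V (lt_trans (by positivity) hγt)
  have hs1 : γ < s := lt_of_pow_lt_pow_left₀ _ hs0.le hγt
  have hs2 : s < 1 := lt_of_pow_lt_pow_left₀ (Fintype.card V) zero_le_one (by rwa [one_pow])
  obtain ⟨η, hη, hgap⟩ := exists_mass_gap H (t := s ^ Fintype.card V) (m := s ^ 2) h0 h1
    (isClosed_constraint 1 (γ = 1 / 2)) (by
      rintro ⟨a, b, c⟩ hC hq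
      rcases sq_lt_blockMass hd hH h0 h1 hs0 hq with h | ⟨rfl, rfl, rfl⟩ | ⟨rfl, rfl, rfl⟩ |
        ⟨rfl, rfl, rfl⟩
      · exact h
      · exact absurd ht0 (not_lt.2 hq)
      · have hγ : γ = 1 / 2 := hC.elim (fun h => absurd h (by simp)) fun h => h.2
        change _ ≤ homDensity H (twoBlock γ 0 0 1) at hq
        rw [homDensity_twoBlock_zero_zero_one h0 h1 (by omega) hH,
          show 1 - γ = γ by rw [hγ]; norm_num] at hq
        exact absurd hγt (not_lt.2 hq)
      · simp only [blockMass, Set.Icc.coe_one]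
        nlinarith)
  obtain ⟨p₀, hp₀, hlog⟩ := exists_log_threshold hη
  refine ⟨p₀, hp₀, fun p hp0 hpp g ⟨a, b, c, hg⟩ hgt => ?_⟩
  obtain ⟨hp2, hlogp⟩ := hlog p hp0 hpp
  have hp1 : (p : ℝ) < 1 := by linarith
  have hW := (isBlockReference_twoBlock (a := 1) (b := p) (c := p) h0 h1 hp0 hp1 (by simp) (by simp)
    (by simp)).values
  -- The exceptional placement: `g` equals 1 on part of {W = p}, where truncation helps. Finite
  -- entropy is not needed, since that argument starts from the maximum of `g` and the reference.
  by_cases hex : c = 1 ∧ γ < 1 / 2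
  · obtain ⟨rfl, hγ⟩ := hex
    refine exists_entropy_lt_of_volume_one H hp0 hp2 (fun x y => ?_) ht1 hgt fun hcon =>
        volume_eq_off_block_ne_zero h0 hγ hg (Or.inr rfl) (measure_mono_null ?_ hcon)
    · rw [twoBlock_apply]
      cases block γ x <;> cases block γ y <;> simp [blockValue]
    · rintro z ⟨hz1, hz2⟩
      refine ⟨hz1, ?_⟩
      rw [twoBlock_apply]
      revert hz2
      cases block γ z.1 <;> cases block γ z.2 <;> simp [blockValue]
  · refine ⟨twoBlock s 1 0 0, ?_, entropy_lt_of_gap hp0 hp2 hlogp hW (fun x y => ?_)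
      (fun x y h => ?_) fun hfin => ?_⟩
    · rw [homDensity_twoBlock_one_zero_zero hs0 hs2 (by omega) hH]
    · rw [twoBlock_apply]
      cases block s x <;> cases block s y <;> simp [blockValue]
    · rw [twoBlock_apply, twoBlock_apply] at *
      by_cases hx : (x : ℝ) ≤ γ <;> by_cases hy : (y : ℝ) ≤ γ <;>
        simp only [block, hx, hy, blockValue, decide_true, decide_false, Bool.and_self, Bool.not_true,
          Bool.not_false, Bool.and_false, Bool.and_true, if_true, if_false, Bool.false_eq_true] at h ⊢
      · simp [hx.trans hs1.le, hy.trans hs1.le]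
      all_goals exact absurd h (by rintro (h | h) <;> linarith)
    · rw [integral_twoBlock hs0 hs2, integral_eq_of_cutMetric_eq_zero hg, integral_twoBlock h0 h1]
      have hag := agreesOffOmega_of_entropy_ne_top hfin
      have hblock : EqOnBlock γ g true ((1 : I) : ℝ) := hag.eqOnBlock (Or.inr rfl) fun x y hx hy => by
        rw [twoBlock_apply, hx, hy]; rfl
      have hmem : (a, b, c) ∈ {q : I × I × I | q.1 = 1} ∪ {q : I × I × I | q.2.2 = 1 ∧ γ = 1 / 2} := by
        rcases eq_or_eq_of_eqOnBlock h0 h1 hg hblock with h | ⟨h, h'⟩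
        · exact Or.inl h
        · refine Or.inr ⟨h, le_antisymm h' (not_lt.1 fun h'' => hex ⟨h, h''⟩)⟩
      rw [homDensity_eq_of_cutMetric_eq_zero H hg] at hgt
      refine le_trans (le_of_eq ?_) (hgap (a, b, c) hmem hgt)
      simp [blockMass]

/-- Finite entropy fixes the values 1 and 0 on both block squares, so only `b` is free, up to
exchanging the blocks when γ = 1/2. The competitor is the hub of `exists_initialHub`, and no
exceptional placement remains. -/
theorem exists_entropy_lt_first_one_second_zero (hd : 2 ≤ d) (hH : H.IsRegularOfDegree d)
    (h0 : 0 < γ) (h1 : γ < 1) (ht0 : homDensity H (twoBlock γ 1 0 0) < t)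
    (ht1 : t < homDensity H (twoBlock γ 1 1 0)) :
    ∃ p₀ : ℝ, 0 < p₀ ∧ ∀ p : I, 0 < (p : ℝ) → (p : ℝ) < p₀ → ∀ g, IsSymmetric γ g →
      t ≤ homDensity H g →
        ∃ g', t ≤ homDensity H g' ∧ entropy (twoBlock γ 1 p 0) g' < entropy (twoBlock γ 1 p 0) g := by
  obtain ⟨r, hr0, hr1, hrt, hr⟩ := exists_initialHub hd hH h0 h1 ht0 ht1
  obtain ⟨η, hη, hgap⟩ := exists_mass_gap H (t := t) (m := γ ^ 2 + 2 * γ * r) h0 h1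
    (C := {q : I × I × I | q.1 = 1 ∧ q.2.2 = 0} ∪
      {q : I × I × I | q.1 = 0 ∧ q.2.2 = 1 ∧ γ = 1 / 2})
    (((isClosed_eq continuous_fst continuous_const).inter
      (isClosed_eq (continuous_snd.comp continuous_snd) continuous_const)).union
      ((isClosed_eq continuous_fst continuous_const).inter
      ((isClosed_eq (continuous_snd.comp continuous_snd) continuous_const).inter isClosed_const))) (by
      rintro ⟨a, b, c⟩ (⟨h2, h3⟩ | ⟨h2, h3, hγ⟩) hq
      · change a = 1 at h2
        change c = 0 at h3
        subst h2 h3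
        have h4 := mul_lt_mul_of_pos_left (hr b hq) h0
        simp only [blockMass, Set.Icc.coe_one, Set.Icc.coe_zero]
        linarith
      · change a = 0 at h2
        change c = 1 at h3
        subst h2 h3
        change t ≤ homDensity H (twoBlock γ 0 b 1) at hq
        rw [← homDensity_twoBlock_one_sub h0 h1, show 1 - γ = γ by rw [hγ]; norm_num] at hq
        have h4 := hr b hq
        simp only [blockMass, Set.Icc.coe_one, Set.Icc.coe_zero]
        rw [hγ] at h4 ⊢
        linarith)
  obtain ⟨p₀, hp₀, hlog⟩ := exists_log_threshold hη
  refine ⟨p₀, hp₀, fun p hp0 hpp g ⟨a, b, c, hg⟩ hgt => ?_⟩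
  obtain ⟨hp2, hlogp⟩ := hlog p hp0 hpp
  have hp1 : (p : ℝ) < 1 := by linarith
  have hW := (isBlockReference_twoBlock (a := 1) (b := p) (c := 0) h0 h1 hp0 hp1 (by simp) (by simp)
    (by simp)).values
  refine ⟨initialHub γ r, hrt, entropy_lt_of_gap hp0 hp2 hlogp hW (initialHub_eq_zero_or_one γ r)
      (fun x y h => ?_) fun hfin => ?_⟩
  · rw [initialHub_apply, twoBlock_apply] at *
    by_cases hx : (x : ℝ) ≤ γ <;> by_cases hy : (y : ℝ) ≤ γ <;>
      simp only [block, hx, hy, blockValue, decide_true, decide_false, Bool.and_self, Bool.not_true,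
        Bool.not_false, Bool.and_false, Bool.and_true, if_true, if_false, Bool.false_eq_true,
        zero_mul, Set.Icc.coe_zero] at h ⊢
    · simp [hx.trans (by linarith : γ ≤ γ + r), hy.trans (by linarith : γ ≤ γ + r)]
    all_goals exact absurd h (by rintro (h | h) <;> linarith)
  · rw [integral_initialHub h0 hr0 hr1, integral_eq_of_cutMetric_eq_zero hg, integral_twoBlock h0 h1]
    have hag := agreesOffOmega_of_entropy_ne_top hfin
    rw [homDensity_eq_of_cutMetric_eq_zero H hg] at hgt
    exact hgap (a, b, c) (values_of_eqOnBlock h0 h1 hg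
      (hag.eqOnBlock (Or.inr rfl) fun x y hx hy => by rw [twoBlock_apply, hx, hy]; rfl)
      (hag.eqOnBlock (Or.inl rfl) fun x y hx hy => by rw [twoBlock_apply, hx, hy]; rfl)) hgt

end cases

theorem homDensity_twoBlock_one_one_one {V : Type*} [Fintype V] (H : SimpleGraph V)
    [Fintype H.edgeSet] (γ : ℝ) : homDensity H (twoBlock γ 1 1 1) = 1 := by
  have h1 : ∀ x : V → I, ∏ e ∈ H.edgeFinset, edgeWeight (twoBlock γ 1 1 1) x e = 1 := fun x =>
    Finset.prod_eq_one fun e _ => by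
      induction e with
      | _ i j =>
        rw [edgeWeight_mk, twoBlock_apply]
        cases block γ (x i) <;> cases block γ (x j) <;> rfl
  rw [homDensity_eq]
  simp_rw [h1]
  simp

end Graphon

/-! ### The three cases assembled -/

theorem theorem1p6 {V : Type*} [Fintype V] [DecidableEq V] [Nonempty V]
    (H : SimpleGraph V) [DecidableRel H.Adj] (d : ℕ) (hd : 2 ≤ d)
    (hH : H.IsRegularOfDegree d) (γ : ℝ) (hγ0 : 0 < γ) (hγ1 : γ < 1) (t : ℝ)
    (W : I → Graphon)
    (hW :
      ((∀ p, W p = Graphon.twoBlock γ 0 p p) ∧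
        0 < t ∧ t < Graphon.homDensity H (Graphon.twoBlock γ 0 0 1)) ∨
      ((∀ p, W p = Graphon.twoBlock γ 1 p p) ∧
        Graphon.homDensity H (Graphon.twoBlock γ 1 0 0) < t ∧ t < 1) ∨
      ((∀ p, W p = Graphon.twoBlock γ 1 p 0) ∧
        Graphon.homDensity H (Graphon.twoBlock γ 1 0 0) < t ∧
        t < Graphon.homDensity H (Graphon.twoBlock γ 1 1 0))) :
    ∃ p₀ : ℝ, 0 < p₀ ∧ ∀ p : I, 0 < (p : ℝ) → (p : ℝ) < p₀ →
      (∃ m₁ m₂ : ℝ≥0∞,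
        IsLeast {r | ∃ g : Graphon, t ≤ Graphon.homDensity H g ∧
          r = Graphon.rate (W p) g} m₁ ∧
        IsLeast {r | ∃ g : Graphon, Graphon.IsSymmetric γ g ∧ t ≤ Graphon.homDensity H g ∧
          r = Graphon.rate (W p) g} m₂ ∧
        m₁ < m₂) ∧
      (∀ g : Graphon, Graphon.IsOptimizer H (W p) t g → ¬ Graphon.IsSymmetric γ g) := by
  rcases hW with ⟨hW, ht0, ht1⟩ | ⟨hW, ht0, ht1⟩ | ⟨hW, ht0, ht1⟩
  · obtain ⟨p₀, hp₀, himp⟩ := Graphon.exists_entropy_lt_first_zero hd hH hγ0 hγ1 ht0 ht1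
    refine ⟨min p₀ 1, lt_min hp₀ one_pos, fun p hp hpp => ?_⟩
    rw [hW p]
    exact Graphon.rate_optimizers_not_symmetric H
      (Graphon.isBlockReference_twoBlock hγ0 hγ1 hp (hpp.trans_le (min_le_right _ _)) (by simp)
        (by simp) (by simp))
      ⟨0, 0, 1, ht1.le⟩ (himp p hp (hpp.trans_le (min_le_left _ _)))
  · obtain ⟨p₀, hp₀, himp⟩ := Graphon.exists_entropy_lt_first_one hd hH hγ0 hγ1 ht0 ht1
    refine ⟨min p₀ 1, lt_min hp₀ one_pos, fun p hp hpp => ?_⟩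
    rw [hW p]
    exact Graphon.rate_optimizers_not_symmetric H
      (Graphon.isBlockReference_twoBlock hγ0 hγ1 hp (hpp.trans_le (min_le_right _ _)) (by simp)
        (by simp) (by simp))
      ⟨1, 1, 1, ht1.le.trans_eq (Graphon.homDensity_twoBlock_one_one_one H γ).symm⟩
      (himp p hp (hpp.trans_le (min_le_left _ _)))
  · obtain ⟨p₀, hp₀, himp⟩ :=
      Graphon.exists_entropy_lt_first_one_second_zero hd hH hγ0 hγ1 ht0 ht1
    refine ⟨min p₀ 1, lt_min hp₀ one_pos, fun p hp hpp => ?_⟩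
    rw [hW p]
    exact Graphon.rate_optimizers_not_symmetric H
      (Graphon.isBlockReference_twoBlock hγ0 hγ1 hp (hpp.trans_le (min_le_right _ _)) (by simp)
        (by simp) (by simp))
      ⟨1, 1, 0, ht1.le⟩ (himp p hp (hpp.trans_le (min_le_left _ _)))
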